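/- Let $\mathbb{T}$ be the infinite random recursive tree on $\mathbb{N}=\{1,2,\dots\}$: $1$ is the root, and each $i\ge 2$ chooses its parent uniformly in $\{1,\dots,i-1\}$, independently of the other vertices. Let $(\epsilon_i)_{i\ge2}$ be i.i.d. standard exponential variables, independent of $\mathbb{T}$; the edge between $i$ and its parent is removed at time $\epsilon_i$. For $t\ge 0$ let $\Pi(t)$ be the partition of $\mathbb{N}$ into the vertex sets of the connected components remaining at time $t$, with blocks $\Pi_1(t),\Pi_2(t),\dots$ listed in increasing order of their smallest elements (and $\Pi_i(t)=\emptyset$ if there are fewer than $i$ blocks). The weight of the $i$-th block is $$X_i(t)=\lim_{n\to\infty} n^{-\mathrm{e}^{-t}}\,\#\{j\le n: j\in\Pi_i(t)\}.$$ For $0<q<\infty$ let $\ell^{q\downarrow}$ be the space of sequences $x_1\ge x_2\ge\dots\ge 0$ with $\sum_i x_i^q<\infty$, endowed with the $\ell^q$-distance, and let $\ell^{\infty\downarrow}$ be the space of decreasing sequences of nonnegative reals, endowed with the $\ell^\infty$-distance. Let $T\in(0,\infty]$ and $q=\mathrm{e}^T$ (with $\mathrm{e}^\infty=\infty$). For every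 $t\in[0,T)$, almost surely, the limit $X_i(t)$ exists for every $i$ and lies in $(0,\infty)$ whenever $\Pi_i(t)\ne\emptyset$, the sequence $(X_i(t))_{i\ge1}$ can be ranked in decreasing order (with multiplicities), and the resulting sequence $\mathbf{X}^\downarrow(t)$ belongs to $\ell^{q\downarrow}$. The $\ell^{q\downarrow}$-valued process $(\mathbf{X}^\downarrow(t):0\le t<T)$ is Markovian, and its transition probabilities are as follows. For $s,t\ge 0$ with $s+t<T$, the conditional law of $\mathbf{X}^\downarrow(s+t)$ given $(\mathbf{X}^\downarrow(r):0\le r\le s)$, on $\mathbf{X}^\downarrow(s)=(x_1,x_2,\dots)$, is the law of the decreasing rearrangement of the family $$\bigl(x_i^{\mathrm{e}^{-t}}x_j^{(i)} : i,j\in\mathbb{N}\bigr),$$ where $(x_1^{(i)},x_2^{(i)},\dots)$, $i\in\mathbb{N}$, are independent random elements of $\ell^{q\downarrow}$, each distributed as $\mathbf{X}^\downarrow(t)$. For almost every value $(x_i)$ of $\mathbf{X}^\downarrow(s)$ this rearrangement almost surely exists and belongs to $\ell^{q\downarrow}$. -/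

import Mathlib

open MeasureTheory ProbabilityTheory Filter Topology
open scoped ENNReal

/-! ### The random recursive tree and its destruction

Vertices are labelled `0, 1, 2, …`: vertex `j` is the `(j + 1)`-st vertex to be incorporated and
`0` is the root. Edge number `k` joins the non-root vertex `k + 1` to its parent `u k`. -/

/-- `u k` is the parent of vertex `k + 1` and `ε k` the time at which the edge between them is
removed. The parent of vertex `k + 1` is uniform on the `k + 1` earlier vertices `{0, …, k}`, the
parents are independent, the removal times are i.i.d. standard exponential, and the sequence of
removal times is independent of the tree. -/
structure IsRecursiveTreeDestruction {Ω : Type*} [MeasurableSpace Ω] (P : Measure Ω)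
    (u : ℕ → Ω → ℕ) (ε : ℕ → Ω → ℝ) : Prop where
  measurable_parent : ∀ k, Measurable (u k)
  measurable_time : ∀ k, Measurable (ε k)
  law_parent : ∀ k, P.map (u k) = uniformOn (Set.Iic k)
  law_time : ∀ k, P.map (ε k) = expMeasure 1
  indep_parent : iIndepFun u P
  indep_time : iIndepFun ε P
  indep_parent_time : IndepFun (fun ω k => u k ω) (fun ω k => ε k ω) P

/-- What is left of the tree with parents `u` at time `t`: the edges whose removal time
exceeds `t`. -/
def remainingForest (u : ℕ → ℕ) (ε : ℕ → ℝ) (t : ℝ) : SimpleGraph ℕ :=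
  SimpleGraph.fromRel fun i j => ∃ k, i = k + 1 ∧ j = u k ∧ t < ε k

/-- The partition of the vertex set into the connected components at time `t`. -/
def clusterPartition (u : ℕ → ℕ) (ε : ℕ → ℝ) (t : ℝ) : Setoid ℕ :=
  (remainingForest u ε t).reachableSetoid

/-- `m` is the smallest element of its block. -/
def IsBlockMin (π : Setoid ℕ) (m : ℕ) : Prop := ∀ l, π m l → m ≤ l

/-- The blocks of a partition, listed in increasing order of their smallest elements: `block π i`
is the block such that exactly `i` blocks have a smaller minimum. It is empty if `π` has at most
`i` blocks. -/
def block (π : Setoid ℕ) (i : ℕ) : Set ℕ :=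
  {j | ∃ m, IsBlockMin π m ∧ {l | l < m ∧ IsBlockMin π l}.ncard = i ∧ π m j}

/-! ### Weights -/

/-- The proportion, at scale `n ^ (e ^ (-t))`, of the first `n` vertices which belong to `B`. -/
noncomputable def scaledCount (t : ℝ) (B : Set ℕ) (n : ℕ) : ℝ :=
  (n : ℝ) ^ (-Real.exp (-t)) * (({j | j < n ∧ j ∈ B}.ncard : ℕ) : ℝ)

/-- The set `B`, considered at time `t`, has weight `w`. -/
def HasWeight (t : ℝ) (B : Set ℕ) (w : ℝ) : Prop :=
  Tendsto (scaledCount t B) atTop (𝓝 w)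

/-- The weight at time `t` of a set of vertices. -/
noncomputable def weight (t : ℝ) (B : Set ℕ) : ℝ := limUnder atTop (scaledCount t B)

/-- The weight `X_i(t)` of the `i`-th block of the partition at time `t`. -/
noncomputable def blockWeight (u : ℕ → ℕ) (ε : ℕ → ℝ) (t : ℝ) (i : ℕ) : ℝ :=
  weight t (block (clusterPartition u ε t) i)

/-! ### Decreasing rearrangements -/

/-- `y` is the decreasing rearrangement of the family `x` of nonnegative reals: `y` is decreasing
and each positive value occurs in `y` as many times as in `x` (if `x` has only finitely many
positive terms, `y` is completed by zeros). -/
def IsDecreasingRearrangement {ι : Type*} (y : ℕ → ℝ) (x : ι → ℝ) : Prop :=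
  Antitone y ∧ (∀ n, 0 ≤ y n) ∧ ∀ r : ℝ, 0 < r → {n | y n = r}.encard = {i | x i = r}.encard

/-- The decreasing rearrangement of a family of nonnegative reals: its `k`-th term (counted from
`0`) is the largest number which is exceeded or attained by more than `k` terms of the family. -/
noncomputable def decRearr {ι : Type*} (x : ι → ℝ) (k : ℕ) : ℝ :=
  (⨆ (F : Finset ι) (_ : k < F.card), ⨅ i ∈ F, ENNReal.ofReal (x i)).toReal

/-! ### The space of decreasing `q`-summable sequences -/

/-- The space of decreasing sequences of nonnegative reals in `ℓ^q` (bounded ones if `q = ∞`),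
with the `ℓ^q`-distance and its Borel σ-algebra. -/
def LqDown (q : ℝ≥0∞) : Type :=
  {x : lp (fun _ : ℕ => ℝ) q // Antitone (fun i => x i) ∧ ∀ i, 0 ≤ x i}

namespace LqDown

instance (q : ℝ≥0∞) : CoeFun (LqDown q) (fun _ => ℕ → ℝ) := ⟨fun x i => x.1 i⟩

noncomputable instance (q : ℝ≥0∞) [Fact (1 ≤ q)] : MetricSpace (LqDown q) :=
  inferInstanceAs
    (MetricSpace {x : lp (fun _ : ℕ => ℝ) q // Antitone (fun i => x i) ∧ ∀ i, 0 ≤ x i})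

noncomputable instance (q : ℝ≥0∞) [Fact (1 ≤ q)] : MeasurableSpace (LqDown q) := borel _

instance (q : ℝ≥0∞) [Fact (1 ≤ q)] : BorelSpace (LqDown q) := ⟨rfl⟩

/-- The sequences which are elements of `LqDown q`. -/
def seqs (q : ℝ≥0∞) : Set (ℕ → ℝ) := {y | Antitone y ∧ (∀ i, 0 ≤ y i) ∧ Memℓp y q}

open Classical in
/-- A sequence as an element of `LqDown q`; the zero sequence if it is not one. -/
noncomputable def ofSeq (q : ℝ≥0∞) (y : ℕ → ℝ) : LqDown q :=
  if h : y ∈ seqs q then ⟨⟨y, h.2.2⟩, h.1, h.2.1⟩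
  else ⟨0, fun _ _ _ => le_rfl, fun _ => le_rfl⟩

end LqDown

instance one_le_exp_of_pos (T : EReal) [h : Fact (0 < T)] : Fact (1 ≤ EReal.exp T) :=
  ⟨by simpa using h.out.le⟩

/-- The process `X↓` of the ranked weights, with values in `LqDown q`. -/
noncomputable def rankedWeights {Ω : Type*} (q : ℝ≥0∞) (u : ℕ → Ω → ℕ) (ε : ℕ → Ω → ℝ)
    (t : ℝ) (ω : Ω) : LqDown q :=
  LqDown.ofSeq q (decRearr (blockWeight (fun k => u k ω) (fun k => ε k ω) t))

/-! ### The Markov property -/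

/-- The family `(x_i ^ (e ^ (-t)) * x_j^(i) : i, j)`. -/
noncomputable def fragFamily {q : ℝ≥0∞} (t : ℝ) (x : LqDown q) (z : ℕ → LqDown q) :
    ℕ × ℕ → ℝ :=
  fun p => x p.1 ^ Real.exp (-t) * z p.1 p.2

/-- The law of the decreasing rearrangement of `(x_i ^ (e ^ (-t)) * x_j^(i) : i, j)`, where the
`x^(i)` are independent with law `ν`. -/
noncomputable def fragLaw {q : ℝ≥0∞} [Fact (1 ≤ q)] (t : ℝ) (ν : Measure (LqDown q))
    (x : LqDown q) : Measure (LqDown q) :=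
  (Measure.infinitePi fun _ : ℕ => ν).map fun z => LqDown.ofSeq q (decRearr (fragFamily t x z))

/-- The process `(X t : t ∈ I)`, where `I` is a set of nonnegative times, is Markovian (with
respect to its own history) with transition probabilities `K t x`. -/
structure IsMarkovWith {Ω E : Type*} [MeasurableSpace Ω] [MeasurableSpace E] (P : Measure Ω)
    (I : Set ℝ) (X : ℝ → Ω → E) (K : ℝ → E → Measure E) : Prop where
  measurable_process : ∀ t ∈ I, Measurable (X t)
  measurable_transition : ∀ t ∈ I, Measurable (K t)
  isProbabilityMeasure_transition : ∀ t ∈ I, ∀ x, IsProbabilityMeasure (K t x)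
  markov : ∀ s t : ℝ, 0 ≤ s → 0 ≤ t → s + t ∈ I → ∀ B : Set E, MeasurableSet B →
    P⟦X (s + t) ⁻¹' B | ⨆ r ∈ Set.Icc 0 s, MeasurableSpace.comap (X r) inferInstance⟧
      =ᵐ[P] fun ω => (K t (X s ω)).real B

/-! The proof has an analytic half (existence and summability of the weights) and a probabilistic
half (the branching structure).

Weights. Fix `t` and follow the cluster whose smallest vertex is `m`. If it has `N` vertices among
`0, …, k`, vertex `k + 1` joins it with probability `e^{-t} N / (k + 1)`. For every `c > -1`, the
potential `growthPotential c N`, of order `N^c`, is multiplied by `1 + c / N` when the cluster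
grows. Its conditional mean is therefore multiplied by `1 + e^{-t} c / (k + 1)`, whatever `N` is,
and after division by `growth (e^{-t} c) k` it is a nonnegative martingale. The exponent `c = 1`
gives convergence of the rescaled size, `c = -1/2` shows that the limit is positive, and `c = p`
bounds the `p`-th moment of the weight by a multiple of `(m + 1)^{-e^{-t} p}`. Summing over `m`, the
`p`-th power sum of the weights has finite mean as soon as `p > e^t`
(`lintegral_powerSum_vertexWeight_ne_top`). For `t < T` some such `p` satisfies `p ≤ e^T`.

Branching. Given the clusters at time `s`, the trees inside them are independent recursive trees
and, by memorylessness, their residual removal times are again exponential. This is expressed by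
resampling: `splice s a b` replaces the tree inside each cluster of `a` by an independent tree `b
m`, and `measurePreserving_splice` says that the result is again a recursive tree with its removal
times. Splicing does not change the partitions up to time `s`. The clusters at time `s + t` are the
clusters of the `b m` at time `t`, carried into the clusters of `a`. A cluster with about `w
n^{e^{-s}}` vertices below `n`, split by a tree in which a block has weight `w'`, yields a block
with about `w' (w n^{e^{-s}})^{e^{-t}}` vertices, hence of weight `w^{e^{-t}} w'`
(`hasWeight_splice`).

The clusters are indexed by their smallest vertex throughout. The passage to ranked sequences uses
that `decRearr` sees only the positive terms with their multiplicities (`SamePositive.decRearr_eq`),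
and that the law of the fragments is unchanged when the independent, identically distributed trees
are relabelled (`map_rankedProduct_eq`). The Markov property then follows from Fubini's theorem for
the pair `(a, b)` (`measure_splice_inter`). -/

theorem tsum_subtype_pos (f : ℝ → ℝ≥0∞) (hf : ∀ r ≤ 0, f r = 0) {ι : Type*} (x : ι → ℝ) :
    ∑' i : {i // 0 < x i}, f (x i) = ∑' i, f (x i) := by
  refine tsum_subtype_eq_of_support_subset (s := {i | 0 < x i}) (f := fun i => f (x i)) ?_
  intro i hi
  by_contra hcon
  exact hi (hf _ (not_lt.1 hcon))

/-! ### Families with the same positive terms -/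

/-- The families `x` and `y` have the same positive terms, with the same multiplicities. -/
def SamePositive {ι κ : Type*} (x : ι → ℝ) (y : κ → ℝ) : Prop :=
  ∃ e : {i // 0 < x i} ≃ {j // 0 < y j}, ∀ i, y (e i) = x i

namespace SamePositive

variable {ι κ : Type*} {x : ι → ℝ} {y : κ → ℝ}

theorem symm (h : SamePositive x y) : SamePositive y x := by
  obtain ⟨e, he⟩ := h
  refine ⟨e.symm, fun j => ?_⟩
  rw [← he, Equiv.apply_symm_apply]

theorem tsum_eq (h : SamePositive x y) (f : ℝ → ℝ≥0∞) (hf : ∀ r ≤ 0, f r = 0) :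
    ∑' i, f (x i) = ∑' j, f (y j) := by
  obtain ⟨e, he⟩ := h
  rw [← tsum_subtype_pos f hf x, ← tsum_subtype_pos f hf y, ← e.tsum_eq (fun j => f (y j))]
  exact tsum_congr fun i => by rw [he]

/-- A finite set containing a nonpositive term contributes infimum `0`, so only sets of positive
terms matter, and these are carried over by the bijection. -/
theorem iSup_finset_le (h : SamePositive x y) (k : ℕ) :
    (⨆ (F : Finset ι) (_ : k < F.card), ⨅ i ∈ F, ENNReal.ofReal (x i)) ≤
      ⨆ (F : Finset κ) (_ : k < F.card), ⨅ i ∈ F, ENNReal.ofReal (y i) := by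
  obtain ⟨e, he⟩ := h
  refine iSup₂_le fun F hF => ?_
  by_cases hpos : ∀ i ∈ F, 0 < x i
  · let g : {i // i ∈ F} ↪ κ :=
      ⟨fun i => e ⟨i, hpos i i.2⟩, fun i j hij => by
        have := e.injective (Subtype.ext hij)
        exact Subtype.ext (by simpa using this)⟩
    refine le_iSup₂_of_le (F.attach.map g) (by simpa using hF) ?_
    refine le_iInf₂ fun j hj => ?_
    obtain ⟨i, -, rfl⟩ := Finset.mem_map.1 hj
    refine (iInf₂_le i.1 i.2).trans (le_of_eq ?_)
    change _ = ENNReal.ofReal (y (e _))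
    rw [he]
  · push Not at hpos
    obtain ⟨i, hi, hxi⟩ := hpos
    refine (iInf₂_le i hi).trans ?_
    simp [ENNReal.ofReal_of_nonpos hxi]

theorem decRearr_eq (h : SamePositive x y) : decRearr x = decRearr y := by
  funext k
  exact congrArg ENNReal.toReal (le_antisymm (h.iSup_finset_le k) (h.symm.iSup_finset_le k))

/-- Finiteness turns equal cardinals of the fibres over a positive value `r` into a bijection; these
bijections are glued over all `r`. -/
theorem of_encard_eq (hfin : ∀ r : ℝ, 0 < r → {i | x i = r}.Finite)
    (h : ∀ r : ℝ, 0 < r → {i | x i = r}.encard = {j | y j = r}.encard) : SamePositive x y := by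
  let X : {i // 0 < x i} → {r : ℝ // 0 < r} := fun i => ⟨x i, i.2⟩
  let Y : {j // 0 < y j} → {r : ℝ // 0 < r} := fun j => ⟨y j, j.2⟩
  have eX : ∀ r, {i // X i = r} ≃ {i | x i = r.1} := fun r =>
    { toFun := fun i => ⟨i.1.1, congrArg Subtype.val i.2⟩
      invFun := fun i => ⟨⟨i.1, i.2.symm ▸ r.2⟩, Subtype.ext i.2⟩
      left_inv := fun i => rfl
      right_inv := fun i => rfl }
  have eY : ∀ r, {i // Y i = r} ≃ {i | y i = r.1} := fun r =>
    { toFun := fun i => ⟨i.1.1, congrArg Subtype.val i.2⟩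
      invFun := fun i => ⟨⟨i.1, i.2.symm ▸ r.2⟩, Subtype.ext i.2⟩
      left_inv := fun i => rfl
      right_inv := fun i => rfl }
  have eXY : ∀ r : {r : ℝ // 0 < r}, Nonempty ({i | x i = r.1} ≃ {j | y j = r.1}) := fun r => by
    have hx := hfin r r.2
    have hy : {j | y j = r.1}.Finite :=
      Set.encard_lt_top_iff.1 (h r r.2 ▸ Set.encard_lt_top_iff.2 hx)
    have := hx.to_subtype
    have := hy.to_subtype
    rw [← Finite.card_eq, Nat.card_coe_set_eq, Nat.card_coe_set_eq, Set.ncard, Set.ncard, h r r.2]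
  let e := (Equiv.sigmaFiberEquiv X).symm.trans ((Equiv.sigmaCongrRight fun r =>
    (eX r).trans ((Classical.choice (eXY r)).trans (eY r).symm)).trans (Equiv.sigmaFiberEquiv Y))
  refine ⟨e, fun i => ?_⟩
  have : Y (e i) = X i := by
    have h1 := (((Equiv.sigmaCongrRight fun r =>
      (eX r).trans ((Classical.choice (eXY r)).trans (eY r).symm))
        ((Equiv.sigmaFiberEquiv X).symm i)).2).2
    exact h1
  exact congrArg Subtype.val this

end SamePositive

/-! ### Decreasing rearrangements of families with finitely many large terms -/

section DecRearr

variable {ι : Type*} {x : ι → ℝ}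

/-- Only finitely many terms lie in `[r / 2, r)`, so the values do not accumulate at `r` from below.
Such gaps make the suprema defining `decRearr` comparable with counts of terms. -/
theorem exists_lt_forall_le_of_finite (hx : ∀ r : ℝ, 0 < r → {i | r ≤ x i}.Finite) {r : ℝ}
    (hr : 0 < r) : ∃ r' < r, ∀ i, x i < r → x i ≤ r' := by
  have hA : (insert (r / 2) (x '' {i | r / 2 ≤ x i ∧ x i < r})).Finite :=
    ((((hx (r / 2) (by positivity)).subset fun i hi => hi.1)).image x).insert _
  obtain ⟨a, ha, hmax⟩ := Set.exists_max_image _ id hA ⟨_, Set.mem_insert _ _⟩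
  refine ⟨a, ?_, fun i hi => ?_⟩
  · rcases ha with rfl | ⟨i, hi, rfl⟩
    · linarith
    · exact hi.2
  · by_cases h2 : r / 2 ≤ x i
    · exact hmax _ (Set.mem_insert_of_mem _ ⟨i, ⟨h2, hi⟩, rfl⟩)
    · exact (not_le.1 h2).le.trans (hmax _ (Set.mem_insert _ _))

theorem exists_gt_forall_le_of_finite (hx : ∀ r : ℝ, 0 < r → {i | r ≤ x i}.Finite) {r : ℝ}
    (hr : 0 < r) : ∃ r' > r, ∀ i, r < x i → r' ≤ x i := by
  have hA : (insert (r + 1) (x '' {i | r < x i})).Finite :=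
    ((((hx r hr).subset fun i (hi : r < x i) => hi.le)).image x).insert _
  obtain ⟨a, ha, hmin⟩ := Set.exists_min_image _ id hA ⟨_, Set.mem_insert _ _⟩
  refine ⟨a, ?_, fun i hi => hmin _ (Set.mem_insert_of_mem _ ⟨i, hi, rfl⟩)⟩
  rcases ha with rfl | ⟨i, hi, rfl⟩
  · exact lt_add_one r
  · exact hi

/-- If at most `k` terms reach `r`, a set of more than `k` indices contains a term below `r`, hence
below the gap; the supremum then stays strictly under `r`. -/
theorem ofReal_le_iSup_finset_iff (hx : ∀ r : ℝ, 0 < r → {i | r ≤ x i}.Finite) {r : ℝ}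
    (hr : 0 < r) (k : ℕ) :
    ENNReal.ofReal r ≤ (⨆ (F : Finset ι) (_ : k < F.card), ⨅ i ∈ F, ENNReal.ofReal (x i)) ↔
      k < {i | r ≤ x i}.ncard := by
  constructor
  · intro h
    by_contra hcon
    obtain ⟨r', hr', hgap⟩ := exists_lt_forall_le_of_finite hx hr
    refine absurd (h.trans (iSup₂_le fun F hF => ?_ : _ ≤ ENNReal.ofReal r'))
      (not_le.2 ((ENNReal.ofReal_lt_ofReal_iff hr).2 hr'))
    obtain ⟨i, hi, hlt⟩ : ∃ i ∈ F, x i < r := by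
      by_contra! hall
      have := Set.ncard_le_ncard (show (F : Set ι) ⊆ {i | r ≤ x i} from hall) (hx r hr)
      rw [Set.ncard_coe_finset] at this
      omega
    exact (iInf₂_le i hi).trans (ENNReal.ofReal_le_ofReal (hgap i hlt))
  · intro h
    refine le_iSup₂_of_le (hx r hr).toFinset (by rwa [← Set.ncard_eq_toFinset_card _ (hx r hr)]) ?_
    exact le_iInf₂ fun i hi => ENNReal.ofReal_le_ofReal (by simpa using hi)

theorem iSup_finset_ne_top (hx : ∀ r : ℝ, 0 < r → {i | r ≤ x i}.Finite) (k : ℕ) :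
    (⨆ (F : Finset ι) (_ : k < F.card), ⨅ i ∈ F, ENNReal.ofReal (x i)) ≠ ⊤ := by
  obtain ⟨M, hM⟩ := ((hx 1 one_pos).image x).bddAbove
  have hpos : (0 : ℝ) < max M 1 + 1 := by positivity
  have hempty : {i | max M 1 + 1 ≤ x i} = ∅ := by
    ext i
    simp only [Set.mem_ofPred_eq, Set.mem_empty_iff_false, iff_false, not_le]
    by_cases h1 : 1 ≤ x i
    · exact lt_of_le_of_lt ((hM ⟨i, h1, rfl⟩).trans (le_max_left M 1)) (lt_add_one _)
    · have := le_max_right M 1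
      linarith
  intro htop
  have := (ofReal_le_iSup_finset_iff hx hpos k).1 (htop ▸ le_top)
  simp [hempty] at this

theorem le_decRearr_iff (hx : ∀ r : ℝ, 0 < r → {i | r ≤ x i}.Finite) {r : ℝ}
    (hr : 0 < r) (k : ℕ) : r ≤ decRearr x k ↔ k < {i | r ≤ x i}.ncard := by
  rw [← ofReal_le_iSup_finset_iff hx hr, decRearr,
    ENNReal.ofReal_le_iff_le_toReal (iSup_finset_ne_top hx k)]

theorem lt_decRearr_iff (hx : ∀ r : ℝ, 0 < r → {i | r ≤ x i}.Finite) {r : ℝ}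
    (hr : 0 < r) (k : ℕ) : r < decRearr x k ↔ k < {i | r < x i}.ncard := by
  constructor
  · intro h
    refine ((le_decRearr_iff hx (hr.trans h) k).1 le_rfl).trans_le
      (Set.ncard_le_ncard (fun i hi => h.trans_le hi)
        ((hx r hr).subset fun i (hi : r < x i) => hi.le))
  · intro h
    obtain ⟨r', hr', hgap⟩ := exists_gt_forall_le_of_finite hx hr
    refine hr'.trans_le ((le_decRearr_iff hx (hr.trans hr') k).2 (h.trans_le ?_))
    exact Set.ncard_le_ncard (fun i hi => hgap i hi) (hx r' (hr.trans hr'))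

theorem decRearr_nonneg (x : ι → ℝ) (k : ℕ) : 0 ≤ decRearr x k := ENNReal.toReal_nonneg

theorem isDecreasingRearrangement_decRearr (hx : ∀ r : ℝ, 0 < r → {i | r ≤ x i}.Finite) :
    IsDecreasingRearrangement (decRearr x) x := by
  refine ⟨fun k l hkl => ?_, decRearr_nonneg x, fun r hr => ?_⟩
  · refine ENNReal.toReal_mono (iSup_finset_ne_top hx k) (iSup₂_le fun F hF => ?_)
    exact le_iSup₂_of_le F (hkl.trans_lt hF) le_rfl
  · have h1 : {n | decRearr x n = r} = Set.Ico {i | r < x i}.ncard {i | r ≤ x i}.ncard := by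
      ext n
      rw [Set.mem_ofPred_eq, Set.mem_Ico, ← le_decRearr_iff hx hr, ← not_lt, ← lt_decRearr_iff hx hr,
        not_lt, le_antisymm_iff]
    have hfin := hx r hr
    have hsub : {i | r < x i} ⊆ {i | r ≤ x i} := fun i (hi : r < x i) => hi.le
    have h2 : {i | x i = r} = {i | r ≤ x i} \ {i | r < x i} := by
      ext i
      simp only [Set.mem_ofPred_eq, Set.mem_sdiff, not_lt]
      exact ⟨fun h => ⟨h.ge, h.le⟩, fun h => le_antisymm h.2 h.1⟩
    rw [h1, h2, ← Finset.coe_Ico, Set.encard_coe_eq_coe_finsetCard, Nat.card_Ico,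
      ← (hfin.subset Set.sdiff_subset).cast_ncard_eq, Set.ncard_sdiff hsub (hfin.subset hsub)]

theorem samePositive_decRearr (hx : ∀ r : ℝ, 0 < r → {i | r ≤ x i}.Finite) :
    SamePositive (decRearr x) x := by
  have h := isDecreasingRearrangement_decRearr hx
  refine SamePositive.symm (SamePositive.of_encard_eq (fun r hr => ?_) fun r hr => (h.2.2 r hr).symm)
  exact (hx r hr).subset fun i hi => ge_of_eq hi

/-- The sum of the `p`-th powers of a family of nonnegative reals. -/
noncomputable def powerSum (p : ℝ) (x : ι → ℝ) : ℝ≥0∞ := ∑' i, ENNReal.ofReal (x i) ^ p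

theorem SamePositive.powerSum_eq {κ : Type*} {y : κ → ℝ} (h : SamePositive x y) {p : ℝ}
    (hp : 0 < p) : powerSum p x = powerSum p y :=
  h.tsum_eq (fun r => ENNReal.ofReal r ^ p) fun r hr => by
    simp [ENNReal.ofReal_of_nonpos hr, hp]

theorem finite_le_of_powerSum_ne_top {p : ℝ} (hp : 0 < p) (h : powerSum p x ≠ ⊤) (r : ℝ)
    (hr : 0 < r) : {i | r ≤ x i}.Finite := by
  refine (ENNReal.finite_const_le_of_tsum_ne_top h
    (ε := ENNReal.ofReal r ^ p) ?_).subset fun i hi => ?_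
  · simp [hr, hp, ENNReal.rpow_eq_zero_iff]
  · exact ENNReal.rpow_le_rpow (ENNReal.ofReal_le_ofReal hi) hp.le

theorem memℓp_of_powerSum_ne_top {p : ℝ} (hp : 0 < p) {q : ℝ≥0∞} (hpq : ENNReal.ofReal p ≤ q)
    {y : ℕ → ℝ} (hy : ∀ n, 0 ≤ y n) (h : powerSum p y ≠ ⊤) : Memℓp y q := by
  refine Memℓp.of_exponent_ge ?_ hpq
  have hp' : 0 < (ENNReal.ofReal p).toReal := by rwa [ENNReal.toReal_ofReal hp.le]
  refine memℓp_gen ?_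
  rw [ENNReal.toReal_ofReal hp.le]
  refine (ENNReal.summable_toReal h).congr fun n => ?_
  rw [ENNReal.ofReal_rpow_of_nonneg (hy n) hp.le, ENNReal.toReal_ofReal (by have := hy n; positivity),
    Real.norm_of_nonneg (hy n)]

theorem decRearr_mem_seqs {p : ℝ} (hp : 0 < p) {q : ℝ≥0∞} (hpq : ENNReal.ofReal p ≤ q)
    (h : powerSum p x ≠ ⊤) : decRearr x ∈ LqDown.seqs q := by
  have hx := finite_le_of_powerSum_ne_top hp h
  refine ⟨(isDecreasingRearrangement_decRearr hx).1, decRearr_nonneg x, ?_⟩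
  refine memℓp_of_powerSum_ne_top hp hpq (decRearr_nonneg x) ?_
  rwa [(samePositive_decRearr hx).powerSum_eq hp]

end DecRearr

/-! ### Measurability in the space of decreasing `q`-summable sequences -/

theorem measurable_decRearr {Ω ι : Type*} [MeasurableSpace Ω] [Countable ι] {x : Ω → ι → ℝ}
    (hx : ∀ i, Measurable fun ω => x ω i) (k : ℕ) : Measurable fun ω => decRearr (x ω) k := by
  refine ENNReal.measurable_toReal.comp ?_
  refine Measurable.iSup fun F => Measurable.iSup fun _ => ?_
  exact Measurable.iInf fun i => Measurable.iInf fun _ => (hx i).ennreal_ofReal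

namespace LqDown

theorem coe_ofSeq {q : ℝ≥0∞} {y : ℕ → ℝ} (hy : y ∈ seqs q) (i : ℕ) : ofSeq q y i = y i :=
  congrArg (fun x : LqDown q => x i) (dif_pos hy : ofSeq q y = _)

open Classical in
theorem ofSeq_apply {q : ℝ≥0∞} (y : ℕ → ℝ) (i : ℕ) :
    ofSeq q y i = if y ∈ seqs q then y i else 0 := by
  split_ifs with h
  · exact coe_ofSeq h i
  · exact congrArg (fun x : LqDown q => x i) (dif_neg h : ofSeq q y = _)

variable {Ω : Type*} [MeasurableSpace Ω] {q : ℝ≥0∞} [Fact (1 ≤ q)]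

theorem continuous_coe : Continuous fun x : LqDown q => x.1 := continuous_subtype_val

theorem measurable_coord (i : ℕ) : Measurable fun x : LqDown q => x i :=
  ((lp.evalCLM ℝ (fun _ : ℕ => ℝ) q i).continuous.comp continuous_coe).measurable

/-- This reduces Borel measurability to measurability of the coordinates. For `q = ⊤` truncation by
zeros fails and the ambient space is not separable. But a decreasing nonnegative sequence converges,
so continuing `x 0, …, x n` by the constant `x n` is within `x n - inf x` of `x` in the uniform
norm. -/
theorem exists_continuous_approximation (q : ℝ≥0∞) [Fact (1 ≤ q)] :
    ∃ c : ∀ n : ℕ, (Fin (n + 1) → ℝ) → lp (fun _ : ℕ => ℝ) q, (∀ n, Continuous (c n)) ∧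
      ∀ x : LqDown q, Tendsto (fun n => c n fun i => x i) atTop (𝓝 x.1) := by
  have hsingle : ∀ i : ℕ, Continuous fun r : ℝ => (lp.single q i r : lp (fun _ : ℕ => ℝ) q) :=
    fun i => (lp.singleContinuousLinearMap ℝ (fun _ : ℕ => ℝ) q i).continuous
  by_cases hq : q = ⊤
  · subst hq
    refine ⟨fun n v => v (Fin.last n) • (1 : lp (fun _ : ℕ => ℝ) ⊤) +
      ∑ i : Fin (n + 1), lp.single ⊤ (i : ℕ) (v i - v (Fin.last n)), fun n => ?_, fun x => ?_⟩
    · refine ((continuous_apply _).smul continuous_const).add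
        (continuous_finsetSum _ fun i _ => (hsingle i).comp ?_)
      fun_prop
    · have hbdd : BddBelow (Set.range fun i => x i) := ⟨0, by
        rintro _ ⟨i, rfl⟩
        exact x.2.2 i⟩
      have hlim := tendsto_atTop_ciInf x.2.1 hbdd
      set c := ⨅ i, x i
      have hc : ∀ i, c ≤ x i := fun i => ciInf_le hbdd i
      rw [tendsto_iff_norm_sub_tendsto_zero]
      refine squeeze_zero (fun _ => norm_nonneg _) (fun n => ?_)
        (by simpa using hlim.sub_const c)
      have hn : 0 ≤ x n - c := sub_nonneg.2 (hc n)
      refine lp.norm_le_of_forall_le hn fun j => ?_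
      have hval : ((x n) • (1 : lp (fun _ : ℕ => ℝ) ⊤) +
          ∑ i : Fin (n + 1), lp.single ⊤ (i : ℕ) (x i - x n) - x.1 : lp (fun _ : ℕ => ℝ) ⊤) j =
          x n + (if j < n + 1 then x j - x n else 0) - x j := by
        have hsum : (∑ i : Fin (n + 1), lp.single ⊤ (i : ℕ) (x i - x n) :
            lp (fun _ : ℕ => ℝ) ⊤) j = if j < n + 1 then x j - x n else 0 := by
          rw [Fin.sum_univ_eq_sum_range (fun i => (lp.single ⊤ i (x i - x n) :
            lp (fun _ : ℕ => ℝ) ⊤)) (n + 1), lp.coeFn_sum, Finset.sum_apply]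
          simp only [lp.single_apply, Pi.single_apply]
          rw [Finset.sum_ite_eq]
          simp
        rw [lp.coeFn_sub, Pi.sub_apply, lp.coeFn_add, Pi.add_apply, hsum, lp.coeFn_smul,
          Pi.smul_apply, lp.infty_coeFn_one]
        simp
      refine (congrArg norm hval).trans_le ?_
      split_ifs with hj
      · simpa using hn
      · rw [add_zero, Real.norm_of_nonneg (sub_nonneg.2 (x.2.1 (by omega)))]
        linarith [hc j]
  · refine ⟨fun n v => ∑ i : Fin (n + 1), lp.single q (i : ℕ) (v i), fun n => ?_, fun x => ?_⟩
    · exact continuous_finsetSum _ fun i _ => (hsingle i).comp (continuous_apply i)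
    · have h := (lp.hasSum_single hq x.1).tendsto_sum_nat.comp (tendsto_add_atTop_nat 1)
      refine h.congr fun n => ?_
      exact (Fin.sum_univ_eq_sum_range (fun i => (lp.single q i (x i) :
            lp (fun _ : ℕ => ℝ) q)) (n + 1)).symm

theorem measurable_of_coord {f : Ω → LqDown q} (hf : ∀ i, Measurable fun ω => f ω i) :
    Measurable f := by
  let _ : MeasurableSpace (lp (fun _ : ℕ => ℝ) q) := borel _
  have : BorelSpace (lp (fun _ : ℕ => ℝ) q) := ⟨rfl⟩
  obtain ⟨c, hc, hlim⟩ := exists_continuous_approximation q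
  have hval : Measurable fun ω => (f ω).1 := by
    refine measurable_of_tendsto_metrizable (f := fun n ω => c n fun i => f ω i) (fun n => ?_)
      (tendsto_pi_nhds.2 fun ω => hlim (f ω))
    exact (hc n).measurable.comp (measurable_pi_lambda _ fun i => hf i)
  intro S hS
  have hb : (borel (LqDown q)) = MeasurableSpace.comap Subtype.val
      (borel (lp (fun _ : ℕ => ℝ) q)) := borel_comap
  change MeasurableSet[borel (LqDown q)] S at hS
  rw [hb] at hS
  obtain ⟨S', hS', rfl⟩ := hS
  exact hval hS'

theorem measurableSet_mem_seqs {y : Ω → ℕ → ℝ} (hy : ∀ i, Measurable fun ω => y ω i) :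
    MeasurableSet {ω | y ω ∈ seqs q} := by
  have h1 : MeasurableSet {ω | Antitone (y ω)} := by
    have : {ω | Antitone (y ω)} = ⋂ n, {ω | y ω (n + 1) ≤ y ω n} := by
      ext ω
      simp only [Set.mem_ofPred_eq, Set.mem_iInter]
      exact ⟨fun h n => h n.le_succ, antitone_nat_of_succ_le⟩
    rw [this]
    exact MeasurableSet.iInter fun n => measurableSet_le (hy _) (hy _)
  have h2 : MeasurableSet {ω | ∀ i, 0 ≤ y ω i} := by
    rw [Set.ofPred_forall]
    exact MeasurableSet.iInter fun i => measurableSet_le measurable_const (hy i)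
  have h3 : MeasurableSet {ω | Memℓp (y ω) q} := by
    by_cases hq : q = ⊤
    · subst hq
      have : {ω | Memℓp (y ω) ⊤} = ⋃ C : ℕ, ⋂ i, {ω | ‖y ω i‖ ≤ C} := by
        ext ω
        simp only [Set.mem_ofPred_eq, Set.mem_iUnion, Set.mem_iInter, memℓp_infty_iff]
        constructor
        · rintro ⟨C, hC⟩
          obtain ⟨N, hN⟩ := exists_nat_ge C
          exact ⟨N, fun i => (hC ⟨i, rfl⟩).trans hN⟩
        · rintro ⟨C, hC⟩
          refine ⟨C, ?_⟩
          rintro _ ⟨i, rfl⟩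
          exact hC i
      rw [this]
      exact MeasurableSet.iUnion fun C => MeasurableSet.iInter fun i =>
        measurableSet_le (hy i).norm measurable_const
    · have hq' : 0 < q.toReal :=
        ENNReal.toReal_pos (zero_lt_one.trans_le Fact.out).ne' hq
      have : {ω | Memℓp (y ω) q} =
          ⋃ C : ℕ, ⋂ s : Finset ℕ, {ω | ∑ i ∈ s, ‖y ω i‖ ^ q.toReal ≤ C} := by
        ext ω
        simp only [Set.mem_ofPred_eq, Set.mem_iUnion, Set.mem_iInter, memℓp_gen_iff'' hq']
        constructor
        · rintro ⟨C, -, hC⟩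
          obtain ⟨N, hN⟩ := exists_nat_ge C
          exact ⟨N, fun i => (hC i).trans hN⟩
        · rintro ⟨C, hC⟩
          exact ⟨C, Nat.cast_nonneg C, hC⟩
      rw [this]
      refine MeasurableSet.iUnion fun C => MeasurableSet.iInter fun s => measurableSet_le ?_ measurable_const
      exact Finset.measurable_sum _ fun i _ => (hy i).norm.pow_const _
  exact h1.inter (h2.inter h3)

theorem measurable_ofSeq {y : Ω → ℕ → ℝ} (hy : ∀ i, Measurable fun ω => y ω i) :
    Measurable fun ω => ofSeq q (y ω) := by
  classical
  refine measurable_of_coord fun i => ?_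
  simp only [ofSeq_apply]
  exact Measurable.ite (measurableSet_mem_seqs hy) (hy i) measurable_const

theorem measurable_fragFamily (t : ℝ) (p : ℕ × ℕ) :
    Measurable fun w : LqDown q × (ℕ → LqDown q) => fragFamily t w.1 w.2 p := by
  refine Measurable.mul ?_ ?_
  · exact ((measurable_coord p.1).comp measurable_fst).pow_const _
  · exact (measurable_coord p.2).comp ((measurable_pi_apply p.1).comp measurable_snd)

theorem measurable_ofSeq_decRearr_fragFamily (t : ℝ) :
    Measurable fun w : LqDown q × (ℕ → LqDown q) => ofSeq q (decRearr (fragFamily t w.1 w.2)) :=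
  measurable_ofSeq fun k => measurable_decRearr (measurable_fragFamily t) k

theorem measurable_fragLaw (t : ℝ) (ν : Measure (LqDown q)) [IsProbabilityMeasure ν] :
    Measurable (fragLaw t ν) := by
  have h := measurable_ofSeq_decRearr_fragFamily (q := q) t
  have heq : fragLaw t ν = fun x => ((Measure.infinitePi fun _ : ℕ => ν).map (Prod.mk x)).map
      fun w : LqDown q × (ℕ → LqDown q) => ofSeq q (decRearr (fragFamily t w.1 w.2)) := by
    funext x
    rw [Measure.map_map h measurable_prodMk_left]
    rfl
  rw [heq]
  exact (Measure.measurable_map _ h).comp Measurable.map_prodMk_left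

theorem isProbabilityMeasure_fragLaw (t : ℝ) (ν : Measure (LqDown q)) [IsProbabilityMeasure ν]
    (x : LqDown q) : IsProbabilityMeasure (fragLaw t ν x) :=
  Measure.isProbabilityMeasure_map
    ((measurable_ofSeq_decRearr_fragFamily t).comp measurable_prodMk_left).aemeasurable

end LqDown

/-! ### Measurability of the ranked weights -/

theorem ncard_lt_and_eq_count (p : ℕ → Prop) [DecidablePred p] (n : ℕ) : {j | j < n ∧ p j}.ncard = Nat.count p n := by
  rw [Nat.count_eq_card_filter_range, ← Set.ncard_coe_finset]
  congr 1
  ext j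
  simp

section Measurability

variable {Ω : Type*} [MeasurableSpace Ω]

theorem measurableSet_reflTransGen {R : Ω → ℕ → ℕ → Prop}
    (hR : ∀ i j, MeasurableSet {ω | R ω i j}) (i j : ℕ) :
    MeasurableSet {ω | Relation.ReflTransGen (R ω) i j} := by
  -- `Q n j` is the event that `j` is reached from `i` in exactly `n` steps.
  let Q : ℕ → ℕ → Set Ω := fun n => Nat.rec (fun j => {_ω | i = j})
    (fun _ Qn j => ⋃ l, Qn l ∩ {ω | R ω l j}) n
  have hQ : ∀ n j, MeasurableSet (Q n j) := by
    intro n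
    induction n with
    | zero => exact fun j => MeasurableSet.const _
    | succ n ih => exact fun j => MeasurableSet.iUnion fun l => (ih l).inter (hR l j)
  have : {ω | Relation.ReflTransGen (R ω) i j} = ⋃ n, Q n j := by
    ext ω
    simp only [Set.mem_ofPred_eq, Set.mem_iUnion]
    constructor
    · intro h
      induction h with
      | refl => exact ⟨0, rfl⟩
      | tail _ hbc ih =>
        obtain ⟨n, hn⟩ := ih
        exact ⟨n + 1, Set.mem_iUnion.2 ⟨_, hn, hbc⟩⟩
    · rintro ⟨n, hn⟩
      induction n generalizing j with
      | zero =>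
        obtain rfl : i = j := hn
        exact Relation.ReflTransGen.refl
      | succ n ih =>
        obtain ⟨l, hl, hlj⟩ := Set.mem_iUnion.1 hn
        exact (ih l hl).tail hlj
  rw [this]
  exact MeasurableSet.iUnion fun n => hQ n j

theorem measurable_count {p : Ω → ℕ → Prop} [∀ ω, DecidablePred (p ω)] (hp : ∀ j, MeasurableSet {ω | p ω j}) (n : ℕ) :
    Measurable fun ω => Nat.count (p ω) n := by
  induction n with
  | zero => simp
  | succ n ih =>
    simp only [Nat.count_succ]
    exact ih.add (Measurable.ite (hp n) measurable_const measurable_const)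

theorem measurableSet_mem_block {π : Ω → Setoid ℕ} (hπ : ∀ i j, MeasurableSet {ω | π ω i j})
    (i j : ℕ) : MeasurableSet {ω | j ∈ block (π ω) i} := by
  classical
  have hmin : ∀ m, MeasurableSet {ω | IsBlockMin (π ω) m} := by
    intro m
    simp only [IsBlockMin, Set.ofPred_forall]
    refine MeasurableSet.iInter fun l => ?_
    exact MeasurableSet.imp (hπ m l) (MeasurableSet.const _)
  have heq : {ω | j ∈ block (π ω) i} = ⋃ m, ({ω | IsBlockMin (π ω) m} ∩
      ({ω | Nat.count (IsBlockMin (π ω)) m = i} ∩ {ω | π ω m j})) := by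
    ext ω
    simp only [Set.mem_iUnion]
    exact exists_congr fun m => by
      simp only [ncard_lt_and_eq_count, Set.mem_inter_iff, Set.mem_ofPred_eq]
  rw [heq]
  refine MeasurableSet.iUnion fun m => (hmin m).inter (MeasurableSet.inter ?_ (hπ m j))
  exact measurable_count hmin m (measurableSet_singleton i)

theorem measurable_weight {B : Ω → Set ℕ} (hB : ∀ j, MeasurableSet {ω | j ∈ B ω}) (t : ℝ) :
    Measurable fun ω => weight t (B ω) := by
  classical
  refine (StronglyMeasurable.limUnder fun n => ?_).measurable
  refine Measurable.stronglyMeasurable ?_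
  simp only [scaledCount, ncard_lt_and_eq_count]
  exact measurable_const.mul (measurable_from_top.comp (measurable_count hB n))

variable {u : ℕ → Ω → ℕ} {ε : ℕ → Ω → ℝ}

theorem measurableSet_clusterPartition (hu : ∀ k, Measurable (u k)) (hε : ∀ k, Measurable (ε k))
    (t : ℝ) (i j : ℕ) :
    MeasurableSet {ω | clusterPartition (fun k => u k ω) (fun k => ε k ω) t i j} := by
  have hrel : ∀ i j, MeasurableSet {ω | ∃ k, i = k + 1 ∧ j = u k ω ∧ t < ε k ω} := by
    intro i j
    rw [Set.ofPred_exists]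
    refine MeasurableSet.iUnion fun k => (MeasurableSet.const _).inter (MeasurableSet.inter ?_ ?_)
    · exact measurableSet_eq_fun measurable_const (hu k)
    · exact measurableSet_lt measurable_const (hε k)
  have : {ω | clusterPartition (fun k => u k ω) (fun k => ε k ω) t i j} =
      {ω | Relation.ReflTransGen
        (remainingForest (fun k => u k ω) (fun k => ε k ω) t).Adj i j} := by
    ext ω
    exact SimpleGraph.reachable_iff_reflTransGen _ _
  rw [this]
  refine measurableSet_reflTransGen (fun i j => ?_) i j
  simp only [remainingForest, SimpleGraph.fromRel_adj]
  exact (MeasurableSet.const _).inter ((hrel i j).union (hrel j i))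

theorem measurable_blockWeight (hu : ∀ k, Measurable (u k)) (hε : ∀ k, Measurable (ε k))
    (t : ℝ) (i : ℕ) :
    Measurable fun ω => blockWeight (fun k => u k ω) (fun k => ε k ω) t i :=
  measurable_weight (measurableSet_mem_block (measurableSet_clusterPartition hu hε t) i) t

theorem measurable_rankedWeights (hu : ∀ k, Measurable (u k)) (hε : ∀ k, Measurable (ε k))
    (q : ℝ≥0∞) [Fact (1 ≤ q)] (t : ℝ) : Measurable (rankedWeights q u ε t) :=
  LqDown.measurable_ofSeq fun k => measurable_decRearr (measurable_blockWeight hu hε t) k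

end Measurability

theorem SamePositive.of_map {ι κ : Type*} {x : ι → ℝ} {y : κ → ℝ} (g : ι → κ)
    (hinj : ∀ i i', 0 < x i → 0 < x i' → g i = g i' → i = i')
    (hval : ∀ i, 0 < x i → y (g i) = x i) (hsurj : ∀ j, 0 < y j → ∃ i, 0 < x i ∧ g i = j) :
    SamePositive x y := by
  refine ⟨Equiv.ofBijective (fun i => ⟨g i, by rw [hval i i.2]; exact i.2⟩) ⟨?_, ?_⟩,
    fun i => hval i i.2⟩
  · intro i i' h
    exact Subtype.ext (hinj i i' i.2 i'.2 (congrArg Subtype.val h))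
  · rintro ⟨j, hj⟩
    obtain ⟨i, hi, rfl⟩ := hsurj j hj
    exact ⟨⟨i, hi⟩, rfl⟩

/-! ### The smallest vertex of a cluster -/

/-- The smallest vertex of the cluster of a vertex at time `t`, for the tree in which vertex `k + 1`
has parent `(a k).1` and is connected to it until time `(a k).2`. -/
noncomputable def blockRoot (a : ℕ → ℕ × ℝ) (t : ℝ) : ℕ → ℕ
  | 0 => 0
  | k + 1 =>
    have : min (a k).1 k < k + 1 := Nat.lt_succ_of_le (min_le_right _ _)
    haveI := Classical.dec (t < (a k).2)
    if t < (a k).2 then blockRoot a t (min (a k).1 k) else k + 1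

/-- The parent of every vertex is an earlier vertex. -/
def ParentsEarlier (a : ℕ → ℕ × ℝ) : Prop := ∀ k, (a k).1 ≤ k

section BlockRoot

variable {a a' : ℕ → ℕ × ℝ} {t : ℝ} {k n : ℕ}

@[simp] theorem blockRoot_zero : blockRoot a t 0 = 0 := by rw [blockRoot]

/-- The `min` only makes the recursion well-founded for arbitrary `a`; it disappears under
`ParentsEarlier`, which holds almost surely. -/
theorem blockRoot_succ_of_lt' (h : t < (a k).2) :
    blockRoot a t (k + 1) = blockRoot a t (min (a k).1 k) := by
  rw [blockRoot, if_pos h]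

theorem blockRoot_succ_of_lt (ha : ParentsEarlier a) (h : t < (a k).2) :
    blockRoot a t (k + 1) = blockRoot a t (a k).1 := by
  rw [blockRoot_succ_of_lt' h, min_eq_left (ha k)]

theorem blockRoot_succ_of_le (h : (a k).2 ≤ t) : blockRoot a t (k + 1) = k + 1 := by
  rw [blockRoot, if_neg (not_lt.2 h)]

theorem blockRoot_le (a : ℕ → ℕ × ℝ) (t : ℝ) (n : ℕ) : blockRoot a t n ≤ n := by
  induction n using Nat.strong_induction_on with
  | _ n ih =>
    cases n with
    | zero => simp
    | succ k =>
      by_cases h : t < (a k).2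
      · rw [blockRoot_succ_of_lt' h]
        have := ih (min (a k).1 k) (by omega)
        omega
      · rw [blockRoot_succ_of_le (not_lt.1 h)]

/-- Clusters only split as time passes, so a vertex and its root at the later time `t` lie in the
same cluster at time `s`. -/
theorem blockRoot_blockRoot_of_le {s : ℝ} (hst : s ≤ t) (n : ℕ) :
    blockRoot a s (blockRoot a t n) = blockRoot a s n := by
  induction n using Nat.strong_induction_on with
  | _ n ih =>
    cases n with
    | zero => simp
    | succ k =>
      by_cases h : t < (a k).2
      · rw [blockRoot_succ_of_lt' h, blockRoot_succ_of_lt' (hst.trans_lt h)]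
        exact ih _ (by omega)
      · rw [blockRoot_succ_of_le (not_lt.1 h)]

theorem blockRoot_blockRoot (n : ℕ) : blockRoot a t (blockRoot a t n) = blockRoot a t n :=
  blockRoot_blockRoot_of_le le_rfl n

theorem blockRoot_congr (h : ∀ k < n, a k = a' k) : blockRoot a t n = blockRoot a' t n := by
  induction n using Nat.strong_induction_on with
  | _ n ih =>
    cases n with
    | zero => simp
    | succ k =>
      have hk := h k k.lt_succ_self
      by_cases ht : t < (a k).2
      · rw [blockRoot_succ_of_lt' ht, blockRoot_succ_of_lt' (hk ▸ ht), ← hk]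
        exact ih _ (by omega) fun j hj => h j (by omega)
      · rw [blockRoot_succ_of_le (not_lt.1 ht), blockRoot_succ_of_le (not_lt.1 (hk ▸ ht))]

/-- Following alive edges towards the root of the tree leads every vertex to its `blockRoot`;
conversely an alive edge joins two vertices with equal `blockRoot`. -/
theorem clusterPartition_iff (ha : ParentsEarlier a) (i j : ℕ) :
    clusterPartition (fun k => (a k).1) (fun k => (a k).2) t i j ↔
      blockRoot a t i = blockRoot a t j := by
  set G := remainingForest (fun k => (a k).1) (fun k => (a k).2) t with hG
  change G.Reachable i j ↔ _
  have hroot : ∀ n, G.Reachable n (blockRoot a t n) := by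
    intro n
    induction n using Nat.strong_induction_on with
    | _ n ih =>
      cases n with
      | zero => simp
      | succ k =>
        have hk := ha k
        by_cases h : t < (a k).2
        · rw [blockRoot_succ_of_lt ha h]
          refine SimpleGraph.Reachable.trans (SimpleGraph.Adj.reachable ?_)
            (ih (a k).1 (by omega))
          rw [hG, remainingForest, SimpleGraph.fromRel_adj]
          exact ⟨by omega, Or.inl ⟨k, rfl, rfl, h⟩⟩
        · rw [blockRoot_succ_of_le (not_lt.1 h)]
  constructor
  · rintro ⟨p⟩
    induction p with
    | nil => rfl
    | cons hadj _ ih =>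
      rw [← ih]
      rw [hG, remainingForest, SimpleGraph.fromRel_adj] at hadj
      rcases hadj.2 with ⟨k, rfl, rfl, h⟩ | ⟨k, rfl, rfl, h⟩
      · exact blockRoot_succ_of_lt ha h
      · exact (blockRoot_succ_of_lt ha h).symm
  · intro h
    exact (hroot i).trans (h ▸ (hroot j).symm)

theorem isBlockMin_iff (ha : ParentsEarlier a) (m : ℕ) :
    IsBlockMin (clusterPartition (fun k => (a k).1) (fun k => (a k).2) t) m ↔
      blockRoot a t m = m := by
  simp only [IsBlockMin, clusterPartition_iff ha]
  constructor
  · exact fun h => le_antisymm (blockRoot_le a t m) (h _ (blockRoot_blockRoot m).symm)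
  · intro h l hl
    rw [← h, hl]
    exact blockRoot_le a t l

/-- The weight of the cluster whose smallest vertex is `m`, zero if there is none. -/
noncomputable def vertexWeight (a : ℕ → ℕ × ℝ) (t : ℝ) (m : ℕ) : ℝ :=
  if blockRoot a t m = m then weight t {j | blockRoot a t j = m} else 0

theorem mem_block_iff (ha : ParentsEarlier a) (i j : ℕ) :
    j ∈ block (clusterPartition (fun k => (a k).1) (fun k => (a k).2) t) i ↔
      Nat.count (fun l => blockRoot a t l = l) (blockRoot a t j) = i := by
  simp only [block, Set.mem_ofPred_eq, isBlockMin_iff ha, clusterPartition_iff ha,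
    ncard_lt_and_eq_count]
  constructor
  · rintro ⟨m, hm, hc, hmj⟩
    rwa [← hmj, hm]
  · intro h
    exact ⟨blockRoot a t j, blockRoot_blockRoot j, h, blockRoot_blockRoot j⟩

theorem block_count_eq (ha : ParentsEarlier a) {m : ℕ} (hm : blockRoot a t m = m) :
    block (clusterPartition (fun k => (a k).1) (fun k => (a k).2) t)
      (Nat.count (fun l => blockRoot a t l = l) m) = {j | blockRoot a t j = m} := by
  ext j
  rw [mem_block_iff ha, Set.mem_ofPred_eq]
  exact ⟨fun h => Nat.count_injective (p := fun l => blockRoot a t l = l) (blockRoot_blockRoot j) hm h, fun h => by rw [h]⟩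

theorem exists_block_eq (ha : ParentsEarlier a) {i : ℕ}
    (h : (block (clusterPartition (fun k => (a k).1) (fun k => (a k).2) t) i).Nonempty) :
    ∃ m, blockRoot a t m = m ∧ block (clusterPartition (fun k => (a k).1) (fun k => (a k).2) t) i =
      {j | blockRoot a t j = m} := by
  classical
  obtain ⟨j, hj⟩ := h
  rw [mem_block_iff ha] at hj
  exact ⟨_, blockRoot_blockRoot j, hj ▸ block_count_eq ha (blockRoot_blockRoot j)⟩

theorem weight_empty (t : ℝ) : weight t ∅ = 0 := by
  have : scaledCount t ∅ = fun _ => 0 := by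
    funext n
    simp [scaledCount]
  rw [weight, this]
  exact tendsto_const_nhds.limUnder_eq

/-- Numbering the blocks by rank or by smallest vertex gives the same positive weights. The second
numbering suits a construction that adds one vertex at a time. -/
theorem samePositive_vertexWeight_blockWeight (ha : ParentsEarlier a) (t : ℝ) :
    SamePositive (vertexWeight a t) (blockWeight (fun k => (a k).1) (fun k => (a k).2) t) := by
  classical
  have hroot : ∀ m, 0 < vertexWeight a t m → blockRoot a t m = m := by
    intro m hm
    by_contra hcon
    rw [vertexWeight, if_neg hcon] at hm
    exact lt_irrefl _ hm
  have hval : ∀ m, blockRoot a t m = m →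
      blockWeight (fun k => (a k).1) (fun k => (a k).2) t
        (Nat.count (fun l => blockRoot a t l = l) m) = vertexWeight a t m := by
    intro m hm
    rw [blockWeight, block_count_eq ha hm, vertexWeight, if_pos hm]
  refine SamePositive.of_map (Nat.count fun l => blockRoot a t l = l) (fun m m' hm hm' h => ?_)
    (fun m hm => hval m (hroot m hm)) fun i hi => ?_
  · exact Nat.count_injective (p := fun l => blockRoot a t l = l) (hroot m hm) (hroot m' hm') h
  · have hne : (block (clusterPartition (fun k => (a k).1) (fun k => (a k).2) t) i).Nonempty := by
      by_contra hcon
      rw [blockWeight, Set.not_nonempty_iff_eq_empty.1 hcon, weight_empty] at hi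
      exact lt_irrefl _ hi
    obtain ⟨j, hj⟩ := hne
    rw [mem_block_iff ha] at hj
    subst hj
    rw [hval _ (blockRoot_blockRoot j)] at hi
    exact ⟨_, hi, rfl⟩

theorem scaledCount_eq (t : ℝ) (p : ℕ → Prop) [DecidablePred p] (n : ℕ) :
    scaledCount t {j | p j} n = (n : ℝ) ^ (-Real.exp (-t)) * (Nat.count p n : ℝ) := by
  rw [scaledCount, ← ncard_lt_and_eq_count]
  rfl

end BlockRoot

/-! ### Independent pairs -/

/-- On the π-system of rectangles, the independence of the two sequences first separates the `X`
part from the `Y` part, and each part then factors over the indices. -/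
theorem iIndepFun.prodMk_of_indepFun {Ω ι : Type*} {β γ : ι → Type*} [MeasurableSpace Ω]
    [∀ i, MeasurableSpace (β i)] [∀ i, MeasurableSpace (γ i)] {P : Measure Ω}
    {X : ∀ i, Ω → β i} {Y : ∀ i, Ω → γ i} (hXm : ∀ i, Measurable (X i))
    (hYm : ∀ i, Measurable (Y i)) (hX : iIndepFun X P) (hY : iIndepFun Y P)
    (hXY : IndepFun (fun ω i => X i ω) (fun ω i => Y i ω) P) :
    iIndepFun (fun i ω => (X i ω, Y i ω)) P := by
  let R : ∀ i, Set (Set (β i × γ i)) := fun i =>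
    Set.image2 (· ×ˢ ·) {s | MeasurableSet s} {t | MeasurableSet t}
  refine iIndepSets.iIndep (m := fun i => MeasurableSpace.comap (fun ω => (X i ω, Y i ω)) inferInstance)
    (fun i => ((hXm i).prodMk (hYm i)).comap_le)
    (fun i => Set.preimage (fun ω => (X i ω, Y i ω)) '' R i)
    (fun i => isPiSystem_prod.comap _) (fun i => ?_) ?_
  · rw [← MeasurableSpace.comap_generateFrom, generateFrom_prod]
  · rw [iIndepSets_iff]
    intro S f hf
    have hf' : ∀ i, ∃ A : Set (β i), ∃ B : Set (γ i), MeasurableSet A ∧ MeasurableSet B ∧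
        (i ∈ S → f i = X i ⁻¹' A ∩ Y i ⁻¹' B) := by
      intro i
      by_cases hi : i ∈ S
      · obtain ⟨_, ⟨A, hA, B, hB, rfl⟩, h⟩ := hf i hi
        exact ⟨A, B, hA, hB, fun _ => h.symm⟩
      · exact ⟨∅, ∅, .empty, .empty, fun h => absurd h hi⟩
    choose A B hA hB hAB using hf'
    have hpair : ∀ i, P (X i ⁻¹' A i ∩ Y i ⁻¹' B i) = P (X i ⁻¹' A i) * P (Y i ⁻¹' B i) := by
      intro i
      exact (hXY.comp (measurable_pi_apply i) (measurable_pi_apply i)).measure_inter_preimage_eq_mul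
        _ _ (hA i) (hB i)
    have h1 : (⋂ i ∈ S, f i) = (fun ω i => X i ω) ⁻¹' (Set.pi S A) ∩
        (fun ω i => Y i ω) ⁻¹' (Set.pi S B) := by
      ext ω
      simp only [Set.mem_iInter, Set.mem_inter_iff, Set.mem_preimage, Set.mem_pi, ← forall_and]
      refine forall_congr' fun i => forall_congr' fun hi => ?_
      rw [hAB i hi]
      rfl
    have h2 : (fun ω i => X i ω) ⁻¹' (Set.pi S A) = ⋂ i ∈ S, X i ⁻¹' A i := by
      ext ω
      simp
    have h3 : (fun ω i => Y i ω) ⁻¹' (Set.pi S B) = ⋂ i ∈ S, Y i ⁻¹' B i := by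
      ext ω
      simp
    rw [h1, hXY.measure_inter_preimage_eq_mul _ _
      (MeasurableSet.pi S.countable_toSet fun i _ => hA i)
      (MeasurableSet.pi S.countable_toSet fun i _ => hB i), h2, h3,
      hX.measure_inter_preimage_eq_mul S fun i _ => hA i,
      hY.measure_inter_preimage_eq_mul S fun i _ => hB i, ← Finset.prod_mul_distrib]
    exact Finset.prod_congr rfl fun i hi => by rw [hAB i hi, hpair i]

/-- Resampling one coordinate independently preserves a product measure. This is how a single edge
is integrated out below. -/
theorem measurePreserving_update_infinitePi {ι : Type*} [DecidableEq ι] {X : ι → Type*}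
    [∀ i, MeasurableSpace (X i)] (μ : ∀ i, Measure (X i)) [∀ i, IsProbabilityMeasure (μ i)]
    (n : ι) : MeasurePreserving (fun p : (∀ i, X i) × X n => Function.update p.1 n p.2)
      ((Measure.infinitePi μ).prod (μ n)) (Measure.infinitePi μ) := by
  have hm : Measurable fun p : (∀ i, X i) × X n => Function.update p.1 n p.2 := by
    refine measurable_pi_lambda _ fun i => ?_
    by_cases hi : i = n
    · subst hi
      simpa using measurable_snd
    · simp only [Function.update_of_ne hi]
      exact (measurable_pi_apply i).comp measurable_fst
  refine ⟨hm, Measure.eq_infinitePi μ fun s t ht => ?_⟩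
  rw [Measure.map_apply hm (MeasurableSet.pi s.countable_toSet fun i _ => ht i)]
  by_cases hn : n ∈ s
  · have : (fun p : (∀ i, X i) × X n => Function.update p.1 n p.2) ⁻¹' Set.pi s t =
        Set.pi (s.erase n : Finset ι) t ×ˢ t n := by
      ext ⟨a, e⟩
      simp only [Set.mem_preimage, Set.mem_pi, Set.mem_prod, Finset.mem_coe, Finset.mem_erase]
      constructor
      · intro h
        refine ⟨fun i hi => ?_, by simpa using h n hn⟩
        simpa [Function.update_of_ne hi.1] using h i hi.2
      · rintro ⟨h, he⟩ i hi
        by_cases hin : i = n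
        · subst hin
          simpa using he
        · simpa [Function.update_of_ne hin] using h i ⟨hin, hi⟩
    rw [this, Measure.prod_prod, Measure.infinitePi_pi μ fun i _ => ht i,
      Finset.prod_erase_mul s (fun i => μ i (t i)) hn]
  · have : (fun p : (∀ i, X i) × X n => Function.update p.1 n p.2) ⁻¹' Set.pi s t =
        Set.pi s t ×ˢ Set.univ := by
      ext ⟨a, e⟩
      simp only [Set.mem_preimage, Set.mem_pi, Set.mem_prod, Set.mem_univ, and_true]
      refine forall_congr' fun i => forall_congr' fun hi => ?_
      rw [Function.update_of_ne (fun h : i = n => hn (h ▸ hi))]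
    rw [this, Measure.prod_prod, Measure.infinitePi_pi μ fun i _ => ht i, measure_univ, mul_one]

/-! ### The law of the recursive tree and of the removal times -/

instance isProbabilityMeasure_uniformOn_Iic (k : ℕ) :
    IsProbabilityMeasure (uniformOn (Set.Iic k)) :=
  isProbabilityMeasure_uniformOn (Set.finite_Iic k) ⟨k, Set.mem_Iic.2 le_rfl⟩

instance isProbabilityMeasure_expMeasure_one : IsProbabilityMeasure (expMeasure 1) :=
  isProbabilityMeasure_expMeasure one_pos

/-- The law of the parent of vertex `k + 1` and of the time at which its edge is removed. -/
noncomputable def edgeLaw (k : ℕ) : Measure (ℕ × ℝ) := (uniformOn (Set.Iic k)).prod (expMeasure 1)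

instance (k : ℕ) : IsProbabilityMeasure (edgeLaw k) := by
  unfold edgeLaw
  infer_instance

/-- The law of the recursive tree with its removal times. -/
noncomputable def treeLaw : Measure (ℕ → ℕ × ℝ) := Measure.infinitePi edgeLaw

instance : IsProbabilityMeasure treeLaw := by
  unfold treeLaw
  infer_instance

theorem IsRecursiveTreeDestruction.map_eq_treeLaw {Ω : Type*} [MeasurableSpace Ω] {P : Measure Ω}
    {u : ℕ → Ω → ℕ} {ε : ℕ → Ω → ℝ} (h : IsRecursiveTreeDestruction P u ε) :
    P.map (fun ω k => (u k ω, ε k ω)) = treeLaw := by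
  have hi := iIndepFun.prodMk_of_indepFun h.measurable_parent h.measurable_time h.indep_parent
    h.indep_time h.indep_parent_time
  rw [hi.map_fun_eq_infinitePi_map fun k => (h.measurable_parent k).prodMk (h.measurable_time k),
    treeLaw]
  congr 1
  funext k
  have hk : IndepFun (u k) (ε k) P :=
    h.indep_parent_time.comp (measurable_pi_apply k) (measurable_pi_apply k)
  have := h.indep_parent.isProbabilityMeasure
  rw [(indepFun_iff_map_prod_eq_prod_map_map (h.measurable_parent k).aemeasurable
    (h.measurable_time k).aemeasurable).1 hk, h.law_parent, h.law_time, edgeLaw]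

theorem uniformOn_Iic_eq_sum (k : ℕ) :
    uniformOn (Set.Iic k) = ((k : ℝ≥0∞) + 1)⁻¹ • ∑ v ∈ Finset.range (k + 1), Measure.dirac v := by
  have hI : (Set.Iic k : Set ℕ) = (Finset.range (k + 1) : Finset ℕ) := by
    ext v
    simp
  ext s hs
  rw [uniformOn, cond_apply (MeasurableSet.of_discrete), hI, Measure.count_apply_finset,
    Measure.smul_apply, Measure.finsetSum_apply, smul_eq_mul, Finset.card_range]
  congr 1
  · push_cast
    rfl
  · classical
    have : (((Finset.range (k + 1) : Finset ℕ) : Set ℕ) ∩ s) =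
        ((Finset.range (k + 1)).filter (· ∈ s) : Finset ℕ) := by
      ext v
      simp
    rw [this, Measure.count_apply_finset, Finset.card_filter]
    push_cast
    refine Finset.sum_congr rfl fun v _ => ?_
    rw [Measure.dirac_apply' _ hs]
    rfl

theorem lintegral_edgeLaw (k : ℕ) {f : ℕ × ℝ → ℝ≥0∞} (hf : Measurable f) :
    ∫⁻ x, f x ∂edgeLaw k =
      ((k : ℝ≥0∞) + 1)⁻¹ * ∑ v ∈ Finset.range (k + 1), ∫⁻ e, f (v, e) ∂expMeasure 1 := by
  rw [edgeLaw, lintegral_prod _ hf.aemeasurable, uniformOn_Iic_eq_sum, lintegral_smul_measure,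
    lintegral_finsetSum_measure, smul_eq_mul]
  congr 1
  exact Finset.sum_congr rfl fun v _ => lintegral_dirac _ _

/-- Memorylessness of the exponential law, in the form of a change of variables. -/
theorem lintegral_expMeasure_Ioi {s : ℝ} (hs : 0 ≤ s) {f : ℝ → ℝ≥0∞} (hf : Measurable f) :
    ∫⁻ e in Set.Ioi s, f e ∂expMeasure 1 =
      ENNReal.ofReal (Real.exp (-s)) * ∫⁻ e, f (s + e) ∂expMeasure 1 := by
  have hpdf : Measurable (exponentialPDF 1) := by
    exact (measurable_exponentialPDFReal 1).ennreal_ofReal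
  have hexp : expMeasure 1 = volume.withDensity (exponentialPDF 1) := rfl
  rw [hexp, setLIntegral_withDensity_eq_setLIntegral_mul _ hpdf hf measurableSet_Ioi,
    lintegral_withDensity_eq_lintegral_mul (g := fun e => f (s + e)) _ hpdf
      (hf.comp (measurable_const_add s))]
  rw [← lintegral_indicator measurableSet_Ioi,
    ← lintegral_add_left_eq_self _ s, ← lintegral_const_mul' _ _ ENNReal.ofReal_ne_top]
  -- At `e = 0` the indicator of the open half-line vanishes while the density does not.
  have hae : ∀ᵐ e : ℝ ∂volume, e ≠ 0 := by
    simp [ae_iff]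
  refine lintegral_congr_ae (hae.mono fun e he => ?_)
  simp only [Set.indicator_apply, Set.mem_Ioi, lt_add_iff_pos_right, Pi.mul_apply]
  rcases lt_or_gt_of_ne he with h | h
  · rw [if_neg h.not_gt, exponentialPDF_of_neg h]
    simp
  · rw [if_pos h, exponentialPDF_of_nonneg (by linarith), exponentialPDF_of_nonneg h.le, ← mul_assoc,
      ← ENNReal.ofReal_mul (Real.exp_pos _).le]
    congr 2
    rw [one_mul, one_mul, one_mul, one_mul, ← Real.exp_add]
    congr 1
    ring

theorem expMeasure_Ioi {s : ℝ} (hs : 0 ≤ s) :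
    expMeasure 1 (Set.Ioi s) = ENNReal.ofReal (Real.exp (-s)) := by
  have := lintegral_expMeasure_Ioi hs (f := fun _ => 1) measurable_const
  simpa using this

theorem ae_treeLaw_parentsEarlier : ∀ᵐ a ∂treeLaw, ParentsEarlier a := by
  refine ae_all_iff.2 fun k => ?_
  have hmp := measurePreserving_eval_infinitePi edgeLaw k
  refine hmp.quasiMeasurePreserving.ae (p := fun x => x.1 ≤ k) ?_
  have : ∀ᵐ v ∂uniformOn (Set.Iic k), v ≤ k := by
    rw [ae_iff, show {v | ¬ v ≤ k} = (Set.Iic k)ᶜ from rfl, prob_compl_eq_zero_iff .of_discrete,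
      uniformOn_self (Set.finite_Iic k) ⟨k, Set.mem_Iic.2 le_rfl⟩]
  exact Measure.quasiMeasurePreserving_fst.ae this

theorem ae_treeLaw_time_pos : ∀ᵐ a ∂treeLaw, ∀ k, 0 < (a k).2 := by
  refine ae_all_iff.2 fun k => ?_
  have hmp := measurePreserving_eval_infinitePi edgeLaw k
  refine hmp.quasiMeasurePreserving.ae (p := fun x => 0 < x.2) ?_
  have : ∀ᵐ e ∂expMeasure 1, 0 < e := by
    rw [ae_iff, show {e : ℝ | ¬ 0 < e} = (Set.Ioi 0)ᶜ from rfl,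
      prob_compl_eq_zero_iff measurableSet_Ioi, expMeasure_Ioi le_rfl]
    simp
  exact Measure.quasiMeasurePreserving_snd.ae this

/-! ### The products `∏ (1 + c / k)` -/

/-- The product of `1 + c / k` for `1 ≤ k ≤ n`. -/
noncomputable def growth (c : ℝ) (n : ℕ) : ℝ := ∏ i ∈ Finset.range n, (1 + c / ((i : ℝ) + 1))

section Growth

variable {c : ℝ}

@[simp] theorem growth_zero (c : ℝ) : growth c 0 = 1 := by simp [growth]

theorem growth_succ (c : ℝ) (n : ℕ) : growth c (n + 1) = growth c n * (1 + c / ((n : ℝ) + 1)) := by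
  rw [growth, Finset.prod_range_succ, growth]

theorem one_add_div_pos (hc : -1 < c) (n : ℕ) : 0 < 1 + c / ((n : ℝ) + 1) := by
  have : 1 + c / ((n : ℝ) + 1) = (n + 1 + c) / (n + 1) := by field_simp
  rw [this]
  apply div_pos <;> linarith

theorem growth_pos (hc : -1 < c) (n : ℕ) : 0 < growth c n :=
  Finset.prod_pos fun i _ => one_add_div_pos hc i

theorem growth_eq_gammaSeq (hc : 0 < c) {n : ℕ} (hn : n ≠ 0) :
    growth c n / (n : ℝ) ^ c = (c * Real.GammaSeq c n)⁻¹ := by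
  have h1 : growth c n * (n.factorial : ℝ) = ∏ j ∈ Finset.range n, (c + ((j + 1 : ℕ) : ℝ)) := by
    rw [← Finset.prod_range_add_one_eq_factorial, growth]
    push_cast
    rw [← Finset.prod_mul_distrib]
    refine Finset.prod_congr rfl fun i _ => ?_
    have : (i : ℝ) + 1 ≠ 0 := by positivity
    field_simp
    ring
  rw [Real.GammaSeq, Finset.prod_range_succ', ← h1]
  push_cast
  field_simp
  simp

/-- Euler's limit formula for the Gamma function; the limit is `1 / (c Γ(c))`. -/
theorem tendsto_growth (hc : 0 < c) :
    ∃ κ > 0, Tendsto (fun n : ℕ => growth c n / ((n : ℝ) + 1) ^ c) atTop (𝓝 κ) := by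
  have hG : 0 < c * Real.Gamma c := mul_pos hc (Real.Gamma_pos_of_pos hc)
  refine ⟨(c * Real.Gamma c)⁻¹, inv_pos.2 hG, ?_⟩
  have h1 : Tendsto (fun n : ℕ => (c * Real.GammaSeq c n)⁻¹ * ((n : ℝ) / (n + 1)) ^ c) atTop
      (𝓝 ((c * Real.Gamma c)⁻¹ * 1 ^ c)) := by
    refine ((Real.GammaSeq_tendsto_Gamma c).const_mul c).inv₀ hG.ne' |>.mul ?_
    exact (tendsto_natCast_div_add_atTop (1 : ℝ)).rpow_const (Or.inl one_ne_zero)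
  rw [Real.one_rpow, mul_one] at h1
  refine h1.congr' ?_
  filter_upwards [eventually_ne_atTop 0] with n hn
  have hn' : (0 : ℝ) < n := by positivity
  rw [← growth_eq_gammaSeq hc hn, Real.div_rpow hn'.le (by positivity)]
  have : (n : ℝ) ^ c ≠ 0 := by positivity
  field_simp

theorem exists_growth_le (hc : 0 < c) : ∃ A > 0, ∀ n : ℕ, growth c n ≤ A * ((n : ℝ) + 1) ^ c := by
  obtain ⟨κ, hκ, h⟩ := tendsto_growth hc
  obtain ⟨A, hA⟩ := h.bddAbove_range
  refine ⟨max A 1, by positivity, fun n => ?_⟩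
  rw [← div_le_iff₀ (by positivity)]
  exact (hA ⟨n, rfl⟩).trans (le_max_left _ _)

theorem exists_le_growth (hc : 0 < c) : ∃ A > 0, ∀ n : ℕ, ((n : ℝ) + 1) ^ c ≤ A * growth c n := by
  obtain ⟨κ, hκ, h⟩ := tendsto_growth hc
  obtain ⟨A, hA⟩ := (h.inv₀ hκ.ne').bddAbove_range
  refine ⟨max A 1, by positivity, fun n => ?_⟩
  rw [← div_le_iff₀ (growth_pos (by linarith) n), ← inv_div]
  exact (hA ⟨n, rfl⟩).trans (le_max_left _ _)

/-- The product of the factors is `1 - c² / k²`. The inequality bounds `growth` from above at a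
negative exponent by means of the asymptotics at the opposite, positive one. -/
theorem growth_neg_mul_growth_le_one (hc : 0 < c) (hc' : c < 1) (n : ℕ) :
    growth (-c) n * growth c n ≤ 1 := by
  rw [growth, growth, ← Finset.prod_mul_distrib]
  refine Finset.prod_le_one (fun i _ => ?_) fun i _ => ?_
  · exact (mul_pos (one_add_div_pos (by linarith) i) (one_add_div_pos (by linarith) i)).le
  · have : (1 + -c / ((i : ℝ) + 1)) * (1 + c / ((i : ℝ) + 1)) = 1 - (c / ((i : ℝ) + 1)) ^ 2 := by
      ring
    rw [this]
    linarith [sq_nonneg (c / ((i : ℝ) + 1))]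

/-- A lower bound of order `n^{-1/2}` for `growth (-1/2) n`: the quantity `4 n growth(-1/2, n)²`
equals `1` at `n = 1` and is nondecreasing, since `(n + 1) (1 - 1 / (2 (n + 1)))² = n + 1 / (4 (n +
1))`. -/
theorem one_le_mul_growth_neg_half_sq (n : ℕ) :
    1 ≤ 4 * ((n : ℝ) + 1) * growth (-(1 / 2)) n ^ 2 := by
  have key : ∀ n : ℕ, 1 ≤ n → 1 ≤ 4 * (n : ℝ) * growth (-(1 / 2)) n ^ 2 := by
    intro n hn
    induction n, hn using Nat.le_induction with
    | base =>
      rw [growth_succ]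
      norm_num
    | succ n hn ih =>
      have hn' : (0 : ℝ) < n := by positivity
      have h1 : (n : ℝ) ≤ ((n : ℝ) + 1) * (1 + -(1 / 2) / ((n : ℝ) + 1)) ^ 2 := by
        have : ((n : ℝ) + 1) * (1 + -(1 / 2) / ((n : ℝ) + 1)) ^ 2 = n + 1 / (4 * (n + 1)) := by
          field_simp
          ring
        rw [this]
        have : 0 < 1 / (4 * ((n : ℝ) + 1)) := by positivity
        linarith
      rw [growth_succ]
      push_cast
      calc 1 ≤ 4 * (n : ℝ) * growth (-(1 / 2)) n ^ 2 := ih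
        _ ≤ 4 * (((n : ℝ) + 1) * (1 + -(1 / 2) / ((n : ℝ) + 1)) ^ 2) * growth (-(1 / 2)) n ^ 2 := by
          gcongr
        _ = _ := by ring
  rcases Nat.eq_zero_or_pos n with rfl | hn
  · norm_num
  · refine (key n hn).trans ?_
    gcongr
    linarith

/-- The product of `1 + c / k` for `1 ≤ k < N`, zero if `N = 0`. -/
noncomputable def growthPotential (c : ℝ) : ℕ → ℝ
  | 0 => 0
  | N + 1 => growth c N

@[simp] theorem growthPotential_zero : growthPotential c 0 = 0 := rfl

theorem growthPotential_nonneg (hc : -1 < c) (N : ℕ) : 0 ≤ growthPotential c N := by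
  cases N with
  | zero => exact le_rfl
  | succ N => exact (growth_pos hc N).le

theorem growthPotential_succ (N : ℕ) (hN : N ≠ 0) :
    growthPotential c (N + 1) = growthPotential c N * (1 + c / N) := by
  cases N with
  | zero => exact absurd rfl hN
  | succ N =>
    rw [growthPotential, growthPotential, growth_succ]
    push_cast
    rfl

theorem growthPotential_one (N : ℕ) : growthPotential 1 N = N := by
  induction N with
  | zero => simp
  | succ N ih =>
    by_cases hN : N = 0
    · subst hN
      simp [growthPotential]
    · rw [growthPotential_succ N hN, ih]
      have : (N : ℝ) ≠ 0 := by positivity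
      push_cast
      field_simp

end Growth

/-! ### The growth of a cluster -/

theorem measurable_blockRoot (t : ℝ) (n : ℕ) :
    Measurable fun a : ℕ → ℕ × ℝ => blockRoot a t n := by
  classical
  induction n using Nat.strong_induction_on with
  | _ n ih =>
    cases n with
    | zero => simp
    | succ k =>
      have hk : Measurable fun a : ℕ → ℕ × ℝ => a k := measurable_pi_apply k
      have heq : (fun a : ℕ → ℕ × ℝ => blockRoot a t (k + 1)) = fun a => if t < (a k).2 then
          ∑ v ∈ Finset.range (k + 1), (if min (a k).1 k = v then blockRoot a t v else 0)
          else k + 1 := by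
        funext a
        split_ifs with h
        · rw [blockRoot_succ_of_lt' h, Finset.sum_ite_eq, if_pos]
          exact Finset.mem_range.2 (Nat.lt_succ_of_le (min_le_right _ _))
        · exact blockRoot_succ_of_le (not_lt.1 h)
      rw [heq]
      refine Measurable.ite (measurableSet_lt measurable_const hk.snd) ?_ measurable_const
      refine Finset.measurable_sum _ fun v hv => ?_
      refine Measurable.ite ?_ (ih v (Finset.mem_range.1 hv)) measurable_const
      exact measurableSet_eq_fun (hk.fst.min measurable_const) measurable_const

/-- The number of vertices `≤ k` whose cluster at time `t` has smallest vertex `m`. -/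
noncomputable def clusterSize (a : ℕ → ℕ × ℝ) (t : ℝ) (m k : ℕ) : ℕ :=
  Nat.count (fun j => blockRoot a t j = m) (k + 1)

section ClusterSize

variable {a a' : ℕ → ℕ × ℝ} {t : ℝ} {m k : ℕ}

theorem measurable_clusterSize (t : ℝ) (m k : ℕ) :
    Measurable fun a : ℕ → ℕ × ℝ => clusterSize a t m k :=
  measurable_count (fun j => measurable_blockRoot t j (measurableSet_singleton m)) _

theorem clusterSize_congr (h : ∀ j < k, a j = a' j) : clusterSize a t m k = clusterSize a' t m k := by
  rw [clusterSize, clusterSize, Nat.count_eq_card_filter_range, Nat.count_eq_card_filter_range]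
  congr 1
  refine Finset.filter_congr fun j hj => ?_
  rw [blockRoot_congr fun i hi => h i (by have := Finset.mem_range.1 hj; omega)]

theorem clusterSize_le (a : ℕ → ℕ × ℝ) (t : ℝ) (m k : ℕ) : clusterSize a t m k ≤ k + 1 :=
  Nat.count_le _

theorem clusterSize_self_eq : clusterSize a t m m = if blockRoot a t m = m then 1 else 0 := by
  rw [clusterSize, Nat.count_succ]
  have : Nat.count (fun j => blockRoot a t j = m) m = 0 := by
    rw [Nat.count_eq_card_filter_range, Finset.card_eq_zero, Finset.filter_eq_empty_iff]
    intro j hj h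
    have := blockRoot_le a t j
    have := Finset.mem_range.1 hj
    omega
  rw [this, zero_add]

open Classical in
-- Edge `k` alone decides whether vertex `k + 1` joins an existing cluster; `m ≤ k` excludes that
-- this vertex is the one founding the cluster.
theorem clusterSize_update (hmk : m ≤ k) (a : ℕ → ℕ × ℝ) (t : ℝ) (e : ℕ × ℝ) :
    clusterSize (Function.update a k e) t m (k + 1) = clusterSize a t m k +
      if t < e.2 ∧ blockRoot a t (min e.1 k) = m then 1 else 0 := by
  have hcongr : ∀ n ≤ k, blockRoot (Function.update a k e) t n = blockRoot a t n := fun n hn =>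
    blockRoot_congr fun j hj => Function.update_of_ne (by omega) _ _
  rw [clusterSize, Nat.count_succ, ← clusterSize, clusterSize_congr (a' := a) fun j hj =>
    Function.update_of_ne (by omega) _ _]
  congr 1
  refine if_congr ?_ rfl rfl
  by_cases h : t < e.2
  · rw [blockRoot_succ_of_lt' (by simpa using h), Function.update_self,
      hcongr _ (min_le_right _ _)]
    simp [h]
  · rw [blockRoot_succ_of_le (by simpa using h)]
    simp only [h, false_and, iff_false]
    omega

open Classical in
theorem growthPotential_clusterSize_update (c : ℝ) (hmk : m ≤ k) (a : ℕ → ℕ × ℝ) (t : ℝ)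
    (e : ℕ × ℝ) : growthPotential c (clusterSize (Function.update a k e) t m (k + 1)) =
      growthPotential c (clusterSize a t m k) * (1 + c / clusterSize a t m k *
        Set.indicator {e : ℕ × ℝ | t < e.2 ∧ blockRoot a t (min e.1 k) = m} 1 e) := by
  rw [clusterSize_update hmk]
  by_cases h : t < e.2 ∧ blockRoot a t (min e.1 k) = m
  · have hne : clusterSize a t m k ≠ 0 := by
      rw [clusterSize, Nat.count_ne_iff_exists]
      exact ⟨min e.1 k, Nat.lt_succ_of_le (min_le_right _ _), h.2⟩
    rw [if_pos h, growthPotential_succ _ hne, Set.indicator_of_mem (by exact h)]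
    simp
  · rw [if_neg h, Set.indicator_of_notMem (by exact h)]
    simp

/-- The edge survives time `t` with probability `e^{-t}` and, independently, the parent is uniform
among `k + 1` vertices, of which `clusterSize a t m k` are in the cluster. -/
theorem edgeLaw_real_join (ht : 0 ≤ t) (a : ℕ → ℕ × ℝ) (m k : ℕ) :
    (edgeLaw k).real {e : ℕ × ℝ | t < e.2 ∧ blockRoot a t (min e.1 k) = m} =
      Real.exp (-t) * clusterSize a t m k / ((k : ℝ) + 1) := by
  classical
  have hms : MeasurableSet {e : ℕ × ℝ | t < e.2 ∧ blockRoot a t (min e.1 k) = m} := by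
    refine MeasurableSet.inter (measurableSet_lt measurable_const measurable_snd) ?_
    exact measurable_fst (MeasurableSet.of_discrete (s := {v : ℕ | blockRoot a t (min v k) = m}))
  have h : edgeLaw k {e : ℕ × ℝ | t < e.2 ∧ blockRoot a t (min e.1 k) = m} =
      ((k : ℝ≥0∞) + 1)⁻¹ * (clusterSize a t m k * ENNReal.ofReal (Real.exp (-t))) := by
    rw [← lintegral_indicator_one hms, lintegral_edgeLaw k (measurable_one.indicator hms),
      clusterSize, Nat.count_eq_card_filter_range, ← nsmul_eq_mul, ← Finset.sum_const,
      Finset.sum_filter]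
    congr 1
    refine Finset.sum_congr rfl fun v hv => ?_
    have hv' : min v k = v := min_eq_left (Nat.lt_succ_iff.1 (Finset.mem_range.1 hv))
    by_cases hvm : blockRoot a t v = m
    · rw [if_pos hvm, ← expMeasure_Ioi ht, ← lintegral_indicator_one measurableSet_Ioi]
      refine lintegral_congr fun x => ?_
      by_cases hx : t < x
      · rw [Set.indicator_of_mem (by exact ⟨hx, hv'.symm ▸ hvm⟩), Set.indicator_of_mem (by exact hx)]
        rfl
      · rw [Set.indicator_of_notMem (by exact fun h => hx h.1),
          Set.indicator_of_notMem (by exact hx)]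
    · rw [if_neg hvm]
      refine (lintegral_congr fun x => ?_).trans lintegral_zero
      rw [Set.indicator_of_notMem]
      exact fun h => hvm (hv' ▸ h.2)
  rw [measureReal_def, h]
  simp only [ENNReal.toReal_mul, ENNReal.toReal_inv, ENNReal.toReal_natCast,
    ENNReal.toReal_ofReal (Real.exp_pos _).le]
  rw [ENNReal.toReal_add (by simp) (by simp)]
  simp only [ENNReal.toReal_natCast, ENNReal.toReal_one]
  ring

/-- The gain `c / N` upon joining and the joining probability, proportional to `N`, multiply to a
quantity free of `N`. This cancellation is the reason for the choice of the potential. -/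
theorem integral_growthPotential_update (c : ℝ) (ht : 0 ≤ t) (hmk : m ≤ k) (a : ℕ → ℕ × ℝ) :
    ∫ e, growthPotential c (clusterSize (Function.update a k e) t m (k + 1)) ∂edgeLaw k =
      growthPotential c (clusterSize a t m k) * (1 + Real.exp (-t) * c / ((k : ℝ) + 1)) := by
  classical
  have hms : MeasurableSet {e : ℕ × ℝ | t < e.2 ∧ blockRoot a t (min e.1 k) = m} := by
    refine MeasurableSet.inter (measurableSet_lt measurable_const measurable_snd) ?_
    exact measurable_fst (MeasurableSet.of_discrete (s := {v : ℕ | blockRoot a t (min v k) = m}))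
  simp only [growthPotential_clusterSize_update c hmk]
  rw [integral_const_mul, integral_add (integrable_const _)
    (((integrable_const 1).indicator hms).const_mul _), integral_const_mul,
    integral_indicator_one hms, edgeLaw_real_join ht]
  simp only [integral_const, probReal_univ, smul_eq_mul, mul_one]
  by_cases h0 : clusterSize a t m k = 0
  · simp [h0]
  · have : (clusterSize a t m k : ℝ) ≠ 0 := by exact_mod_cast h0
    field_simp

end ClusterSize

/-! ### Integrating out one edge, and the filtration of the first edges -/

theorem integral_treeLaw_update {f : (ℕ → ℕ × ℝ) → ℝ} (hf : Measurable f) {C : ℝ}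
    (hC : ∀ a, |f a| ≤ C) (k : ℕ) :
    ∫ a, f a ∂treeLaw = ∫ a, ∫ e, f (Function.update a k e) ∂edgeLaw k ∂treeLaw := by
  have hmp := measurePreserving_update_infinitePi edgeLaw k
  rw [treeLaw, ← hmp.map_eq, integral_map hmp.measurable.aemeasurable hf.aestronglyMeasurable,
    hmp.map_eq, integral_prod]
  refine Integrable.of_bound (hf.comp hmp.measurable).aestronglyMeasurable C ?_
  exact Eventually.of_forall fun p => hC _

/-- Replace all edges from number `n` on by a default value. -/
def truncateTree (n : ℕ) (a : ℕ → ℕ × ℝ) : ℕ → ℕ × ℝ := fun k => if k < n then a k else 0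

theorem measurable_truncateTree (n : ℕ) : Measurable (truncateTree n) := by
  refine measurable_pi_lambda _ fun k => ?_
  by_cases h : k < n
  · simpa [truncateTree, h] using measurable_pi_apply k
  · simp [truncateTree, h]

/-- The filtration generated by the first edges. -/
def treeFiltration : Filtration ℕ (inferInstance : MeasurableSpace (ℕ → ℕ × ℝ)) where
  seq n := MeasurableSpace.comap (truncateTree n) inferInstance
  mono' := by
    intro n n' hn
    have : truncateTree n = truncateTree n ∘ truncateTree n' := by
      funext a k
      simp only [truncateTree, Function.comp_apply]
      split_ifs <;> first | rfl | omega
    change MeasurableSpace.comap _ _ ≤ MeasurableSpace.comap _ _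
    rw [this, ← MeasurableSpace.comap_comp]
    exact MeasurableSpace.comap_mono (measurable_truncateTree n).comap_le
  le' n := (measurable_truncateTree n).comap_le

theorem measurable_treeFiltration {β : Type*} [MeasurableSpace β] {n : ℕ}
    {f : (ℕ → ℕ × ℝ) → β} (hf : Measurable f) (hfn : ∀ a, f (truncateTree n a) = f a) :
    Measurable[treeFiltration n] f := by
  have : f = f ∘ truncateTree n := by
    funext a
    exact (hfn a).symm
  rw [this]
  exact hf.comp (comap_measurable _)

/-! ### Convergence of the rescaled cluster sizes -/

section Convergence

variable {c t : ℝ} {m : ℕ}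

theorem abs_growthPotential_clusterSize_le (hc : -1 < c) (a : ℕ → ℕ × ℝ) (t : ℝ) (m k : ℕ) :
    |growthPotential c (clusterSize a t m k)| ≤
      ∑ N ∈ Finset.range (k + 2), growthPotential c N := by
  rw [abs_of_nonneg (growthPotential_nonneg hc _)]
  exact Finset.single_le_sum (f := growthPotential c) (fun N _ => growthPotential_nonneg hc N)
    (Finset.mem_range.2 (by have := clusterSize_le a t m k; omega))

theorem measurable_growthPotential_clusterSize (c t : ℝ) (m k : ℕ) :
    Measurable fun a : ℕ → ℕ × ℝ => growthPotential c (clusterSize a t m k) :=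
  (Measurable.of_discrete (f := growthPotential c)).comp (measurable_clusterSize t m k)

theorem integrable_growthPotential_clusterSize (hc : -1 < c) (t : ℝ) (m k : ℕ) :
    Integrable (fun a => growthPotential c (clusterSize a t m k)) treeLaw :=
  Integrable.of_bound (measurable_growthPotential_clusterSize c t m k).aestronglyMeasurable _
    (Eventually.of_forall fun a => abs_growthPotential_clusterSize_le hc a t m k)

theorem setIntegral_growthPotential_succ (hc : -1 < c) (ht : 0 ≤ t) {k : ℕ} (hmk : m ≤ k)
    {A : Set (ℕ → ℕ × ℝ)} (hA : MeasurableSet[treeFiltration k] A) :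
    ∫ a in A, growthPotential c (clusterSize a t m (k + 1)) ∂treeLaw =
      (∫ a in A, growthPotential c (clusterSize a t m k) ∂treeLaw) *
        (1 + Real.exp (-t) * c / ((k : ℝ) + 1)) := by
  have hAm : MeasurableSet A := treeFiltration.le k A hA
  -- `A` depends only on the edges before number `k`, so resampling edge `k` does not affect it.
  have hupd : ∀ (a : ℕ → ℕ × ℝ) (e : ℕ × ℝ), Function.update a k e ∈ A ↔ a ∈ A := by
    obtain ⟨A', -, rfl⟩ := hA
    intro a e
    have : truncateTree k (Function.update a k e) = truncateTree k a := by
      funext j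
      simp only [truncateTree]
      split_ifs with h
      · exact Function.update_of_ne (by omega) _ _
      · rfl
    rw [Set.mem_preimage, Set.mem_preimage, this]
  rw [← integral_indicator hAm, ← integral_indicator hAm, ← integral_mul_const,
    integral_treeLaw_update (k := k)
      ((measurable_growthPotential_clusterSize c t m (k + 1)).indicator hAm)
      (C := ∑ N ∈ Finset.range (k + 1 + 2), growthPotential c N)]
  · congr 1
    funext a
    by_cases ha : a ∈ A
    · rw [Set.indicator_of_mem ha, ← integral_growthPotential_update c ht hmk]
      congr 1
      funext e
      rw [Set.indicator_of_mem ((hupd a e).2 ha)]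
    · rw [Set.indicator_of_notMem ha, zero_mul]
      refine (integral_congr_ae (Eventually.of_forall fun e => ?_)).trans
        (integral_zero (ℕ × ℝ) ℝ)
      exact Set.indicator_of_notMem (fun h => ha ((hupd a e).1 h)) _
  · intro a
    by_cases ha : a ∈ A
    · rw [Set.indicator_of_mem ha]
      exact abs_growthPotential_clusterSize_le hc a t m (k + 1)
    · rw [Set.indicator_of_notMem ha, abs_zero]
      exact Finset.sum_nonneg fun N _ => growthPotential_nonneg hc N

theorem neg_one_lt_exp_mul (hc : -1 < c) (ht : 0 ≤ t) : -1 < Real.exp (-t) * c := by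
  have h1 : Real.exp (-t) ≤ 1 := Real.exp_le_one_iff.2 (by linarith)
  have h0 := Real.exp_pos (-t)
  rcases le_or_gt 0 c with h | h
  · have := mul_nonneg h0.le h
    linarith
  · nlinarith

theorem setIntegral_growthPotential_div_growth (hc : -1 < c) (ht : 0 ≤ t) (n : ℕ)
    {A : Set (ℕ → ℕ × ℝ)} (hA : MeasurableSet[treeFiltration (m + n)] A) :
    ∫ a in A, growthPotential c (clusterSize a t m (m + (n + 1))) /
        growth (Real.exp (-t) * c) (m + (n + 1)) ∂treeLaw =
      ∫ a in A, growthPotential c (clusterSize a t m (m + n)) /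
        growth (Real.exp (-t) * c) (m + n) ∂treeLaw := by
  have hc' := neg_one_lt_exp_mul hc ht
  rw [integral_div, integral_div, ← add_assoc, growth_succ,
    setIntegral_growthPotential_succ hc ht (Nat.le_add_right m n) hA]
  exact mul_div_mul_right _ _ (one_add_div_pos hc' _).ne'

/-- The martingale keeps its mean from `k = m`, where the cluster has at most one vertex and the
potential is at most `1`. -/
theorem integral_growthPotential_div_growth_le (hc : -1 < c) (ht : 0 ≤ t) (n : ℕ) :
    ∫ a, growthPotential c (clusterSize a t m (m + n)) /
        growth (Real.exp (-t) * c) (m + n) ∂treeLaw ≤ (growth (Real.exp (-t) * c) m)⁻¹ := by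
  have hc' := neg_one_lt_exp_mul hc ht
  induction n with
  | zero =>
    rw [add_zero, integral_div, div_eq_mul_inv]
    refine mul_le_of_le_one_left (inv_pos.2 (growth_pos hc' m)).le ?_
    have h1 : ∀ a : ℕ → ℕ × ℝ, growthPotential c (clusterSize a t m m) ≤ 1 := by
      intro a
      rw [clusterSize_self_eq]
      split_ifs
      · simp [growthPotential]
      · simp
    refine (integral_mono (integrable_growthPotential_clusterSize hc t m m)
      (integrable_const 1) h1).trans ?_
    simp
  | succ n ih =>
    have := setIntegral_growthPotential_div_growth (m := m) hc ht n (A := Set.univ) .univ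
    rw [setIntegral_univ, setIntegral_univ] at this
    rw [this]
    exact ih

/-- A martingale bounded in `L¹` converges almost surely; the filtration is shifted by `m` because
the recursion for the cluster starts there. -/
theorem ae_exists_tendsto_growthPotential (hc : -1 < c) (ht : 0 ≤ t) (m : ℕ) :
    ∀ᵐ a ∂treeLaw, ∃ w, Tendsto (fun n => growthPotential c (clusterSize a t m (m + n)) /
      growth (Real.exp (-t) * c) (m + n)) atTop (𝓝 w) := by
  have hc' := neg_one_lt_exp_mul hc ht
  let 𝒢 : Filtration ℕ (inferInstance : MeasurableSpace (ℕ → ℕ × ℝ)) :=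
    { seq := fun n => treeFiltration (m + n)
      mono' := fun n n' h => treeFiltration.mono (by omega)
      le' := fun n => treeFiltration.le _ }
  have hint : ∀ n, Integrable (fun a => growthPotential c (clusterSize a t m (m + n)) /
      growth (Real.exp (-t) * c) (m + n)) treeLaw := fun n =>
    (integrable_growthPotential_clusterSize hc t m (m + n)).div_const _
  have hsub : Submartingale (fun n a => growthPotential c (clusterSize a t m (m + n)) /
      growth (Real.exp (-t) * c) (m + n)) 𝒢 treeLaw := by
    refine submartingale_of_setIntegral_le_succ (fun n => ?_) hint fun n A hA =>
      (setIntegral_growthPotential_div_growth hc ht n hA).ge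
    refine (measurable_treeFiltration (n := m + n)
      ((measurable_growthPotential_clusterSize c t m (m + n)).div_const _)
      fun a => ?_).stronglyMeasurable
    rw [clusterSize_congr (a := truncateTree (m + n) a) (a' := a) fun j hj => if_pos hj]
  refine hsub.exists_ae_tendsto_of_bdd (R := ((growth (Real.exp (-t) * c) m)⁻¹).toNNReal)
    fun n => ?_
  have hnn : ∀ a : ℕ → ℕ × ℝ, 0 ≤ growthPotential c (clusterSize a t m (m + n)) /
      growth (Real.exp (-t) * c) (m + n) := fun a =>
    div_nonneg (growthPotential_nonneg hc _) (growth_pos hc' _).le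
  rw [eLpNorm_one_eq_lintegral_enorm]
  have : ∀ a : ℕ → ℕ × ℝ, ‖growthPotential c (clusterSize a t m (m + n)) /
      growth (Real.exp (-t) * c) (m + n)‖ₑ = ENNReal.ofReal
        (growthPotential c (clusterSize a t m (m + n)) / growth (Real.exp (-t) * c) (m + n)) :=
    fun a => Real.enorm_of_nonneg (hnn a)
  simp only [this]
  rw [← ofReal_integral_eq_lintegral_ofReal (hint n) (Eventually.of_forall hnn)]
  exact ENNReal.ofReal_le_ofReal (integral_growthPotential_div_growth_le hc ht n)

/-- The martingale with `c = 1` gives the limit. The one with `c = -1/2` is almost surely bounded,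
so `N^{-1/2}` is at most of order `k^{-e^{-t}/2}`; this bounds `N / k^{e^{-t}}` away from `0`. -/
theorem ae_exists_tendsto_clusterSize (ht : 0 ≤ t) (m : ℕ) :
    ∀ᵐ a ∂treeLaw, ∃ w, (blockRoot a t m = m → 0 < w) ∧
      Tendsto (fun k : ℕ => (clusterSize a t m k : ℝ) / ((k : ℝ) + 1) ^ Real.exp (-t)) atTop
        (𝓝 w) := by
  have hα := Real.exp_pos (-t)
  have hα1 : Real.exp (-t) ≤ 1 := Real.exp_le_one_iff.2 (by linarith)
  filter_upwards [ae_exists_tendsto_growthPotential (c := 1) (by norm_num) ht m,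
    ae_exists_tendsto_growthPotential (c := -(1 / 2)) (by norm_num) ht m] with a h1 h2
  obtain ⟨w, hw⟩ := h1
  obtain ⟨w', hw'⟩ := h2
  obtain ⟨κ, hκ, hg⟩ := tendsto_growth hα
  have hlim : Tendsto (fun k : ℕ => (clusterSize a t m k : ℝ) / ((k : ℝ) + 1) ^ Real.exp (-t))
      atTop (𝓝 (w * κ)) := by
    simp only [growthPotential_one, mul_one] at hw
    rw [tendsto_congr (fun n => by rw [add_comm m n]),
      tendsto_add_atTop_iff_nat (f := fun k : ℕ => (clusterSize a t m k : ℝ) /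
        growth (Real.exp (-t)) k) m] at hw
    refine (hw.mul hg).congr fun k => ?_
    have := (growth_pos (by linarith : -1 < Real.exp (-t)) k).ne'
    field_simp
  refine ⟨w * κ, fun hm => ?_, hlim⟩
  obtain ⟨B, hB⟩ := hw'.bddAbove_range
  obtain ⟨A, hA, hA'⟩ := exists_le_growth (c := Real.exp (-t) * (1 / 2)) (by positivity)
  have hsize : ∀ n, clusterSize a t m (m + n) ≠ 0 := by
    intro n
    rw [clusterSize, Nat.count_ne_iff_exists]
    exact ⟨m, by omega, hm⟩
  have hpos : ∀ k : ℕ, 0 < ((k : ℝ) + 1) ^ (Real.exp (-t) * (1 / 2)) := fun k => by positivity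
  -- `B` bounds the martingale with `c = -1/2` along this realization, and `A` compares a power with
  -- `growth` at the positive exponent `e^{-t} / 2`.
  have hBA : ∀ n : ℕ, growthPotential (-(1 / 2)) (clusterSize a t m (m + n)) *
      (((m + n : ℕ) : ℝ) + 1) ^ (Real.exp (-t) * (1 / 2)) ≤ B * A := by
    intro n
    have hneg : -1 < Real.exp (-t) * -(1 / 2) := neg_one_lt_exp_mul (by norm_num) ht
    have hgn := growth_pos hneg (m + n)
    have e1 : growthPotential (-(1 / 2)) (clusterSize a t m (m + n)) ≤
        B * growth (Real.exp (-t) * -(1 / 2)) (m + n) := by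
      rw [← div_le_iff₀ hgn]
      exact hB ⟨n, rfl⟩
    have hB0 : 0 ≤ B := by
      have : 0 ≤ growthPotential (-(1 / 2)) (clusterSize a t m (m + n)) :=
        growthPotential_nonneg (by norm_num) _
      by_contra hneg
      have := mul_neg_of_neg_of_pos (not_le.1 hneg) hgn
      linarith
    have e2 := hA' (m + n)
    have e3 : growth (Real.exp (-t) * -(1 / 2)) (m + n) *
        growth (Real.exp (-t) * (1 / 2)) (m + n) ≤ 1 := by
      rw [mul_neg]
      exact growth_neg_mul_growth_le_one (by positivity) (by linarith) _
    calc _ ≤ (B * growth (Real.exp (-t) * -(1 / 2)) (m + n)) *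
        (A * growth (Real.exp (-t) * (1 / 2)) (m + n)) := by gcongr
      _ = B * A * (growth (Real.exp (-t) * -(1 / 2)) (m + n) *
        growth (Real.exp (-t) * (1 / 2)) (m + n)) := by ring
      _ ≤ B * A := mul_le_of_le_one_right (by positivity) e3
  have hBA0 : 0 < B * A := by
    refine lt_of_lt_of_le ?_ (hBA 0)
    refine mul_pos ?_ (hpos _)
    obtain ⟨N, hN⟩ := Nat.exists_eq_succ_of_ne_zero (hsize 0)
    rw [hN]
    exact growth_pos (by norm_num) N
  -- The constant comes from squaring `growth(-1/2, N) x ≤ B A`, with `x² = k^{e^{-t}}` up to a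
  -- shift of `k`, and from `1 ≤ 4 (N + 1) growth(-1/2, N)²`, where the cluster has `N + 1`
  -- vertices.
  have hlow : ∀ n, (4 * (B * A) ^ 2)⁻¹ ≤ (clusterSize a t m (m + n) : ℝ) /
      (((m + n : ℕ) : ℝ) + 1) ^ Real.exp (-t) := by
    intro n
    obtain ⟨N, hN⟩ := Nat.exists_eq_succ_of_ne_zero (hsize n)
    have e1 := hBA n
    rw [hN] at e1 ⊢
    change growth (-(1 / 2)) N * _ ≤ B * A at e1
    have e2 := one_le_mul_growth_neg_half_sq N
    have hgN : 0 < growth (-(1 / 2)) N := growth_pos (by norm_num) N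
    have e3 : (((m + n : ℕ) : ℝ) + 1) ^ Real.exp (-t) =
        ((((m + n : ℕ) : ℝ) + 1) ^ (Real.exp (-t) * (1 / 2))) ^ 2 := by
      rw [← Real.rpow_natCast, ← Real.rpow_mul (by positivity)]
      congr 1
      push_cast
      ring
    rw [e3, inv_le_iff_one_le_mul₀ (by positivity), Nat.succ_eq_add_one]
    set x := (((m + n : ℕ) : ℝ) + 1) ^ (Real.exp (-t) * (1 / 2))
    rw [div_mul_eq_mul_div, le_div_iff₀ (by positivity), one_mul]
    push_cast
    calc x ^ 2 = 1 * x ^ 2 := (one_mul _).symm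
      _ ≤ (4 * ((N : ℝ) + 1) * growth (-(1 / 2)) N ^ 2) * x ^ 2 := by gcongr
      _ = ((N : ℝ) + 1) * (4 * (growth (-(1 / 2)) N * x) ^ 2) := by ring
      _ ≤ ((N : ℝ) + 1) * (4 * (B * A) ^ 2) := by gcongr
  refine lt_of_lt_of_le (by positivity : 0 < (4 * (B * A) ^ 2)⁻¹)
    (ge_of_tendsto hlim (eventually_atTop.2 ⟨m, fun k hk => ?_⟩))
  obtain ⟨n, rfl⟩ := Nat.exists_eq_add_of_le hk
  exact hlow n

theorem tendsto_scaledCount_iff {a : ℕ → ℕ × ℝ} {w : ℝ} :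
    HasWeight t {j | blockRoot a t j = m} w ↔
      Tendsto (fun k : ℕ => (clusterSize a t m k : ℝ) / ((k : ℝ) + 1) ^ Real.exp (-t)) atTop
        (𝓝 w) := by
  rw [HasWeight, ← tendsto_add_atTop_iff_nat 1]
  refine tendsto_congr fun k => ?_
  rw [scaledCount_eq, clusterSize, Real.rpow_neg (Nat.cast_nonneg _), div_eq_inv_mul]
  push_cast
  rfl

theorem ae_hasWeight (ht : 0 ≤ t) : ∀ᵐ a ∂treeLaw, ∀ m, ∃ w, (blockRoot a t m = m → 0 < w) ∧
    HasWeight t {j | blockRoot a t j = m} w := by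
  simp only [tendsto_scaledCount_iff]
  exact ae_all_iff.2 fun m => ae_exists_tendsto_clusterSize ht m

end Convergence

/-! ### Moments of the weights -/

section Moments

variable {t p : ℝ}

theorem measurable_vertexWeight (t : ℝ) (m : ℕ) :
    Measurable fun a : ℕ → ℕ × ℝ => vertexWeight a t m := by
  classical
  have hroot : ∀ j, MeasurableSet {a : ℕ → ℕ × ℝ | blockRoot a t j = m} := fun j =>
    measurable_blockRoot t j (measurableSet_singleton m)
  exact Measurable.ite (hroot m) (measurable_weight hroot t) measurable_const

theorem measurable_powerSum_vertexWeight (p t : ℝ) :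
    Measurable fun a : ℕ → ℕ × ℝ => powerSum p (vertexWeight a t) :=
  Measurable.tsum fun m => (measurable_vertexWeight t m).ennreal_ofReal.pow_const _

theorem clusterSize_rpow_le (hp : 0 < p) (t : ℝ) : ∃ A > 0, ∀ (a : ℕ → ℕ × ℝ) (m k : ℕ),
    ((clusterSize a t m k : ℝ) / ((k : ℝ) + 1) ^ Real.exp (-t)) ^ p ≤
      A * (growthPotential p (clusterSize a t m k) / growth (Real.exp (-t) * p) k) := by
  have hαp : 0 < Real.exp (-t) * p := by positivity
  obtain ⟨A, hA, hA'⟩ := exists_le_growth hp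
  obtain ⟨B, hB, hB'⟩ := exists_growth_le hαp
  refine ⟨A * B, by positivity, fun a m k => ?_⟩
  have hpot : (clusterSize a t m k : ℝ) ^ p ≤ A * growthPotential p (clusterSize a t m k) := by
    cases clusterSize a t m k with
    | zero => simp [hp.ne']
    | succ N => exact_mod_cast hA' N
  have hg := growth_pos (by linarith : -1 < Real.exp (-t) * p) k
  have hpotnn := growthPotential_nonneg (by linarith : -1 < p) (clusterSize a t m k)
  rw [Real.div_rpow (Nat.cast_nonneg _) (by positivity), ← Real.rpow_mul (by positivity),
    div_le_iff₀ (by positivity)]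
  refine hpot.trans ?_
  have : A * B * (growthPotential p (clusterSize a t m k) / growth (Real.exp (-t) * p) k) *
      ((k : ℝ) + 1) ^ (Real.exp (-t) * p) = A * growthPotential p (clusterSize a t m k) *
      (B * ((k : ℝ) + 1) ^ (Real.exp (-t) * p) / growth (Real.exp (-t) * p) k) := by
    ring
  rw [this]
  refine le_mul_of_one_le_right (by positivity) ?_
  rw [one_le_div hg]
  exact hB' k

/-- By Fatou's lemma the moment is controlled by the mean of the martingale with `c = p`. The decay
in `m` comes from its initial normalization `1 / growth (e^{-t} p) m`: a late cluster starts with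
one vertex at a late stage. -/
theorem lintegral_vertexWeight_rpow_le (ht : 0 ≤ t) (hp : 0 < p) : ∃ A : ℝ, 0 < A ∧ ∀ m : ℕ,
    ∫⁻ a, ENNReal.ofReal (vertexWeight a t m) ^ p ∂treeLaw ≤
      ENNReal.ofReal (A * (((m : ℝ) + 1) ^ (Real.exp (-t) * p))⁻¹) := by
  have hαp : 0 < Real.exp (-t) * p := by positivity
  obtain ⟨A, hA, hA'⟩ := clusterSize_rpow_le hp t
  obtain ⟨B, hB, hB'⟩ := exists_le_growth hαp
  refine ⟨A * B, by positivity, fun m => ?_⟩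
  let Z : ℕ → (ℕ → ℕ × ℝ) → ℝ≥0∞ := fun k a =>
    ENNReal.ofReal (((clusterSize a t m k : ℝ) / ((k : ℝ) + 1) ^ Real.exp (-t)) ^ p)
  have hZm : ∀ k, Measurable (Z k) := fun k =>
    (((Measurable.of_discrete (f := fun N : ℕ => (N : ℝ))).comp
      (measurable_clusterSize t m k)).div_const _ |>.pow_const p).ennreal_ofReal
  have hfatou : ∀ᵐ a ∂treeLaw,
      ENNReal.ofReal (vertexWeight a t m) ^ p ≤ liminf (fun n => Z (m + n) a) atTop := by
    filter_upwards [ae_hasWeight ht] with a ha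
    obtain ⟨w, hw0, hw⟩ := ha m
    by_cases hm : blockRoot a t m = m
    · have hV : vertexWeight a t m = w := by
        rw [vertexWeight, if_pos hm, weight]
        exact hw.limUnder_eq
      rw [hV]
      rw [tendsto_scaledCount_iff, ← tendsto_add_atTop_iff_nat m] at hw
      have h1 := ENNReal.tendsto_ofReal ((hw.rpow_const (p := p) (Or.inr hp.le)))
      have h2 : Tendsto (fun n => Z (m + n) a) atTop (𝓝 (ENNReal.ofReal (w ^ p))) :=
        h1.congr fun n => by
          change _ = ENNReal.ofReal _
          rw [add_comm m n]
      rw [h2.liminf_eq, ENNReal.ofReal_rpow_of_nonneg (hw0 hm).le hp.le]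
    · rw [vertexWeight, if_neg hm]
      simp [hp]
  refine (lintegral_mono_ae hfatou).trans ((lintegral_liminf_le fun n => hZm _).trans ?_)
  refine liminf_le_of_frequently_le' (Frequently.of_forall fun n => ?_)
  have hpot := fun a => growthPotential_nonneg (by linarith : -1 < p) (clusterSize a t m (m + n))
  have hg := growth_pos (by linarith : -1 < Real.exp (-t) * p)
  calc ∫⁻ a, Z (m + n) a ∂treeLaw
      ≤ ∫⁻ a, ENNReal.ofReal (A * (growthPotential p (clusterSize a t m (m + n)) /
          growth (Real.exp (-t) * p) (m + n))) ∂treeLaw :=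
        lintegral_mono fun a => ENNReal.ofReal_le_ofReal (hA' a m (m + n))
    _ = ENNReal.ofReal (∫ a, A * (growthPotential p (clusterSize a t m (m + n)) /
          growth (Real.exp (-t) * p) (m + n)) ∂treeLaw) := by
        refine (ofReal_integral_eq_lintegral_ofReal ?_ (Eventually.of_forall fun a => ?_)).symm
        · exact ((integrable_growthPotential_clusterSize (by linarith) t m _).div_const _).const_mul _
        · exact mul_nonneg hA.le (div_nonneg (hpot a) (hg _).le)
    _ ≤ ENNReal.ofReal (A * B * (((m : ℝ) + 1) ^ (Real.exp (-t) * p))⁻¹) := by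
        refine ENNReal.ofReal_le_ofReal ?_
        rw [integral_const_mul, mul_assoc]
        refine mul_le_mul_of_nonneg_left ?_ hA.le
        refine (integral_growthPotential_div_growth_le (by linarith) ht n).trans ?_
        rw [← div_eq_mul_inv, le_div_iff₀ (by positivity), inv_mul_le_iff₀ (hg m), mul_comm (growth _ _)]
        exact hB' m

/-- The moment bounds form a Riemann series of exponent `e^{-t} p > 1`. -/
theorem lintegral_powerSum_vertexWeight_ne_top (ht : 0 ≤ t) (hp : Real.exp t < p) :
    ∫⁻ a, powerSum p (vertexWeight a t) ∂treeLaw ≠ ⊤ := by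
  have hp0 : 0 < p := (Real.exp_pos t).trans hp
  obtain ⟨A, hA, hA'⟩ := lintegral_vertexWeight_rpow_le ht hp0
  simp only [powerSum]
  rw [lintegral_tsum fun m =>
    ((measurable_vertexWeight t m).ennreal_ofReal.pow_const _).aemeasurable]
  refine ne_top_of_le_ne_top ?_ (ENNReal.tsum_le_tsum hA')
  have h1 : 1 < Real.exp (-t) * p := by
    rw [Real.exp_neg, ← div_eq_inv_mul, one_lt_div (Real.exp_pos t)]
    exact hp
  have hsum : Summable fun m : ℕ => A * (((m : ℝ) + 1) ^ (Real.exp (-t) * p))⁻¹ := by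
    have := (summable_nat_add_iff 1).2 (Real.summable_nat_rpow_inv.2 h1)
    push_cast at this
    exact this.mul_left A
  rw [← ENNReal.ofReal_tsum_of_nonneg (fun m => by positivity) hsum]
  exact ENNReal.ofReal_ne_top

theorem ae_powerSum_vertexWeight_ne_top (ht : 0 ≤ t) (hp : Real.exp t < p) :
    ∀ᵐ a ∂treeLaw, powerSum p (vertexWeight a t) ≠ ⊤ := by
  filter_upwards [ae_lt_top (measurable_powerSum_vertexWeight p t)
    (lintegral_powerSum_vertexWeight_ne_top ht hp)] with a ha
  exact ha.ne

end Moments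

/-! ### Enumeration of a set of vertices -/

theorem Nat.nth_mem_of_lt_count {p : ℕ → Prop} [DecidablePred p] {n k : ℕ} (h : n < Nat.count p k) :
    p (Nat.nth p n) := by
  refine Nat.nth_mem n fun hf => h.trans_le ?_
  rw [Nat.count_eq_card_filter_range]
  refine Finset.card_le_card fun j hj => ?_
  simpa using (Finset.mem_filter.1 hj).2

theorem Nat.sum_range_count {M : Type*} [AddCommMonoid M] (p : ℕ → Prop) [DecidablePred p]
    (f : ℕ → M) (n : ℕ) :
    ∑ v ∈ Finset.range (Nat.count p n), f (Nat.nth p v) =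
      ∑ w ∈ Finset.range n, if p w then f w else 0 := by
  induction n with
  | zero => simp
  | succ n ih =>
    rw [Finset.sum_range_succ, ← ih, Nat.count_succ]
    split_ifs with h
    · rw [Finset.sum_range_succ, Nat.nth_count h]
    · simp

theorem infinite_of_tendsto_count {p : ℕ → Prop} [DecidablePred p]
    (h : Tendsto (Nat.count p) atTop atTop) : (Set.ofPred p).Infinite := by
  intro hf
  obtain ⟨n, hn⟩ := (h.eventually_gt_atTop hf.toFinset.card).exists
  refine absurd hn (not_lt.2 ?_)
  rw [Nat.count_eq_card_filter_range]
  refine Finset.card_le_card fun j hj => ?_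
  simpa using (Finset.mem_filter.1 hj).2

theorem HasWeight.tendsto_count {p : ℕ → Prop} [DecidablePred p] {t w : ℝ}
    (h : HasWeight t {j | p j} w) (hw : 0 < w) : Tendsto (Nat.count p) atTop atTop := by
  have h1 : Tendsto (fun n : ℕ => (n : ℝ) ^ Real.exp (-t)) atTop atTop :=
    (tendsto_rpow_atTop (Real.exp_pos _)).comp tendsto_natCast_atTop_atTop
  have h2 := h1.atTop_mul_pos hw h
  rw [← tendsto_natCast_atTop_iff (R := ℝ)]
  refine h2.congr' ?_
  filter_upwards [eventually_gt_atTop 0] with n hn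
  have hn' : (0 : ℝ) < n := by exact_mod_cast hn
  rw [scaledCount_eq, ← mul_assoc, ← Real.rpow_add hn', add_neg_cancel, Real.rpow_zero, one_mul]

/-! ### Replacing the trees inside the clusters -/

/-- The tree in which the edges of `a` alive at time `s` have been replaced: the cluster at time `s`
whose smallest vertex is `m` receives the tree `b m`, transported by the increasing enumeration of
the cluster, with removal times delayed by `s`. -/
noncomputable def splice (s : ℝ) (a : ℕ → ℕ × ℝ) (b : ℕ → ℕ → ℕ × ℝ) (k : ℕ) : ℕ × ℝ :=
  haveI := Classical.dec (s < (a k).2)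
  if s < (a k).2 then
    (Nat.nth (fun j => blockRoot a s j = blockRoot a s (k + 1))
      (b (blockRoot a s (k + 1)) (clusterSize a s (blockRoot a s (k + 1)) k - 1)).1,
      s + (b (blockRoot a s (k + 1)) (clusterSize a s (blockRoot a s (k + 1)) k - 1)).2)
  else a k

section Splice

variable {s t : ℝ} {a : ℕ → ℕ × ℝ} {b : ℕ → ℕ → ℕ × ℝ} {k m : ℕ}

/-- With `N` vertices of its cluster before it, vertex `k + 1` is number `N` in the enumeration from
`0`. Since edge number `j` belongs to vertex `j + 1`, it reads edge `N - 1` of the inserted tree; `N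
> 0` because its parent in `a` precedes it in the cluster. -/
theorem splice_of_lt (h : s < (a k).2) : splice s a b k =
    (Nat.nth (fun j => blockRoot a s j = blockRoot a s (k + 1))
      (b (blockRoot a s (k + 1)) (clusterSize a s (blockRoot a s (k + 1)) k - 1)).1,
      s + (b (blockRoot a s (k + 1)) (clusterSize a s (blockRoot a s (k + 1)) k - 1)).2) := by
  rw [splice, if_pos h]

theorem splice_of_le (h : (a k).2 ≤ s) : splice s a b k = a k := by
  rw [splice, if_neg (not_lt.2 h)]

theorem clusterSize_blockRoot_succ_pos (h : s < (a k).2) :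
    0 < clusterSize a s (blockRoot a s (k + 1)) k := by
  rw [pos_iff_ne_zero, clusterSize, Nat.count_ne_iff_exists]
  exact ⟨min (a k).1 k, Nat.lt_succ_of_le (min_le_right _ _), (blockRoot_succ_of_lt' h).symm⟩

theorem splice_parent_spec (hb : ∀ m, ParentsEarlier (b m)) (h : s < (a k).2) :
    (splice s a b k).1 ≤ k ∧ blockRoot a s (splice s a b k).1 = blockRoot a s (k + 1) := by
  rw [splice_of_lt h]
  have hpos := clusterSize_blockRoot_succ_pos h
  have hlt : (b (blockRoot a s (k + 1)) (clusterSize a s (blockRoot a s (k + 1)) k - 1)).1 <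
      Nat.count (fun j => blockRoot a s j = blockRoot a s (k + 1)) (k + 1) := by
    have := hb (blockRoot a s (k + 1)) (clusterSize a s (blockRoot a s (k + 1)) k - 1)
    rw [← clusterSize]
    omega
  exact ⟨Nat.lt_succ_iff.1 (Nat.nth_lt_of_lt_count hlt),
    Nat.nth_mem_of_lt_count (p := fun j => blockRoot a s j = blockRoot a s (k + 1)) hlt⟩

theorem parentsEarlier_splice (ha : ParentsEarlier a) (hb : ∀ m, ParentsEarlier (b m)) :
    ParentsEarlier (splice s a b) := by
  intro k
  by_cases h : s < (a k).2
  · exact (splice_parent_spec hb h).1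
  · rw [splice_of_le (not_lt.1 h)]
    exact ha k

/-- Edges dead at time `s` are untouched, with their removal times. The others stay alive until
after `s`, and their new parents lie in the same cluster at time `s`, hence in the same cluster at
the earlier time `r`. -/
theorem blockRoot_splice_of_le (ha : ParentsEarlier a) (hb : ∀ m, ParentsEarlier (b m))
    (hb' : ∀ m k, 0 < (b m k).2) {r : ℝ} (hr : r ≤ s) (n : ℕ) :
    blockRoot (splice s a b) r n = blockRoot a r n := by
  induction n using Nat.strong_induction_on with
  | _ n ih =>
    cases n with
    | zero => simp
    | succ k =>
      by_cases h : s < (a k).2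
      · obtain ⟨h1, h2⟩ := splice_parent_spec hb h
        have h3 : r < (splice s a b k).2 := by
          rw [splice_of_lt h]
          have := hb' (blockRoot a s (k + 1)) (clusterSize a s (blockRoot a s (k + 1)) k - 1)
          dsimp only
          linarith
        rw [blockRoot_succ_of_lt (parentsEarlier_splice ha hb) h3, ih _ (by omega),
          ← blockRoot_blockRoot_of_le hr, h2, blockRoot_blockRoot_of_le hr]
      · have hk : splice s a b k = a k := splice_of_le (not_lt.1 h)
        by_cases hr' : r < (a k).2
        · rw [blockRoot_succ_of_lt (parentsEarlier_splice ha hb) (by rwa [hk]), hk,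
            blockRoot_succ_of_lt ha hr']
          exact ih _ (by have := ha k; omega)
        · rw [blockRoot_succ_of_le (not_lt.1 hr'), blockRoot_succ_of_le (by rw [hk]; exact not_lt.1 hr')]

theorem count_blockRoot_self (hm : blockRoot a s m = m) :
    Nat.count (fun j => blockRoot a s j = m) m = 0 := by
  have h := clusterSize_self_eq (a := a) (t := s) (m := m)
  rw [if_pos hm, clusterSize, Nat.count_succ, if_pos hm] at h
  omega

theorem nth_blockRoot_zero (hm : blockRoot a s m = m) :
    Nat.nth (fun j => blockRoot a s j = m) 0 = m := by
  have := Nat.nth_count (p := fun j => blockRoot a s j = m) hm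
  rwa [count_blockRoot_self hm] at this

/-- Inside the cluster of `m`, the spliced tree at time `s + t` is the image of `b m` at time `t`
under the increasing enumeration of the cluster. -/
theorem blockRoot_splice_nth (ht : 0 ≤ t) (ha : ParentsEarlier a)
    (hb : ∀ m, ParentsEarlier (b m)) (hm : blockRoot a s m = m)
    (hinf : (Set.ofPred fun j => blockRoot a s j = m).Infinite) (l : ℕ) :
    blockRoot (splice s a b) (s + t) (Nat.nth (fun j => blockRoot a s j = m) l) =
      Nat.nth (fun j => blockRoot a s j = m) (blockRoot (b m) t l) := by
  have ha' := parentsEarlier_splice (s := s) ha hb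
  induction l using Nat.strong_induction_on with
  | _ l ih =>
    cases l with
    | zero =>
      rw [blockRoot_zero, nth_blockRoot_zero hm]
      cases m with
      | zero => simp
      | succ k =>
        -- The edge above the smallest vertex of a cluster is already dead at time `s`, so splicing
        -- leaves it unchanged and it is dead at time `s + t`.
        have h : (a k).2 ≤ s := by
          by_contra hcon
          rw [blockRoot_succ_of_lt' (not_le.1 hcon)] at hm
          have := blockRoot_le a s (min (a k).1 k)
          omega
        exact blockRoot_succ_of_le (by rw [splice_of_le h]; linarith)
    | succ j =>
      have hlt := Nat.nth_strictMono hinf (show 0 < j + 1 from j.succ_pos)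
      rw [nth_blockRoot_zero hm] at hlt
      have hmem : blockRoot a s (Nat.nth (fun j => blockRoot a s j = m) (j + 1)) = m :=
        Nat.nth_mem_of_infinite hinf (j + 1)
      have hcount : Nat.count (fun j => blockRoot a s j = m)
          (Nat.nth (fun j => blockRoot a s j = m) (j + 1)) = j + 1 :=
        Nat.count_nth_of_infinite hinf (j + 1)
      obtain ⟨k, hk⟩ : ∃ k, Nat.nth (fun j => blockRoot a s j = m) (j + 1) = k + 1 :=
        Nat.exists_eq_succ_of_ne_zero (by omega)
      rw [hk] at hmem hcount hlt ⊢
      have halive : s < (a k).2 := by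
        by_contra hcon
        rw [blockRoot_succ_of_le (not_lt.1 hcon)] at hmem
        omega
      have hs := splice_of_lt (b := b) halive
      rw [hmem, clusterSize, hcount, Nat.add_sub_cancel] at hs
      by_cases htb : t < (b m j).2
      · rw [blockRoot_succ_of_lt ha' (by rw [hs]; dsimp only; linarith), hs,
          blockRoot_succ_of_lt (hb m) htb]
        exact ih _ (by have := hb m j; omega)
      · rw [blockRoot_succ_of_le (by rw [hs]; dsimp only; linarith),
          blockRoot_succ_of_le (not_lt.1 htb), hk]

theorem blockRoot_splice_eq_imp (ht : 0 ≤ t) (ha : ParentsEarlier a)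
    (hb : ∀ m, ParentsEarlier (b m)) (hb' : ∀ m k, 0 < (b m k).2) (n : ℕ) :
    blockRoot a s (blockRoot (splice s a b) (s + t) n) = blockRoot a s n := by
  rw [← blockRoot_splice_of_le ha hb hb' le_rfl, blockRoot_blockRoot_of_le (by linarith),
    blockRoot_splice_of_le ha hb hb' le_rfl]

/-- Counting functions compose: the vertices below `n` in the cluster of `m` are an initial segment
of its enumeration, on which the blocks are those of `b m`. -/
theorem count_blockRoot_splice (ht : 0 ≤ t) (ha : ParentsEarlier a)
    (hb : ∀ m, ParentsEarlier (b m)) (hb' : ∀ m k, 0 < (b m k).2) (hm : blockRoot a s m = m)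
    (hinf : (Set.ofPred fun j => blockRoot a s j = m).Infinite) (l n : ℕ) :
    Nat.count (fun i => blockRoot (splice s a b) (s + t) i =
        Nat.nth (fun j => blockRoot a s j = m) l) n =
      Nat.count (fun i => blockRoot (b m) t i = l) (Nat.count (fun j => blockRoot a s j = m) n) := by
  induction n with
  | zero => simp
  | succ n ih =>
    rw [Nat.count_succ, ih, Nat.count_succ (p := fun j => blockRoot a s j = m)]
    by_cases hn : blockRoot a s n = m
    · rw [if_pos hn, Nat.count_succ]
      congr 1
      refine if_congr ?_ rfl rfl
      have h1 := blockRoot_splice_nth ht ha hb hm hinf (Nat.count (fun j => blockRoot a s j = m) n)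
      rw [Nat.nth_count (p := fun j => blockRoot a s j = m) hn] at h1
      rw [h1]
      exact (Nat.nth_injective hinf).eq_iff
    · rw [if_neg hn, add_zero, add_eq_left]
      refine if_neg fun h => ?_
      have h1 := blockRoot_splice_eq_imp (s := s) ht ha hb hb' n
      rw [h] at h1
      exact hn (h1.symm.trans (Nat.nth_mem_of_infinite hinf l))

/-- With `N` the number of cluster vertices below `n`, the two limits are `N n^{-e^{-s}} → w` and
`count N^{-e^{-t}} → w'`. Raising the first to the power `e^{-t}` and multiplying cancels `N`. -/
theorem hasWeight_splice (ht : 0 ≤ t) (ha : ParentsEarlier a)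
    (hb : ∀ m, ParentsEarlier (b m)) (hb' : ∀ m k, 0 < (b m k).2) (hm : blockRoot a s m = m)
    {w w' : ℝ} (hw : 0 < w) (hwa : HasWeight s {j | blockRoot a s j = m} w) {l : ℕ}
    (hwb : HasWeight t {j | blockRoot (b m) t j = l} w') :
    HasWeight (s + t) {i | blockRoot (splice s a b) (s + t) i =
      Nat.nth (fun j => blockRoot a s j = m) l} (w ^ Real.exp (-t) * w') := by
  have htend := hwa.tendsto_count hw
  have hinf := infinite_of_tendsto_count htend
  have h1 := (Tendsto.rpow_const hwa (p := Real.exp (-t)) (Or.inl hw.ne')).mul (hwb.comp htend)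
  refine h1.congr' ?_
  filter_upwards [htend.eventually_gt_atTop 0, eventually_gt_atTop 0] with n hN hn
  have hN' : (0 : ℝ) < Nat.count (fun j => blockRoot a s j = m) n := by exact_mod_cast hN
  have hn' : (0 : ℝ) < n := by exact_mod_cast hn
  rw [Function.comp_apply, scaledCount_eq, scaledCount_eq, scaledCount_eq,
    count_blockRoot_splice ht ha hb hb' hm hinf, Real.mul_rpow (by positivity) hN'.le,
    ← Real.rpow_mul hn'.le, neg_mul, ← Real.exp_add, ← neg_add, mul_assoc]
  congr 1
  rw [← mul_assoc, ← Real.rpow_add hN', add_neg_cancel, Real.rpow_zero, one_mul]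

theorem vertexWeight_of_hasWeight {w : ℝ} (hm : blockRoot a t m = m)
    (hw : HasWeight t {j | blockRoot a t j = m} w) : vertexWeight a t m = w := by
  rw [vertexWeight, if_pos hm, weight]
  exact hw.limUnder_eq

/-- Every cluster at time `t` has a positive weight. -/
def HasPositiveWeights (a : ℕ → ℕ × ℝ) (t : ℝ) : Prop :=
  ∀ m, blockRoot a t m = m → ∃ w, 0 < w ∧ HasWeight t {j | blockRoot a t j = m} w

theorem HasPositiveWeights.nonneg (h : HasPositiveWeights a t) (m : ℕ) :
    0 ≤ vertexWeight a t m := by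
  by_cases hm : blockRoot a t m = m
  · obtain ⟨w, hw, hw'⟩ := h m hm
    rw [vertexWeight_of_hasWeight hm hw']
    exact hw.le
  · rw [vertexWeight, if_neg hm]

theorem vertexWeight_splice_nth (ht : 0 ≤ t) (ha : ParentsEarlier a)
    (hb : ∀ m, ParentsEarlier (b m)) (hb' : ∀ m k, 0 < (b m k).2)
    (hwa : HasPositiveWeights a s) (hwb : ∀ m, HasPositiveWeights (b m) t)
    (hm : blockRoot a s m = m) (l : ℕ) :
    vertexWeight (splice s a b) (s + t) (Nat.nth (fun j => blockRoot a s j = m) l) =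
      vertexWeight a s m ^ Real.exp (-t) * vertexWeight (b m) t l := by
  obtain ⟨w, hw, hw'⟩ := hwa m hm
  have hinf := infinite_of_tendsto_count (hw'.tendsto_count hw)
  have hroot := blockRoot_splice_nth ht ha hb hm hinf l
  by_cases hl : blockRoot (b m) t l = l
  · obtain ⟨v, hv, hv'⟩ := hwb m l hl
    rw [vertexWeight_of_hasWeight hm hw', vertexWeight_of_hasWeight hl hv']
    refine vertexWeight_of_hasWeight (by rw [hroot, hl]) ?_
    exact hasWeight_splice ht ha hb hb' hm hw hw' hv'
  · rw [vertexWeight, if_neg, vertexWeight, vertexWeight, if_neg hl, mul_zero]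
    rw [hroot]
    exact fun h => hl (Nat.nth_injective hinf h)

/-- The pair `(m, l)` corresponds to vertex number `l` of the cluster of `m`; the inverse sends a
vertex to its root at time `s` and its position in that cluster. -/
theorem samePositive_splice (ht : 0 ≤ t) (ha : ParentsEarlier a)
    (hb : ∀ m, ParentsEarlier (b m)) (hb' : ∀ m k, 0 < (b m k).2)
    (hwa : HasPositiveWeights a s) (hwb : ∀ m, HasPositiveWeights (b m) t) :
    SamePositive (fun p : ℕ × ℕ => vertexWeight a s p.1 ^ Real.exp (-t) *
      vertexWeight (b p.1) t p.2) (vertexWeight (splice s a b) (s + t)) := by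
  have hroot : ∀ p : ℕ × ℕ, 0 < vertexWeight a s p.1 ^ Real.exp (-t) *
      vertexWeight (b p.1) t p.2 → blockRoot a s p.1 = p.1 := by
    intro p hp
    by_contra hcon
    rw [vertexWeight, if_neg hcon, Real.zero_rpow (Real.exp_pos _).ne', zero_mul] at hp
    exact lt_irrefl _ hp
  have hinf : ∀ m, blockRoot a s m = m → (Set.ofPred fun j => blockRoot a s j = m).Infinite := by
    intro m hm
    obtain ⟨w, hw, hw'⟩ := hwa m hm
    exact infinite_of_tendsto_count (hw'.tendsto_count hw)
  refine SamePositive.of_map (fun p => Nat.nth (fun j => blockRoot a s j = p.1) p.2) ?_ ?_ ?_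
  · rintro ⟨m, l⟩ ⟨m', l'⟩ h h' heq
    have hm := hroot _ h
    have hm' := hroot _ h'
    have e1 : blockRoot a s (Nat.nth (fun j => blockRoot a s j = m) l) = m :=
      Nat.nth_mem_of_infinite (hinf m hm) l
    have e2 : blockRoot a s (Nat.nth (fun j => blockRoot a s j = m') l') = m' :=
      Nat.nth_mem_of_infinite (hinf m' hm') l'
    dsimp only at heq
    obtain rfl : m = m' := by rw [← e1, heq, e2]
    rw [Nat.nth_injective (hinf m hm) heq]
  · intro p hp
    exact vertexWeight_splice_nth ht ha hb hb' hwa hwb (hroot p hp) p.2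
  · intro n hn
    have hm := blockRoot_blockRoot (a := a) (t := s) n
    have hnth : Nat.nth (fun j => blockRoot a s j = blockRoot a s n)
        (Nat.count (fun j => blockRoot a s j = blockRoot a s n) n) = n :=
      Nat.nth_count (p := fun j => blockRoot a s j = blockRoot a s n) rfl
    refine ⟨(blockRoot a s n, Nat.count (fun j => blockRoot a s j = blockRoot a s n) n), ?_, hnth⟩
    dsimp only
    rw [← vertexWeight_splice_nth ht ha hb hb' hwa hwb hm, hnth]
    exact hn

end Splice

/-! ### The spliced tree is a recursive tree -/

section SpliceLaw

theorem measurable_apply_apply {Ω β : Type*} [MeasurableSpace Ω] [MeasurableSpace β]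
    {g : Ω → ℕ → β} {f : Ω → ℕ} (hg : Measurable g) (hf : Measurable f) :
    Measurable fun ω => g ω (f ω) :=
  (measurable_from_prod_countable_left (f := fun p : (ℕ → β) × ℕ => p.1 p.2)
    fun n => measurable_pi_apply n).comp (hg.prodMk hf)

theorem measurable_nth {Ω : Type*} [MeasurableSpace Ω] {p : Ω → ℕ → Prop}
    (hp : ∀ j, MeasurableSet {ω | p ω j}) (n : ℕ) : Measurable fun ω => Nat.nth (p ω) n := by
  induction n using Nat.strong_induction_on with
  | _ n ih =>
    let Q : ℕ → Set Ω := fun x => {ω | p ω x} ∩ ⋂ k, ⋂ (_ : k < n), {ω | Nat.nth (p ω) k < x}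
    have hQ : ∀ x, MeasurableSet (Q x) := fun x => (hp x).inter
      (MeasurableSet.iInter fun k => MeasurableSet.iInter fun hk =>
        measurableSet_lt (ih k hk) measurable_const)
    have hmem : ∀ ω x, ω ∈ Q x ↔ x ∈ {x | p ω x ∧ ∀ k < n, Nat.nth (p ω) k < x} := by
      intro ω x
      simp [Q]
    refine measurable_to_countable' fun w => ?_
    -- `Nat.nth` is the infimum of a set of candidates; the second event covers the empty set, whose
    -- infimum is `0` by convention.
    have heq : (fun ω => Nat.nth (p ω) n) ⁻¹' {w} =
        (Q w ∩ ⋂ x, ⋂ (_ : x < w), (Q x)ᶜ) ∪ ({_ω | w = 0} ∩ ⋂ x, (Q x)ᶜ) := by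
      ext ω
      simp only [Set.mem_preimage, Set.mem_singleton_iff, Set.mem_union, Set.mem_inter_iff,
        Set.mem_iInter, Set.mem_compl_iff, hmem, Set.mem_ofPred_eq (p := fun _ => w = 0)]
      rw [Nat.nth_eq_sInf]
      constructor
      · intro h
        rcases Set.eq_empty_or_nonempty {x | p ω x ∧ ∀ k < n, Nat.nth (p ω) k < x} with he | hne
        · right
          rw [he] at h ⊢
          exact ⟨by simpa using h.symm, fun x hx => hx⟩
        · left
          rw [← h]
          exact ⟨Nat.sInf_mem hne, fun x hx => Nat.notMem_of_lt_sInf hx⟩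
      · rintro (⟨h1, h2⟩ | ⟨rfl, h⟩)
        · refine le_antisymm (Nat.sInf_le h1) (not_lt.1 fun hlt => ?_)
          exact h2 _ hlt (Nat.sInf_mem ⟨w, h1⟩)
        · rw [Set.eq_empty_iff_forall_notMem.2 h, Nat.sInf_empty]
    rw [heq]
    exact ((hQ w).inter (MeasurableSet.iInter fun x => MeasurableSet.iInter fun _ =>
      (hQ x).compl)).union ((MeasurableSet.const _).inter (MeasurableSet.iInter fun x =>
      (hQ x).compl))

variable {s : ℝ}

theorem measurableSet_blockRoot_eq (s : ℝ) (j k : ℕ) :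
    MeasurableSet {a : ℕ → ℕ × ℝ | blockRoot a s j = blockRoot a s k} :=
  measurableSet_eq_fun (measurable_blockRoot s j) (measurable_blockRoot s k)

theorem measurable_clusterSize_blockRoot (s : ℝ) (k : ℕ) :
    Measurable fun a : ℕ → ℕ × ℝ => clusterSize a s (blockRoot a s (k + 1)) k :=
  measurable_count (fun j => measurableSet_blockRoot_eq s j (k + 1)) _

theorem measurable_splice (s : ℝ) :
    Measurable fun p : (ℕ → ℕ × ℝ) × (ℕ → ℕ → ℕ × ℝ) => splice s p.1 p.2 := by
  classical
  refine measurable_pi_lambda _ fun k => ?_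
  have hk : Measurable fun p : (ℕ → ℕ × ℝ) × (ℕ → ℕ → ℕ × ℝ) => p.1 k :=
    (measurable_pi_apply k).comp measurable_fst
  have he : Measurable fun p : (ℕ → ℕ × ℝ) × (ℕ → ℕ → ℕ × ℝ) =>
      p.2 (blockRoot p.1 s (k + 1)) (clusterSize p.1 s (blockRoot p.1 s (k + 1)) k - 1) := by
    refine measurable_apply_apply (measurable_apply_apply measurable_snd
      ((measurable_blockRoot s (k + 1)).comp measurable_fst)) ?_
    exact ((measurable_clusterSize_blockRoot s k).comp measurable_fst).sub_const 1
  refine Measurable.ite (measurableSet_lt measurable_const hk.snd) (Measurable.prodMk ?_ ?_) hk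
  · refine measurable_apply_apply (g := fun (p : (ℕ → ℕ × ℝ) × (ℕ → ℕ → ℕ × ℝ)) =>
      Nat.nth (fun j => blockRoot p.1 s j = blockRoot p.1 s (k + 1)))
      (measurable_pi_lambda _ fun v => ?_) he.fst
    exact (measurable_nth (fun j => measurableSet_blockRoot_eq s j (k + 1)) v).comp measurable_fst
  · exact he.snd.const_add s

/-- The mean over the vertices `w ≤ k` of the cluster with smallest vertex `m` of the probability
that `(w, s + e) ∈ A`, where `e` is exponential. -/
noncomputable def clusterMean (s : ℝ) (A : Set (ℕ × ℝ)) (a : ℕ → ℕ × ℝ) (k m : ℕ) : ℝ≥0∞ :=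
  (clusterSize a s m k : ℝ≥0∞)⁻¹ * ∑ w ∈ Finset.range (k + 1),
    if blockRoot a s w = m then expMeasure 1 {e | (w, s + e) ∈ A} else 0

open Classical in
/-- The conditional probability given `a` that the edge number `k` of the spliced tree
belongs to `A`. -/
noncomputable def spliceMass (s : ℝ) (A : Set (ℕ × ℝ)) (k : ℕ) (a : ℕ → ℕ × ℝ) : ℝ≥0∞ :=
  if s < (a k).2 then clusterMean s A a k (blockRoot a s (k + 1)) else A.indicator 1 (a k)

theorem measurableSet_shift {A : Set (ℕ × ℝ)} (hA : MeasurableSet A) (s : ℝ) (w : ℕ) :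
    MeasurableSet {e : ℝ | (w, s + e) ∈ A} :=
  (measurable_const.prodMk (measurable_const_add s) : Measurable fun e : ℝ => (w, s + e)) hA

/-- A uniform position in the enumeration of the cluster is a uniform vertex of the cluster. -/
theorem edgeLaw_nth_eq_clusterMean {A : Set (ℕ × ℝ)} (hA : MeasurableSet A) (a : ℕ → ℕ × ℝ)
    {k m : ℕ} (hpos : 0 < clusterSize a s m k) :
    edgeLaw (clusterSize a s m k - 1)
      {x | (Nat.nth (fun j => blockRoot a s j = m) x.1, s + x.2) ∈ A} = clusterMean s A a k m := by
  have hms : MeasurableSet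
      {x : ℕ × ℝ | (Nat.nth (fun j => blockRoot a s j = m) x.1, s + x.2) ∈ A} := by
    refine (Measurable.prodMk ?_ (measurable_snd.const_add s)) hA
    exact (Measurable.of_discrete (f := Nat.nth fun j => blockRoot a s j = m)).comp measurable_fst
  rw [← lintegral_indicator_one hms, lintegral_edgeLaw _ (measurable_one.indicator hms), clusterMean,
    ← Nat.sum_range_count (fun j => blockRoot a s j = m)
      (fun w => expMeasure 1 {e | (w, s + e) ∈ A}), ← clusterSize]
  obtain ⟨N, hN⟩ := Nat.exists_eq_succ_of_ne_zero hpos.ne'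
  rw [hN, Nat.succ_eq_add_one, Nat.add_sub_cancel]
  push_cast
  congr 1
  refine Finset.sum_congr rfl fun v _ => ?_
  rw [← lintegral_indicator_one (measurableSet_shift hA s _)]
  rfl

/-- A sequence of independent trees is a doubly indexed family of independent edges, so events on
distinct entries factor. -/
theorem infinitePi_treeLaw_forall_mem {K : Finset ℕ} {f : ℕ → ℕ × ℕ}
    (hf : Set.InjOn f K) {A : ℕ → Set (ℕ × ℝ)} (hA : ∀ k, MeasurableSet (A k)) :
    (Measure.infinitePi fun _ : ℕ => treeLaw) {b | ∀ k ∈ K, b (f k).1 (f k).2 ∈ A k} =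
      ∏ k ∈ K, edgeLaw (f k).2 (A k) := by
  have h1 : (Measure.infinitePi fun _ : ℕ => treeLaw) =
      (Measure.infinitePi fun p : ℕ × ℕ => edgeLaw p.2).map (MeasurableEquiv.curry ℕ ℕ (ℕ × ℝ)) :=
    (Measure.infinitePi_map_curry fun _ k => edgeLaw k).symm
  have hm : MeasurableSet {b : ℕ → ℕ → ℕ × ℝ | ∀ k ∈ K, b (f k).1 (f k).2 ∈ A k} := by
    have : {b : ℕ → ℕ → ℕ × ℝ | ∀ k ∈ K, b (f k).1 (f k).2 ∈ A k} =
        ⋂ k ∈ K, (fun b => b (f k).1 (f k).2) ⁻¹' A k := by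
      ext b
      simp
    rw [this]
    refine Finset.measurableSet_biInter _ fun k _ => ?_
    exact ((measurable_pi_apply (f k).2).comp (measurable_pi_apply (f k).1)) (hA k)
  have hinj : Function.Injective fun k : K => f k := fun k k' h =>
    Subtype.ext (hf k.2 k'.2 h)
  have h2 : {c : ℕ × ℕ → ℕ × ℝ | ∀ k ∈ K, c (f k) ∈ A k} =
      (fun (c : ℕ × ℕ → ℕ × ℝ) (k : K) => c (f k)) ⁻¹'
        Set.pi (Finset.univ : Finset K) fun k => A k := by
    ext c
    simp
  rw [h1, Measure.map_apply (MeasurableEquiv.measurable _) hm]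
  change (Measure.infinitePi fun p : ℕ × ℕ => edgeLaw p.2) {c | ∀ k ∈ K, c (f k) ∈ A k} = _
  have h3 : Measurable fun (c : ℕ × ℕ → ℕ × ℝ) (k : K) => c (f k) :=
    measurable_pi_lambda _ fun k => measurable_pi_apply _
  have h4 : MeasurableSet (Set.pi ((Finset.univ : Finset K) : Set K) fun k : K => A k) :=
    MeasurableSet.pi (Set.to_countable _) fun k _ => hA k
  rw [h2, ← Measure.map_apply h3 h4,
    Measure.map_infinitePi_infinitePi_of_inj (P := fun p : ℕ × ℕ => edgeLaw p.2) hinj,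
    Measure.infinitePi_pi (fun k : K => edgeLaw (f k).2) (t := fun k : K => A k) fun k _ => hA k,
    Finset.univ_eq_attach,
    Finset.prod_attach K fun k => edgeLaw (f k).2 (A k)]

/-- Given `a`, the edges of the spliced tree are independent: edges dead at time `s` are
deterministic, and the others read distinct entries of `b`. -/
theorem infinitePi_splice_mem {A : ℕ → Set (ℕ × ℝ)} (hA : ∀ k, MeasurableSet (A k))
    (a : ℕ → ℕ × ℝ) (n : ℕ) :
    (Measure.infinitePi fun _ : ℕ => treeLaw) {b | ∀ k < n, splice s a b k ∈ A k} =
      ∏ k ∈ Finset.range n, spliceMass s (A k) k a := by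
  classical
  -- A dead edge outside its set makes both sides zero; otherwise dead edges impose no condition.
  by_cases hdead : ∃ k < n, (a k).2 ≤ s ∧ a k ∉ A k
  · obtain ⟨k, hk, hks, hkA⟩ := hdead
    have : {b : ℕ → ℕ → ℕ × ℝ | ∀ k < n, splice s a b k ∈ A k} = ∅ := by
      ext b
      simp only [Set.mem_ofPred_eq, Set.mem_empty_iff_false, iff_false]
      intro h
      have := h k hk
      rw [splice_of_le hks] at this
      exact hkA this
    rw [this, measure_empty, eq_comm]
    refine Finset.prod_eq_zero (Finset.mem_range.2 hk) ?_
    rw [spliceMass, if_neg (not_lt.2 hks), Set.indicator_of_notMem hkA]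
  · push Not at hdead
    let K := (Finset.range n).filter fun k => s < (a k).2
    let f : ℕ → ℕ × ℕ := fun k =>
      (blockRoot a s (k + 1), clusterSize a s (blockRoot a s (k + 1)) k - 1)
    let B : ℕ → Set (ℕ × ℝ) := fun k =>
      {x | (Nat.nth (fun j => blockRoot a s j = blockRoot a s (k + 1)) x.1, s + x.2) ∈ A k}
    have hB : ∀ k, MeasurableSet (B k) := fun k => by
      refine (Measurable.prodMk ?_ (measurable_snd.const_add s)) (hA k)
      exact (Measurable.of_discrete
        (f := Nat.nth fun j => blockRoot a s j = blockRoot a s (k + 1))).comp measurable_fst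
    -- Two vertices of the same cluster have different positions in its enumeration.
    have hf : Set.InjOn f K := by
      intro k hk k' hk' h
      have hk2 := (Finset.mem_filter.1 hk).2
      have hk2' := (Finset.mem_filter.1 hk').2
      have h1 : blockRoot a s (k + 1) = blockRoot a s (k' + 1) := congrArg Prod.fst h
      have h2 : clusterSize a s (blockRoot a s (k + 1)) k - 1 =
        clusterSize a s (blockRoot a s (k' + 1)) k' - 1 := congrArg Prod.snd h
      have p1 := clusterSize_blockRoot_succ_pos hk2
      have p2 := clusterSize_blockRoot_succ_pos hk2'
      have h3 : clusterSize a s (blockRoot a s (k' + 1)) k =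
          clusterSize a s (blockRoot a s (k' + 1)) k' := by
        rw [h1] at h2 p1
        omega
      have := Nat.count_injective (p := fun j => blockRoot a s j = blockRoot a s (k' + 1)) h1 rfl h3
      omega
    have hset : {b : ℕ → ℕ → ℕ × ℝ | ∀ k < n, splice s a b k ∈ A k} =
        {b | ∀ k ∈ K, b (f k).1 (f k).2 ∈ B k} := by
      ext b
      simp only [Set.mem_ofPred_eq]
      constructor
      · intro h k hk
        obtain ⟨hk1, hk2⟩ := Finset.mem_filter.1 hk
        have := h k (Finset.mem_range.1 hk1)
        rw [splice_of_lt hk2] at this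
        exact this
      · intro h k hk
        by_cases hks : s < (a k).2
        · rw [splice_of_lt hks]
          exact h k (Finset.mem_filter.2 ⟨Finset.mem_range.2 hk, hks⟩)
        · rw [splice_of_le (not_lt.1 hks)]
          exact hdead k hk (not_lt.1 hks)
    rw [hset, infinitePi_treeLaw_forall_mem hf hB, Finset.prod_filter]
    refine Finset.prod_congr rfl fun k hk => ?_
    rw [spliceMass]
    split_ifs with h
    · exact edgeLaw_nth_eq_clusterMean (hA k) a (clusterSize_blockRoot_succ_pos h)
    · rw [Set.indicator_of_mem (hdead k (Finset.mem_range.1 hk) (not_lt.1 h))]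
      rfl

theorem measurable_spliceMass {A : Set (ℕ × ℝ)} (hA : MeasurableSet A) (s : ℝ) (k : ℕ) :
    Measurable (spliceMass s A k) := by
  classical
  have hk : Measurable fun a : ℕ → ℕ × ℝ => a k := measurable_pi_apply k
  refine Measurable.ite (measurableSet_lt measurable_const hk.snd) ?_
    ((measurable_one.indicator hA).comp hk)
  refine Measurable.mul (Measurable.inv ?_) (Finset.measurable_sum _ fun w _ => ?_)
  · exact (Measurable.of_discrete (f := fun N : ℕ => (N : ℝ≥0∞))).comp
      (measurable_clusterSize_blockRoot s k)
  · exact Measurable.ite (measurableSet_blockRoot_eq s w (k + 1)) measurable_const measurable_const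

theorem clusterMean_congr {A : Set (ℕ × ℝ)} {a a' : ℕ → ℕ × ℝ} {k : ℕ} (h : ∀ j < k, a j = a' j)
    (m : ℕ) : clusterMean s A a k m = clusterMean s A a' k m := by
  rw [clusterMean, clusterMean, clusterSize_congr h]
  congr 1
  refine Finset.sum_congr rfl fun w hw => ?_
  rw [blockRoot_congr fun i hi => h i (by have := Finset.mem_range.1 hw; omega)]

theorem spliceMass_congr {A : Set (ℕ × ℝ)} {a a' : ℕ → ℕ × ℝ} {k : ℕ} (h : ∀ j ≤ k, a j = a' j) :
    spliceMass s A k a = spliceMass s A k a' := by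
  rw [spliceMass, spliceMass, h k le_rfl, blockRoot_congr fun i hi => h i (Nat.lt_succ_iff.1 hi),
    clusterMean_congr fun i hi => h i hi.le]

/-- A uniform vertex of the cluster of a uniform vertex is again uniform: each `w` is counted once
for every `v` in its cluster, with weight the inverse of the size of that cluster. -/
theorem sum_clusterMean (A : Set (ℕ × ℝ)) (a : ℕ → ℕ × ℝ) (k : ℕ) :
    ∑ v ∈ Finset.range (k + 1), clusterMean s A a k (blockRoot a s v) =
      ∑ w ∈ Finset.range (k + 1), expMeasure 1 {e | (w, s + e) ∈ A} := by
  simp only [clusterMean, Finset.mul_sum]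
  rw [Finset.sum_comm]
  refine Finset.sum_congr rfl fun w hw => ?_
  have hterm : ∀ v, (clusterSize a s (blockRoot a s v) k : ℝ≥0∞)⁻¹ *
      (if blockRoot a s w = blockRoot a s v then expMeasure 1 {e | (w, s + e) ∈ A} else 0) =
      if blockRoot a s v = blockRoot a s w then (clusterSize a s (blockRoot a s w) k : ℝ≥0∞)⁻¹ *
        expMeasure 1 {e | (w, s + e) ∈ A} else 0 := by
    intro v
    by_cases h : blockRoot a s v = blockRoot a s w
    · rw [if_pos h.symm, if_pos h, h]
    · rw [if_neg (Ne.symm h), if_neg h, mul_zero]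
  simp only [hterm]
  rw [← Finset.sum_filter, Finset.sum_const, ← Nat.count_eq_card_filter_range, ← clusterSize,
    nsmul_eq_mul, ← mul_assoc, ENNReal.mul_inv_cancel, one_mul]
  · rw [Nat.cast_ne_zero, clusterSize, Nat.count_ne_iff_exists]
    exact ⟨w, Finset.mem_range.1 hw, rfl⟩
  · exact ENNReal.natCast_ne_top _

/-- If edge `k` dies by time `s`, nothing is changed. If it survives, its parent picks a cluster
with probability proportional to its size, the new parent is uniform in that cluster and hence
uniform overall, and the new removal time has the right law by memorylessness. -/
theorem lintegral_spliceMass_update (hs : 0 ≤ s) {A : Set (ℕ × ℝ)} (hA : MeasurableSet A)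
    (a : ℕ → ℕ × ℝ) (k : ℕ) :
    ∫⁻ x, spliceMass s A k (Function.update a k x) ∂edgeLaw k = edgeLaw k A := by
  classical
  have hcongr : ∀ x : ℕ × ℝ, ∀ j < k, Function.update a k x j = a j := fun x j hj =>
    Function.update_of_ne (by omega) _ _
  have hval : ∀ x : ℕ × ℝ, spliceMass s A k (Function.update a k x) =
      if s < x.2 then clusterMean s A a k (blockRoot a s (min x.1 k)) else A.indicator 1 x := by
    intro x
    rw [spliceMass, Function.update_self]
    split_ifs with h
    · rw [clusterMean_congr (hcongr x), blockRoot_succ_of_lt' (by simpa using h),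
        Function.update_self,
        blockRoot_congr fun j hj => hcongr x j (hj.trans_le (min_le_right _ _))]
    · rfl
  have hmeas : Measurable fun x : ℕ × ℝ => if s < x.2 then
      clusterMean s A a k (blockRoot a s (min x.1 k)) else A.indicator 1 x := by
    refine Measurable.ite (measurableSet_lt measurable_const measurable_snd) ?_
      (measurable_one.indicator hA)
    exact (Measurable.of_discrete
      (f := fun v : ℕ => clusterMean s A a k (blockRoot a s (min v k)))).comp measurable_fst
  simp only [hval]
  rw [lintegral_edgeLaw k hmeas, ← lintegral_indicator_one hA,
    lintegral_edgeLaw k (measurable_one.indicator hA)]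
  congr 1
  have h1 : ∀ v ∈ Finset.range (k + 1), ∫⁻ e, (if s < e then
      clusterMean s A a k (blockRoot a s (min v k)) else A.indicator 1 (v, e)) ∂expMeasure 1 =
      ENNReal.ofReal (Real.exp (-s)) * clusterMean s A a k (blockRoot a s v) +
        ∫⁻ e in (Set.Ioi s)ᶜ, A.indicator 1 (v, e) ∂expMeasure 1 := by
    intro v hv
    rw [min_eq_left (Nat.lt_succ_iff.1 (Finset.mem_range.1 hv)),
      ← lintegral_add_compl _ (measurableSet_Ioi (a := s))]
    congr 1
    · refine (setLIntegral_congr_fun measurableSet_Ioi (g := fun _ =>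
        clusterMean s A a k (blockRoot a s v)) fun e he => if_pos he).trans ?_
      rw [setLIntegral_const, expMeasure_Ioi hs, mul_comm]
    · exact setLIntegral_congr_fun measurableSet_Ioi.compl fun e he => if_neg he
  have h2 : ∀ v ∈ Finset.range (k + 1), ∫⁻ e, A.indicator 1 (v, e) ∂expMeasure 1 =
      ENNReal.ofReal (Real.exp (-s)) * expMeasure 1 {e | (v, s + e) ∈ A} +
        ∫⁻ e in (Set.Ioi s)ᶜ, A.indicator 1 (v, e) ∂expMeasure 1 := by
    intro v _
    have hm : Measurable fun e : ℝ => (A.indicator 1 (v, e) : ℝ≥0∞) :=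
      (measurable_one.indicator hA).comp (measurable_const.prodMk measurable_id)
    rw [← lintegral_add_compl _ (measurableSet_Ioi (a := s)), lintegral_expMeasure_Ioi hs hm,
      ← lintegral_indicator_one (measurableSet_shift hA s v)]
    rfl
  rw [Finset.sum_congr rfl h1, Finset.sum_congr rfl h2, Finset.sum_add_distrib,
    Finset.sum_add_distrib, ← Finset.mul_sum, ← Finset.mul_sum, sum_clusterMean]

/-- Induction by integrating out the last edge: the other factors do not depend on it, and its own
factor has a mean not depending on the earlier edges. -/
theorem lintegral_prod_spliceMass (hs : 0 ≤ s) {A : ℕ → Set (ℕ × ℝ)}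
    (hA : ∀ k, MeasurableSet (A k)) (n : ℕ) :
    ∫⁻ a, ∏ k ∈ Finset.range n, spliceMass s (A k) k a ∂treeLaw =
      ∏ k ∈ Finset.range n, edgeLaw k (A k) := by
  induction n with
  | zero => simp
  | succ n ih =>
    have hmp := measurePreserving_update_infinitePi edgeLaw n
    have hprod : ∀ n, Measurable fun a => ∏ k ∈ Finset.range n, spliceMass s (A k) k a := fun n =>
      Finset.measurable_prod _ fun k _ => measurable_spliceMass (hA k) s k
    have h1 : ∫⁻ a, ∏ k ∈ Finset.range (n + 1), spliceMass s (A k) k a ∂treeLaw =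
        ∫⁻ a, ∫⁻ x, ∏ k ∈ Finset.range (n + 1), spliceMass s (A k) k (Function.update a n x)
          ∂edgeLaw n ∂treeLaw := by
      rw [treeLaw, ← hmp.lintegral_comp (hprod (n + 1))]
      exact lintegral_prod _ ((hprod (n + 1)).comp hmp.measurable).aemeasurable
    rw [h1, Finset.prod_range_succ, ← ih, ← lintegral_mul_const _ (hprod n)]
    refine lintegral_congr fun a => ?_
    rw [← lintegral_spliceMass_update hs (hA n) a n, ← lintegral_const_mul]
    · refine lintegral_congr fun x => ?_
      rw [Finset.prod_range_succ]
      congr 1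
      refine Finset.prod_congr rfl fun k hk => spliceMass_congr fun j hj => ?_
      have := Finset.mem_range.1 hk
      exact Function.update_of_ne (by omega) _ _
    · exact (measurable_spliceMass (hA n) s n).comp (measurable_update a)

theorem measurePreserving_splice (hs : 0 ≤ s) :
    MeasurePreserving (fun p : (ℕ → ℕ × ℝ) × (ℕ → ℕ → ℕ × ℝ) => splice s p.1 p.2)
      (treeLaw.prod (Measure.infinitePi fun _ : ℕ => treeLaw)) treeLaw := by
  classical
  have hm := measurable_splice s
  refine ⟨hm, Measure.eq_infinitePi edgeLaw fun S A hA => ?_⟩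
  obtain ⟨n, hn⟩ : ∃ n, S ⊆ Finset.range n := S.exists_nat_subset_range
  -- The conditions are padded to an initial segment of edges, as the induction requires.
  let A' : ℕ → Set (ℕ × ℝ) := fun k => if k ∈ S then A k else Set.univ
  have hA' : ∀ k, MeasurableSet (A' k) := fun k => by
    by_cases h : k ∈ S <;> simp [A', h, hA k]
  have hset : Set.pi S A = {c : ℕ → ℕ × ℝ | ∀ k < n, c k ∈ A' k} := by
    ext c
    simp only [Set.mem_pi, Finset.mem_coe, Set.mem_ofPred_eq, A']
    constructor
    · intro h k _
      by_cases hk : k ∈ S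
      · simpa [hk] using h k hk
      · simp [hk]
    · intro h k hk
      simpa [hk] using h k (Finset.mem_range.1 (hn hk))
  have hms : MeasurableSet (Set.pi (S : Set ℕ) A) :=
    MeasurableSet.pi S.countable_toSet fun k _ => hA k
  rw [Measure.map_apply hm hms, Measure.prod_apply (hm hms)]
  have hsec : ∀ a : ℕ → ℕ × ℝ, (Measure.infinitePi fun _ : ℕ => treeLaw)
      (Prod.mk a ⁻¹' ((fun p : (ℕ → ℕ × ℝ) × (ℕ → ℕ → ℕ × ℝ) => splice s p.1 p.2) ⁻¹'
        Set.pi S A)) = ∏ k ∈ Finset.range n, spliceMass s (A' k) k a := by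
    intro a
    rw [hset, ← infinitePi_splice_mem hA']
    rfl
  rw [lintegral_congr hsec, lintegral_prod_spliceMass hs hA',
    ← Finset.prod_subset (s₁ := S) hn fun k _ hk => by simp [A', hk]]
  exact Finset.prod_congr rfl fun k hk => by simp [A', hk]

end SpliceLaw

/-! ### The ranked weights of a tree -/

theorem SamePositive.const_mul {ι κ : Type*} {c : ℕ → ℝ} (hc : ∀ m, 0 ≤ c m) {x : ℕ → ι → ℝ}
    {y : ℕ → κ → ℝ} (h : ∀ m, SamePositive (x m) (y m)) :
    SamePositive (fun p : ℕ × ι => c p.1 * x p.1 p.2) (fun p : ℕ × κ => c p.1 * y p.1 p.2) := by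
  choose e he using h
  refine ⟨⟨fun p => ⟨(p.1.1, (e p.1.1 ⟨p.1.2, pos_of_mul_pos_right p.2 (hc _)⟩).1), ?_⟩,
    fun p => ⟨(p.1.1, ((e p.1.1).symm ⟨p.1.2, pos_of_mul_pos_right p.2 (hc _)⟩).1), ?_⟩, ?_, ?_⟩, ?_⟩
  · dsimp only
    rw [he]
    exact p.2
  · dsimp only
    rw [← he, Equiv.apply_symm_apply]
    exact p.2
  · rintro ⟨⟨m, i⟩, hi⟩
    simp
  · rintro ⟨⟨m, i⟩, hi⟩
    simp
  · rintro ⟨⟨m, i⟩, hi⟩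
    simp [he]

/-- The ranked weights at time `t` of the clusters of the tree `a`. -/
noncomputable def treeWeights (q : ℝ≥0∞) (t : ℝ) (a : ℕ → ℕ × ℝ) : LqDown q :=
  rankedWeights q (fun k (a : ℕ → ℕ × ℝ) => (a k).1) (fun k a => (a k).2) t a

section TreeWeights

variable {q : ℝ≥0∞} {s t p : ℝ} {a : ℕ → ℕ × ℝ}

theorem measurable_treeWeights (q : ℝ≥0∞) [Fact (1 ≤ q)] (t : ℝ) : Measurable (treeWeights q t) :=
  measurable_rankedWeights (fun k => (measurable_pi_apply k).fst)
    (fun k => (measurable_pi_apply k).snd) q t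

theorem treeWeights_eq (ha : ParentsEarlier a) :
    treeWeights q t a = LqDown.ofSeq q (decRearr (vertexWeight a t)) := by
  rw [(samePositive_vertexWeight_blockWeight ha t).decRearr_eq]
  rfl

theorem samePositive_treeWeights (hp : 0 < p) (hpq : ENNReal.ofReal p ≤ q) (ha : ParentsEarlier a)
    (h : powerSum p (vertexWeight a t) ≠ ⊤) :
    SamePositive (fun i => treeWeights q t a i) (vertexWeight a t) := by
  have hseq := decRearr_mem_seqs hp hpq h
  have : (fun i => treeWeights q t a i) = decRearr (vertexWeight a t) := by
    funext i
    rw [treeWeights_eq ha]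
    exact LqDown.coe_ofSeq hseq i
  rw [this]
  exact samePositive_decRearr (finite_le_of_powerSum_ne_top hp h)

theorem treeWeights_splice_of_le {b : ℕ → ℕ → ℕ × ℝ} (ha : ParentsEarlier a)
    (hb : ∀ m, ParentsEarlier (b m)) (hb' : ∀ m k, 0 < (b m k).2) {r : ℝ} (hr : r ≤ s) :
    treeWeights q r (splice s a b) = treeWeights q r a := by
  have h : clusterPartition (fun k => (splice s a b k).1) (fun k => (splice s a b k).2) r =
      clusterPartition (fun k => (a k).1) (fun k => (a k).2) r := by
    refine Setoid.ext fun i j => ?_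
    rw [clusterPartition_iff (parentsEarlier_splice ha hb), clusterPartition_iff ha,
      blockRoot_splice_of_le ha hb hb' hr, blockRoot_splice_of_le ha hb hb' hr]
  unfold treeWeights rankedWeights blockWeight
  rw [h]

theorem ae_hasPositiveWeights (ht : 0 ≤ t) : ∀ᵐ a ∂treeLaw, HasPositiveWeights a t := by
  filter_upwards [ae_hasWeight ht] with a ha m hm
  obtain ⟨w, hw, hw'⟩ := ha m
  exact ⟨w, hw hm, hw'⟩

theorem ae_infinitePi_treeLaw {Q : (ℕ → ℕ × ℝ) → Prop} (h : ∀ᵐ a ∂treeLaw, Q a) :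
    ∀ᵐ b ∂(Measure.infinitePi fun _ : ℕ => treeLaw), ∀ m, Q (b m) :=
  ae_all_iff.2 fun m =>
    (measurePreserving_eval_infinitePi (fun _ : ℕ => treeLaw) m).quasiMeasurePreserving.ae h

/-- The ranking of the family `(c i ^ (e ^ (-t)) * z i j : i, j)`. -/
noncomputable def rankedProduct {ι : Type*} (q : ℝ≥0∞) (t : ℝ) (c : ι → ℝ) (z : ι → LqDown q) :
    LqDown q :=
  LqDown.ofSeq q (decRearr fun p : ι × ℕ => c p.1 ^ Real.exp (-t) * z p.1 p.2)

theorem measurable_rankedProduct {ι : Type*} [Countable ι] [Fact (1 ≤ q)] (t : ℝ) (c : ι → ℝ) :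
    Measurable (rankedProduct q t c) := by
  refine LqDown.measurable_ofSeq (y := fun z : ι → LqDown q =>
    decRearr fun p : ι × ℕ => c p.1 ^ Real.exp (-t) * z p.1 p.2) (fun k => ?_)
  refine measurable_decRearr (x := fun (z : ι → LqDown q) (p : ι × ℕ) =>
    c p.1 ^ Real.exp (-t) * z p.1 p.2) (fun p => ?_) k
  have h : Measurable fun z : ι → LqDown q => z p.1 p.2 :=
    (LqDown.measurable_coord p.2).comp (measurable_pi_apply p.1)
  exact measurable_const.mul h

theorem treeWeights_splice (hp : 0 < p) (hpq : ENNReal.ofReal p ≤ q) (ht : 0 ≤ t)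
    {b : ℕ → ℕ → ℕ × ℝ} (ha : ParentsEarlier a) (hb : ∀ m, ParentsEarlier (b m))
    (hb' : ∀ m k, 0 < (b m k).2) (hwa : HasPositiveWeights a s)
    (hwb : ∀ m, HasPositiveWeights (b m) t) (hpb : ∀ m, powerSum p (vertexWeight (b m) t) ≠ ⊤) :
    treeWeights q (s + t) (splice s a b) =
      rankedProduct q t (vertexWeight a s) fun m => treeWeights q t (b m) := by
  rw [treeWeights_eq (parentsEarlier_splice ha hb), rankedProduct,
    ← (samePositive_splice ht ha hb hb' hwa hwb).decRearr_eq]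
  congr 1
  refine (SamePositive.const_mul (c := fun m => vertexWeight a s m ^ Real.exp (-t))
    (x := fun m => vertexWeight (b m) t) (y := fun m i => treeWeights q t (b m) i)
    (fun m => Real.rpow_nonneg (hwa.nonneg m) _) fun m => ?_).decRearr_eq
  exact (samePositive_treeWeights hp hpq (hb m) (hpb m)).symm

theorem rankedProduct_eq_comp {ι κ : Type*} {c : ι → ℝ} {d : κ → ℝ} (hd : ∀ j, 0 ≤ d j) (g : ι → κ)
    (hg : Function.Injective g) (hgd : ∀ i, d (g i) = c i) (hsurj : ∀ j, 0 < d j → ∃ i, g i = j)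
    (z : κ → LqDown q) : rankedProduct q t d z = rankedProduct q t c fun i => z (g i) := by
  unfold rankedProduct
  congr 1
  refine (SamePositive.of_map (fun p : ι × ℕ => (g p.1, p.2)) ?_ ?_ ?_).symm.decRearr_eq
  · rintro ⟨i, n⟩ ⟨i', n'⟩ - - h
    obtain ⟨h1, h2⟩ := Prod.mk.inj h
    exact Prod.ext (hg h1) h2
  · rintro ⟨i, n⟩ -
    dsimp only
    rw [hgd]
  · rintro ⟨j, n⟩ hj
    have hpos : 0 < d j := by
      refine (hd j).lt_of_ne fun h0 => ?_
      dsimp only at hj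
      rw [← h0, Real.zero_rpow (Real.exp_pos _).ne', zero_mul] at hj
      exact lt_irrefl _ hj
    obtain ⟨i, rfl⟩ := hsurj j hpos
    refine ⟨(i, n), ?_, rfl⟩
    rw [← hgd]
    exact hj

/-- Zero coefficients contribute no positive term, and independent, identically distributed entries
may be relabelled. Both sides equal the law for the family indexed by the positive terms of `c`.
This replaces clusters indexed by vertices with ranked clusters. -/
theorem map_rankedProduct_eq [Fact (1 ≤ q)] {c d : ℕ → ℝ} (hc : ∀ i, 0 ≤ c i) (hd : ∀ i, 0 ≤ d i)
    (h : SamePositive c d) (t : ℝ) (ν : Measure (LqDown q)) [IsProbabilityMeasure ν] :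
    (Measure.infinitePi fun _ : ℕ => ν).map (rankedProduct q t c) =
      (Measure.infinitePi fun _ : ℕ => ν).map (rankedProduct q t d) := by
  obtain ⟨e, he⟩ := h
  have key : ∀ (d : ℕ → ℝ), (∀ i, 0 ≤ d i) → ∀ g : {i // 0 < c i} → ℕ, Function.Injective g →
      (∀ i, d (g i) = c i) → (∀ j, 0 < d j → ∃ i, g i = j) →
      (Measure.infinitePi fun _ : ℕ => ν).map (rankedProduct q t d) =
        (Measure.infinitePi fun _ : {i // 0 < c i} => ν).map
          (rankedProduct q t fun i : {i // 0 < c i} => c i) := by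
    intro d hd g hg hgd hsurj
    rw [← Measure.map_infinitePi_infinitePi_of_inj (P := fun _ : ℕ => ν) hg,
      Measure.map_map (measurable_rankedProduct t _)
        (measurable_pi_lambda _ fun i => measurable_pi_apply _)]
    congr 1
    funext z
    exact rankedProduct_eq_comp hd g hg hgd hsurj z
  rw [key c hc Subtype.val Subtype.val_injective (fun _ => rfl) fun j hj => ⟨⟨j, hj⟩, rfl⟩,
    key d hd (fun i => (e i).1) (Subtype.val_injective.comp e.injective) he fun j hj =>
      ⟨e.symm ⟨j, hj⟩, by simp⟩]

theorem fragLaw_eq_map [Fact (1 ≤ q)] (t : ℝ) (ν : Measure (LqDown q)) (x : LqDown q) :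
    fragLaw t ν x = (Measure.infinitePi fun _ : ℕ => ν).map (rankedProduct q t fun i => x i) := rfl

/-- The conditional law of the ranked weights at time `s + t` of the spliced tree. -/
theorem map_treeWeights_splice [Fact (1 ≤ q)] (hp : Real.exp (s + t) < p)
    (hpq : ENNReal.ofReal p ≤ q) (hs : 0 ≤ s) (ht : 0 ≤ t) : ∀ᵐ a ∂treeLaw,
    (Measure.infinitePi fun _ : ℕ => treeLaw).map
        (fun b => treeWeights q (s + t) (splice s a b)) =
      fragLaw t (treeLaw.map (treeWeights q t)) (treeWeights q s a) := by
  have hp0 : 0 < p := (Real.exp_pos _).trans hp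
  have hps : Real.exp s < p := (Real.exp_le_exp.2 (by linarith)).trans_lt hp
  have hpt : Real.exp t < p := (Real.exp_le_exp.2 (by linarith)).trans_lt hp
  have hprob : IsProbabilityMeasure (treeLaw.map (treeWeights q t)) :=
    Measure.isProbabilityMeasure_map (measurable_treeWeights q t).aemeasurable
  filter_upwards [ae_treeLaw_parentsEarlier, ae_hasPositiveWeights hs,
    ae_powerSum_vertexWeight_ne_top hs hps] with a ha hwa hpa
  have hae : (fun b => treeWeights q (s + t) (splice s a b))
      =ᵐ[Measure.infinitePi fun _ : ℕ => treeLaw]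
      rankedProduct q t (vertexWeight a s) ∘ fun b m => treeWeights q t (b m) := by
    filter_upwards [ae_infinitePi_treeLaw ae_treeLaw_parentsEarlier,
      ae_infinitePi_treeLaw ae_treeLaw_time_pos, ae_infinitePi_treeLaw (ae_hasPositiveWeights ht),
      ae_infinitePi_treeLaw (ae_powerSum_vertexWeight_ne_top ht hpt)] with b hb hb' hwb hpb
    exact treeWeights_splice hp0 hpq ht ha hb hb' hwa hwb hpb
  have hz : Measurable fun (b : ℕ → ℕ → ℕ × ℝ) (m : ℕ) => treeWeights q t (b m) :=
    measurable_pi_lambda _ fun m => (measurable_treeWeights q t).comp (measurable_pi_apply m)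
  rw [Measure.map_congr hae, ← Measure.map_map (measurable_rankedProduct t _) hz,
    Measure.infinitePi_map_pi (fun _ : ℕ => treeLaw) fun _ => measurable_treeWeights q t,
    fragLaw_eq_map]
  exact (map_rankedProduct_eq (fun i => (treeWeights q s a).2.2 i) hwa.nonneg
    (samePositive_treeWeights hp0 hpq ha hpa) t _).symm

/-- Computed in the spliced tree: up to time `s` its weights depend on `a` alone, and given `a` the
weights at time `s + t` have law `fragLaw`. Fubini's theorem then gives the integral. -/
theorem measure_splice_inter [Fact (1 ≤ q)] (hp : Real.exp (s + t) < p)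
    (hpq : ENNReal.ofReal p ≤ q) (hs : 0 ≤ s) (ht : 0 ≤ t)
    {D : Set (Set.Icc 0 s → LqDown q)} (hD : MeasurableSet D) {B : Set (LqDown q)}
    (hB : MeasurableSet B) :
    treeLaw ((fun a (r : Set.Icc 0 s) => treeWeights q r a) ⁻¹' D ∩ treeWeights q (s + t) ⁻¹' B) =
      ∫⁻ a in (fun a (r : Set.Icc 0 s) => treeWeights q r a) ⁻¹' D,
        fragLaw t (treeLaw.map (treeWeights q t)) (treeWeights q s a) B ∂treeLaw := by
  have hY : Measurable fun a (r : Set.Icc 0 s) => treeWeights q r a :=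
    measurable_pi_lambda _ fun r => measurable_treeWeights q r
  have hX := measurable_treeWeights q (s + t)
  have hmp := measurePreserving_splice hs
  have hms := (hY hD).inter (hX hB)
  rw [← hmp.measure_preimage hms.nullMeasurableSet, Measure.prod_apply (hmp.measurable hms),
    ← lintegral_indicator (hY hD)]
  refine lintegral_congr_ae ?_
  filter_upwards [map_treeWeights_splice hp hpq hs ht, ae_treeLaw_parentsEarlier] with a hlaw ha
  have hsp : Measurable fun b => treeWeights q (s + t) (splice s a b) :=
    hX.comp (hmp.measurable.comp measurable_prodMk_left)
  have hset : Prod.mk a ⁻¹' ((fun p : (ℕ → ℕ × ℝ) × (ℕ → ℕ → ℕ × ℝ) => splice s p.1 p.2) ⁻¹'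
      ((fun a (r : Set.Icc 0 s) => treeWeights q r a) ⁻¹' D ∩ treeWeights q (s + t) ⁻¹' B))
      =ᵐ[Measure.infinitePi fun _ : ℕ => treeLaw]
      ({_b | (fun r : Set.Icc 0 s => treeWeights q r a) ∈ D} ∩
        (fun b => treeWeights q (s + t) (splice s a b)) ⁻¹' B : Set (ℕ → ℕ → ℕ × ℝ)) := by
    refine eventuallyEq_set.2 ?_
    filter_upwards [ae_infinitePi_treeLaw ae_treeLaw_parentsEarlier,
      ae_infinitePi_treeLaw ae_treeLaw_time_pos] with b hb hb'
    have : (fun r : Set.Icc 0 s => treeWeights q r (splice s a b)) =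
        fun r : Set.Icc 0 s => treeWeights q r a := by
      funext r
      exact treeWeights_splice_of_le ha hb hb' r.2.2
    simp only [Set.mem_preimage, Set.mem_inter_iff, Set.mem_ofPred_eq, this]
  rw [measure_congr hset]
  by_cases haD : (fun r : Set.Icc 0 s => treeWeights q r a) ∈ D
  · rw [Set.indicator_of_mem (by exact haD), ← hlaw, Measure.map_apply hsp hB]
    congr 1
    ext b
    simp [haD]
  · rw [Set.indicator_of_notMem (by exact haD)]
    simp [haD]

end TreeWeights

/-! ### Summability of the fragments -/

/-- For finite `T` the exponent `e^T` itself works; for `T = ⊤` any exponent above `e^t` does. -/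
theorem exists_exponent {T : EReal} {t : ℝ} (h : (t : EReal) < T) :
    ∃ p, Real.exp t < p ∧ ENNReal.ofReal p ≤ EReal.exp T := by
  induction T with
  | bot => exact absurd h not_lt_bot
  | coe x => exact ⟨Real.exp x, Real.exp_lt_exp.2 (EReal.coe_lt_coe_iff.1 h), le_of_eq (by simp)⟩
  | top => exact ⟨Real.exp t + 1, lt_add_one _, by simp⟩

theorem powerSum_fragFamily {q : ℝ≥0∞} {t p : ℝ} (hp : 0 < p) (x : LqDown q) (z : ℕ → LqDown q) :
    powerSum p (fragFamily t x z) =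
      ∑' i, ENNReal.ofReal (x i) ^ (Real.exp (-t) * p) * powerSum p fun j => z i j := by
  rw [powerSum, ENNReal.tsum_prod']
  refine tsum_congr fun i => ?_
  rw [powerSum, ← ENNReal.tsum_mul_left]
  refine tsum_congr fun j => ?_
  rw [fragFamily, ENNReal.ofReal_mul (Real.rpow_nonneg (x.2.2 i) _),
    ENNReal.mul_rpow_of_nonneg _ _ hp.le, ENNReal.rpow_mul,
    ENNReal.ofReal_rpow_of_nonneg (x.2.2 i) (Real.exp_pos _).le]

section Fragments

variable {q : ℝ≥0∞} [Fact (1 ≤ q)] {s t p : ℝ}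

theorem measurable_powerSum (p : ℝ) : Measurable fun z : LqDown q => powerSum p fun j => z j :=
  Measurable.tsum fun j => (LqDown.measurable_coord j).ennreal_ofReal.pow_const _

theorem lintegral_powerSum_treeWeights_ne_top (ht : 0 ≤ t) (hp : Real.exp t < p)
    (hpq : ENNReal.ofReal p ≤ q) :
    ∫⁻ z : LqDown q, powerSum p (fun j => z j) ∂treeLaw.map (treeWeights q t) ≠ ⊤ := by
  have hp0 : 0 < p := (Real.exp_pos t).trans hp
  rw [lintegral_map (measurable_powerSum p) (measurable_treeWeights q t)]
  refine ne_top_of_le_ne_top (lintegral_powerSum_vertexWeight_ne_top ht hp) (le_of_eq ?_)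
  refine lintegral_congr_ae ?_
  filter_upwards [ae_treeLaw_parentsEarlier, ae_powerSum_vertexWeight_ne_top ht hp] with a ha hpa
  exact (samePositive_treeWeights hp0 hpq ha hpa).powerSum_eq hp0

/-- The mean over `z` factors into the power sum of exponent `e^{-t} p` of the weights at time `s`
and the mean `p`-th power sum at time `t`. The first is finite almost surely because `e^{-t} p >
e^s`. -/
theorem ae_powerSum_fragFamily_ne_top (hs : 0 ≤ s) (ht : 0 ≤ t) (hp : Real.exp (s + t) < p)
    (hpq : ENNReal.ofReal p ≤ q) : ∀ᵐ a ∂treeLaw,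
    ∀ᵐ z ∂(Measure.infinitePi fun _ : ℕ => treeLaw.map (treeWeights q t)),
      powerSum p (fragFamily t (treeWeights q s a) z) ≠ ⊤ := by
  have hp0 : 0 < p := (Real.exp_pos _).trans hp
  have hps : Real.exp s < p := (Real.exp_le_exp.2 (by linarith)).trans_lt hp
  have hpt : Real.exp t < p := (Real.exp_le_exp.2 (by linarith)).trans_lt hp
  have hpst : Real.exp s < Real.exp (-t) * p := by
    rw [Real.exp_neg, ← div_eq_inv_mul, lt_div_iff₀ (Real.exp_pos t), ← Real.exp_add]
    exact hp
  have hprob : IsProbabilityMeasure (treeLaw.map (treeWeights q t)) :=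
    Measure.isProbabilityMeasure_map (measurable_treeWeights q t).aemeasurable
  filter_upwards [ae_treeLaw_parentsEarlier, ae_powerSum_vertexWeight_ne_top hs hps,
    ae_powerSum_vertexWeight_ne_top hs hpst] with a ha hpa hpa'
  have hterm : ∀ i : ℕ, Measurable fun z : ℕ → LqDown q =>
      ENNReal.ofReal (treeWeights q s a i) ^ (Real.exp (-t) * p) * powerSum p fun j => z i j :=
    fun i => measurable_const.mul ((measurable_powerSum p).comp (measurable_pi_apply i))
  have hsum : ∫⁻ z, powerSum p (fragFamily t (treeWeights q s a) z)
      ∂(Measure.infinitePi fun _ : ℕ => treeLaw.map (treeWeights q t)) ≠ ⊤ := by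
    have heval : ∀ i : ℕ, ∫⁻ z : ℕ → LqDown q, powerSum p (fun j => z i j)
        ∂(Measure.infinitePi fun _ : ℕ => treeLaw.map (treeWeights q t)) =
        ∫⁻ z : LqDown q, powerSum p (fun j => z j) ∂treeLaw.map (treeWeights q t) := fun i =>
      (measurePreserving_eval_infinitePi (fun _ : ℕ => treeLaw.map (treeWeights q t)) i).lintegral_comp
        (measurable_powerSum p)
    simp only [powerSum_fragFamily hp0]
    rw [lintegral_tsum fun i => (hterm i).aemeasurable]
    have hmul : ∀ i : ℕ, ∫⁻ z : ℕ → LqDown q, ENNReal.ofReal (treeWeights q s a i) ^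
        (Real.exp (-t) * p) * powerSum p (fun j => z i j)
        ∂(Measure.infinitePi fun _ : ℕ => treeLaw.map (treeWeights q t)) =
        ENNReal.ofReal (treeWeights q s a i) ^ (Real.exp (-t) * p) *
          ∫⁻ z : LqDown q, powerSum p (fun j => z j) ∂treeLaw.map (treeWeights q t) := fun i => by
      have hpi : Measurable fun z : ℕ → LqDown q => powerSum p fun j => z i j :=
        (measurable_powerSum p).comp (measurable_pi_apply i)
      rw [lintegral_const_mul _ hpi, heval]
    simp only [hmul]
    rw [ENNReal.tsum_mul_right]
    refine ENNReal.mul_ne_top ?_ (lintegral_powerSum_treeWeights_ne_top ht hpt hpq)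
    have := (samePositive_treeWeights hp0 hpq ha hpa).powerSum_eq
      (p := Real.exp (-t) * p) (by positivity)
    rw [powerSum] at this
    rw [this]
    exact hpa'
  have hmeas : Measurable fun z : ℕ → LqDown q =>
      powerSum p (fragFamily t (treeWeights q s a) z) := by
    simp only [powerSum_fragFamily hp0]
    exact Measurable.tsum hterm
  filter_upwards [ae_lt_top hmeas hsum] with z hz
  exact hz.ne

end Fragments

/-! ### The Markov property of the ranked weights -/

theorem condExp_indicator_ae_eq {Ω : Type*} {m mΩ : MeasurableSpace Ω} {P : Measure Ω}
    [IsProbabilityMeasure P] (hm : m ≤ mΩ) {E : Set Ω} (hE : MeasurableSet E) {g : Ω → ℝ≥0∞}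
    (hg : Measurable[m] g) (hg1 : ∀ ω, g ω ≤ 1)
    (h : ∀ A, MeasurableSet[m] A → P (A ∩ E) = ∫⁻ ω in A, g ω ∂P) :
    P⟦E | m⟧ =ᵐ[P] fun ω => (g ω).toReal := by
  have hgm : Measurable[m] fun ω => (g ω).toReal := hg.ennreal_toReal
  refine (ae_eq_condExp_of_forall_setIntegral_eq hm ((integrable_const 1).indicator hE)
    (fun A _ _ => ?_) (fun A hA _ => ?_) hgm.stronglyMeasurable.aestronglyMeasurable).symm
  · refine Integrable.integrableOn (Integrable.of_bound
      (hgm.mono hm le_rfl).aestronglyMeasurable 1 (Eventually.of_forall fun ω => ?_))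
    rw [Real.norm_of_nonneg ENNReal.toReal_nonneg]
    exact ENNReal.toReal_le_of_le_ofReal zero_le_one (by simpa using hg1 ω)
  · rw [setIntegral_indicator hE, integral_toReal (hg.mono hm le_rfl).aemeasurable
      (Eventually.of_forall fun ω => (hg1 ω).trans_lt ENNReal.one_lt_top), ← h A hA]
    simp [measureReal_def]

theorem IsRecursiveTreeDestruction.measurable_tree {Ω : Type*} [MeasurableSpace Ω]
    {P : Measure Ω} {u : ℕ → Ω → ℕ} {ε : ℕ → Ω → ℝ} (h : IsRecursiveTreeDestruction P u ε) :
    Measurable fun ω k => (u k ω, ε k ω) :=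
  measurable_pi_lambda _ fun k => (h.measurable_parent k).prodMk (h.measurable_time k)

section Markov

variable {Ω : Type*} [MeasurableSpace Ω] {P : Measure Ω}
  {u : ℕ → Ω → ℕ} {ε : ℕ → Ω → ℝ} {q : ℝ≥0∞} [Fact (1 ≤ q)]

theorem IsRecursiveTreeDestruction.measurePreserving (h : IsRecursiveTreeDestruction P u ε) :
    MeasurePreserving (fun ω k => (u k ω, ε k ω)) P treeLaw :=
  ⟨h.measurable_tree, h.map_eq_treeLaw⟩

theorem IsRecursiveTreeDestruction.map_rankedWeights (h : IsRecursiveTreeDestruction P u ε)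
    (t : ℝ) : P.map (rankedWeights q u ε t) = treeLaw.map (treeWeights q t) := by
  rw [← h.map_eq_treeLaw, Measure.map_map (measurable_treeWeights q t) h.measurable_tree]
  rfl

theorem condExp_rankedWeights [IsProbabilityMeasure P] (h : IsRecursiveTreeDestruction P u ε) {s t p : ℝ}
    (hs : 0 ≤ s) (ht : 0 ≤ t) (hp : Real.exp (s + t) < p) (hpq : ENNReal.ofReal p ≤ q)
    {B : Set (LqDown q)} (hB : MeasurableSet B) :
    P⟦rankedWeights q u ε (s + t) ⁻¹' B |
        ⨆ r ∈ Set.Icc 0 s, MeasurableSpace.comap (rankedWeights q u ε r) inferInstance⟧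
      =ᵐ[P] fun ω => (fragLaw t (P.map (rankedWeights q u ε t)) (rankedWeights q u ε s ω)).real B := by
  have hX : ∀ r, Measurable (rankedWeights q u ε r) :=
    measurable_rankedWeights h.measurable_parent h.measurable_time q
  set ν := P.map (rankedWeights q u ε t) with hν
  have hνprob : IsProbabilityMeasure ν := Measure.isProbabilityMeasure_map (hX t).aemeasurable
  have hKprob : ∀ x, IsProbabilityMeasure (fragLaw t ν x) :=
    LqDown.isProbabilityMeasure_fragLaw t ν
  have hK : Measurable fun x => fragLaw t ν x B :=
    (Measure.measurable_coe hB).comp (LqDown.measurable_fragLaw t ν)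
  have hXm : Measurable[⨆ r ∈ Set.Icc 0 s, MeasurableSpace.comap (rankedWeights q u ε r)
      inferInstance] (rankedWeights q u ε s) := by
    rw [measurable_iff_comap_le]
    exact le_iSup₂_of_le s (Set.right_mem_Icc.2 hs) le_rfl
  refine condExp_indicator_ae_eq (iSup₂_le fun r _ => (hX r).comap_le) (hX (s + t) hB)
    (g := fun ω => fragLaw t ν (rankedWeights q u ε s ω) B) (hK.comp hXm)
    (fun ω => prob_le_one) fun A hA => ?_
  -- Every event of the history up to `s` is thus the preimage of a set of paths on `[0, s]`.
  have hle : (⨆ r ∈ Set.Icc 0 s, MeasurableSpace.comap (rankedWeights q u ε r) inferInstance) ≤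
      MeasurableSpace.comap (fun ω (r : Set.Icc 0 s) => rankedWeights q u ε r ω) inferInstance := by
    refine iSup₂_le fun r hr => ?_
    rw [← measurable_iff_comap_le]
    exact (measurable_pi_apply (⟨r, hr⟩ : Set.Icc 0 s)).comp (comap_measurable
      (fun ω (r : Set.Icc 0 s) => rankedWeights q u ε r ω))
  obtain ⟨D, hD, rfl⟩ := hle A hA
  have hmp := h.measurePreserving
  have hYc : Measurable fun a (r : Set.Icc 0 s) => treeWeights q r a :=
    measurable_pi_lambda _ fun r => measurable_treeWeights q r
  have key := measure_splice_inter hp hpq hs ht hD hB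
  rw [← h.map_rankedWeights, ← hν, ← hmp.measure_preimage
    ((hYc hD).inter (measurable_treeWeights q (s + t) hB)).nullMeasurableSet] at key
  exact key.trans
    (hmp.setLIntegral_comp_preimage (hYc hD) (hK.comp (measurable_treeWeights q s))).symm

end Markov

theorem corollary1 {Ω : Type*} [MeasurableSpace Ω] (P : Measure Ω) [IsProbabilityMeasure P]
    (u : ℕ → Ω → ℕ) (ε : ℕ → Ω → ℝ) (hTree : IsRecursiveTreeDestruction P u ε)
    (T : EReal) [Fact (0 < T)] :
    -- the ranked weights are well defined and lie in the space `ℓ^q↓` with `q = e^T`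
    (∀ t : ℝ, 0 ≤ t → (t : EReal) < T → ∀ᵐ ω ∂P,
      (∀ i, (block (clusterPartition (fun k => u k ω) (fun k => ε k ω) t) i).Nonempty →
        ∃ w : ℝ, 0 < w ∧
          HasWeight t (block (clusterPartition (fun k => u k ω) (fun k => ε k ω) t) i) w) ∧
      IsDecreasingRearrangement (decRearr (blockWeight (fun k => u k ω) (fun k => ε k ω) t))
        (blockWeight (fun k => u k ω) (fun k => ε k ω) t) ∧
      decRearr (blockWeight (fun k => u k ω) (fun k => ε k ω) t)
        ∈ LqDown.seqs (EReal.exp T)) ∧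
    -- the family describing the transition from time `s` to time `s + t` can be ranked in `ℓ^q↓`
    (∀ s t : ℝ, 0 ≤ s → 0 ≤ t → ((s + t : ℝ) : EReal) < T →
      ∀ᵐ ω ∂P, ∀ᵐ z ∂(Measure.infinitePi fun _ : ℕ => P.map (rankedWeights (EReal.exp T) u ε t)),
        IsDecreasingRearrangement
          (decRearr (fragFamily t (rankedWeights (EReal.exp T) u ε s ω) z))
          (fragFamily t (rankedWeights (EReal.exp T) u ε s ω) z) ∧
        decRearr (fragFamily t (rankedWeights (EReal.exp T) u ε s ω) z)
          ∈ LqDown.seqs (EReal.exp T)) ∧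
    -- the Markov property and the transition probabilities
    IsMarkovWith P {t : ℝ | 0 ≤ t ∧ (t : EReal) < T} (rankedWeights (EReal.exp T) u ε)
      (fun t => fragLaw t (P.map (rankedWeights (EReal.exp T) u ε t))) := by
  have hmp := hTree.measurePreserving
  refine ⟨fun t ht htT => ?_, fun s t hs ht hstT => ?_, ?_⟩
  · obtain ⟨p, hp, hpq⟩ := exists_exponent htT
    have hp0 : 0 < p := (Real.exp_pos t).trans hp
    have hae : ∀ᵐ a ∂treeLaw, ParentsEarlier a ∧ HasPositiveWeights a t ∧
        powerSum p (vertexWeight a t) ≠ ⊤ := by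
      filter_upwards [ae_treeLaw_parentsEarlier, ae_hasPositiveWeights ht,
        ae_powerSum_vertexWeight_ne_top ht hp] with a h1 h2 h3
      exact ⟨h1, h2, h3⟩
    filter_upwards [hmp.quasiMeasurePreserving.ae hae] with ω hω
    obtain ⟨h1, h2, h3⟩ := hω
    rw [(samePositive_vertexWeight_blockWeight h1 t).powerSum_eq hp0] at h3
    refine ⟨fun i hi => ?_,
      isDecreasingRearrangement_decRearr (finite_le_of_powerSum_ne_top hp0 h3),
      decRearr_mem_seqs hp0 hpq h3⟩
    obtain ⟨m, hm, hblock⟩ := exists_block_eq h1 hi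
    rw [hblock]
    exact h2 m hm
  · obtain ⟨p, hp, hpq⟩ := exists_exponent hstT
    have hp0 : 0 < p := (Real.exp_pos _).trans hp
    rw [hTree.map_rankedWeights]
    filter_upwards [hmp.quasiMeasurePreserving.ae (ae_powerSum_fragFamily_ne_top hs ht hp hpq)]
      with ω hω
    filter_upwards [hω] with z hz
    exact ⟨isDecreasingRearrangement_decRearr (finite_le_of_powerSum_ne_top hp0 hz),
      decRearr_mem_seqs hp0 hpq hz⟩
  · have hX := measurable_rankedWeights hTree.measurable_parent hTree.measurable_time (EReal.exp T)
    have hprob : ∀ t, IsProbabilityMeasure (P.map (rankedWeights (EReal.exp T) u ε t)) := fun t =>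
      Measure.isProbabilityMeasure_map (hX t).aemeasurable
    refine ⟨fun t _ => hX t, fun t _ => LqDown.measurable_fragLaw t _,
      fun t _ => LqDown.isProbabilityMeasure_fragLaw t _, fun s t hs ht hst B hB => ?_⟩
    obtain ⟨p, hp, hpq⟩ := exists_exponent hst.2
    exact condExp_rankedWeights hTree hs ht hp hpq hB
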